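/- Let $K$ be a field. All gradings are by $\mathbb Z\times\mathbb Z$ (cohomological degree, internal degree), $[1]$ shifts the cohomological degree, $(M[1])^i_j=M^{i+1}_j$, and a topologically free bigraded $K[[\hbar]]$-module is one of the form $M_\hbar=\{M^i_j[[\hbar]]\}_{i,j}$ with $M$ a bigraded $K$-vector space. Let $A_\hbar$ be a flat topological $A_\infty$-algebra with a strict unit $\eta$: $A$ is a bigraded vector space with a $K[[\hbar]]$-linear coderivation $\mathrm d_A=\sum_k \mathrm d_A^{(k)}\hbar^k$ of bidegree $(1,0)$ on the tensor coalgebra $T(A[1])[[\hbar]]$, $\mathrm d_A^2=0$, $\mathrm d_A(1)=0$, and $\eta\in A^0_0$ is a strict unit. (In particular $A_\hbar$ may be any unital associative bigraded product on $A[[\hbar]]$ of bidegree $(0,0)$ with unit $\eta\in A$, such as the deformation quantizations $A_\hbar$ of $S(X^*)$ and $B_\hbar$ of $\wedge X$ along an $\hbar$-formal quadratic Poisson bivector on a finite-dimensional vector space $X$.) A strictly unital topologically free right $A_\infty$-$A_\hbar$-module is a topologically free $M_\hbar$ with a codifferential $\mathrm d_M$ of bidegree $(1,0)$ on the cofree right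 $T(A[1])[[\hbar]]$-comodule $(M[1]\otimes T(A[1]))[[\hbar]]$, $\mathrm d_M^2=0$, such that $\eta$ acts as the identity and the Taylor components $\mathrm d_M^{n}$, $n\ge 2$, vanish when some argument is $\eta$. Morphisms are $K[[\hbar]]$-linear comodule maps $f$ of bidegree $(0,0)$ commuting with the codifferentials whose Taylor components $f^{n}:M[1]\otimes A[1]^{\otimes n}\to N[1]$, $n\ge1$, vanish when some argument from $A$ is $\eta$; $f$ is strict if $f^n=0$ for $n\ge1$. Two morphisms $f,g:M_\hbar\to N_\hbar$ are homotopic if $f-g=\mathrm d_N H+H\mathrm d_M$ for a $K[[\hbar]]$-linear comodule map $H$ of bidegree $(-1,0)$ with the same vanishing property. Let $\mathcal H=\mathcal H^{tf}_\infty(A_\hbar)$ be the resulting homotopy category; the shift $M_\hbar[1]$ carries the codifferential $-\mathrm d_M$ and $[1]$ does not change the underlying comodule maps. A sequence of strict morphisms $M_\hbar\xrightarrow{f}M'_\hbar\xrightarrow{g}M''_\hbar$ is semi-split if it is short exact in every bidegree and there is a $K[[\hbar]]$-linear map $\rho:M'_\hbar\to M_\hbar$ of bidegree $(0,0)$ with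 $\rho f=1$ and $\rho\,\mathrm d_{M'}^n=\mathrm d_M^n(\rho\otimes1)$ for $n\ge1$. 1. For every semi-split sequence with splitting $\rho$ there is a unique morphism $h:M''_\hbar\to M_\hbar[1]$ with $h\circ g=\mathrm d_M\circ(\rho\otimes1)-(\rho\otimes1)\circ\mathrm d_{M'}$; that is, on $M'=M\oplus M''$ one has $\mathrm d_{M'}(x,z)=(\mathrm d_Mx-hz,\mathrm d_{M''}z)$. 2. The category $\mathcal H$, with shift functor $[1]$ and with distinguished triangles those isomorphic in $\mathcal H$ to a triangle $M_\hbar\xrightarrow{f}M'_\hbar\xrightarrow{g}M''_\hbar\xrightarrow{h}M_\hbar[1]$ obtained from a semi-split sequence as in 1., is triangulated. 3. For every morphism $f:M_\hbar\to N_\hbar$ let $C(f)=M_\hbar[1]\oplus N_\hbar$ with $\mathrm d(x,y)=(-\mathrm d_Mx,fx+\mathrm d_Ny)$ and $\mathrm{Cyl}(f)=M_\hbar\oplus M_\hbar[1]\oplus N_\hbar$ with $\mathrm d(m,m',n)=(\mathrm d_Mm-m',-\mathrm d_Mm',fm'+\mathrm d_Nn)$. The triangles $M_\hbar\to \mathrm{Cyl}(f)\to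 C(f)\to M_\hbar[1]$ and $M_\hbar\xrightarrow{f}N_\hbar\to C(f)\to M_\hbar[1]$, with the natural inclusions and projections, are distinguished. 4. The class $\mathrm{Qis}$ of quasi-isomorphisms in $\mathcal H$ (the classes of morphisms $f$ for which $f^0$ induces isomorphisms in every bidegree on the cohomology of the differentials $\mathrm d^0$ on $M_\hbar$, $N_\hbar$) is localizing, i.e. admits a calculus of left and right fractions, and is compatible with the triangulation: $s\in\mathrm{Qis}$ if and only if $s[1]\in\mathrm{Qis}$, and if $(a,b)$ is a morphism between the first arrows of two distinguished triangles with $a,b\in\mathrm{Qis}$, it extends to a morphism of triangles $(a,b,c)$ with $c\in\mathrm{Qis}$. Hence the derived category $\mathcal H[\mathrm{Qis}^{-1}]$ is triangulated, its distinguished triangles being those isomorphic to images of distinguished triangles of $\mathcal H$. -/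

import Mathlib

open CategoryTheory CategoryTheory.Limits TensorProduct

universe u

namespace TopAInf

noncomputable section

/-! ### Formal power series of linear maps -/

section Series

variable {K : Type u} [Field K] {U V W X : Type u} [AddCommGroup U] [Module K U]
  [AddCommGroup V] [Module K V] [AddCommGroup W] [Module K W] [AddCommGroup X] [Module K X]

/-- `Ser K V W` is `Hom(V, W)⟦ħ⟧`, identified with the `K⟦ħ⟧`-linear maps `V⟦ħ⟧ → W⟦ħ⟧`. -/
abbrev Ser (K : Type u) [Field K] (V W : Type u) [AddCommGroup V] [Module K V]
    [AddCommGroup W] [Module K W] : Type u := ℕ → (V →ₗ[K] W)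

/-- Composition of power series of linear maps (Cauchy product), `g` after `f`. -/
def Ser.comp (g : Ser K V W) (f : Ser K U V) : Ser K U W :=
  fun n => ∑ p ∈ Finset.HasAntidiagonal.antidiagonal n, g p.1 ∘ₗ f p.2

/-- The series `l + 0 ħ + 0 ħ² + ⋯`. -/
def Ser.const (l : V →ₗ[K] W) : Ser K V W := fun n => if n = 0 then l else 0

/-- The map `V⟦ħ⟧ → W⟦ħ⟧` given by a power series of linear maps; the elements of `V⟦ħ⟧` are
the sequences of their coefficients. -/
def Ser.eval (f : Ser K V W) : (ℕ → V) →ₗ[K] (ℕ → W) :=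
  LinearMap.pi fun n => ∑ p ∈ Finset.HasAntidiagonal.antidiagonal n, f p.1 ∘ₗ LinearMap.proj p.2

lemma Ser.comp_assoc (h : Ser K W X) (g : Ser K V W) (f : Ser K U V) :
    (h.comp g).comp f = h.comp (g.comp f) := by
  funext n
  ext x
  simp only [Ser.comp, LinearMap.sum_apply, LinearMap.comp_apply, map_sum]
  rw [Finset.sum_sigma', Finset.sum_sigma']
  refine Finset.sum_nbij' (fun ⟨⟨_, j⟩, ⟨k, l⟩⟩ ↦ ⟨(k, l + j), (l, j)⟩)
    (fun ⟨⟨i, _⟩, ⟨k, l⟩⟩ ↦ ⟨(i + k, l), (i, k)⟩) ?_ ?_ ?_ ?_ ?_ <;>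
    simp only [Finset.mem_sigma, Finset.HasAntidiagonal.mem_antidiagonal, Sigma.forall, Prod.forall] <;>
    rintro a b c d ⟨rfl, rfl⟩ <;> simp [add_assoc]

lemma Ser.const_comp (l : V →ₗ[K] W) (f : Ser K U V) :
    (Ser.const l).comp f = fun n => l ∘ₗ f n := by
  funext n
  simp only [Ser.comp, Ser.const]
  rw [Finset.sum_eq_single (0, n)]
  · simp
  · rintro ⟨i, j⟩ hb hne
    have : i ≠ 0 := by
      rintro rfl
      simp at hb
      exact hne (by simp [hb])
    simp [this]
  · simp

lemma Ser.comp_const (f : Ser K V W) (l : U →ₗ[K] V) :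
    f.comp (Ser.const l) = fun n => f n ∘ₗ l := by
  funext n
  simp only [Ser.comp, Ser.const]
  rw [Finset.sum_eq_single (n, 0)]
  · simp
  · rintro ⟨i, j⟩ hb hne
    have : j ≠ 0 := by
      rintro rfl
      simp at hb
      exact hne (by simp [hb])
    simp [this]
  · simp

lemma Ser.add_comp (g g' : Ser K V W) (f : Ser K U V) :
    (g + g').comp f = g.comp f + g'.comp f := by
  funext n; simp [Ser.comp, LinearMap.add_comp, Finset.sum_add_distrib]

lemma Ser.comp_add (g : Ser K V W) (f f' : Ser K U V) :
    g.comp (f + f') = g.comp f + g.comp f' := by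
  funext n; simp [Ser.comp, LinearMap.comp_add, Finset.sum_add_distrib]

lemma Ser.smul_comp (c : K) (g : Ser K V W) (f : Ser K U V) :
    (c • g).comp f = c • g.comp f := by
  funext n; simp [Ser.comp, LinearMap.smul_comp, Finset.smul_sum]

lemma Ser.comp_smul (c : K) (g : Ser K V W) (f : Ser K U V) :
    g.comp (c • f) = c • g.comp f := by
  funext n; simp [Ser.comp, LinearMap.comp_smul, Finset.smul_sum]

lemma Ser.neg_comp (g : Ser K V W) (f : Ser K U V) : (-g).comp f = -g.comp f := by
  funext n; simp [Ser.comp, LinearMap.neg_comp]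

lemma Ser.comp_neg (g : Ser K V W) (f : Ser K U V) : g.comp (-f) = -g.comp f := by
  funext n; simp [Ser.comp, LinearMap.comp_neg]

lemma Ser.sub_comp (g g' : Ser K V W) (f : Ser K U V) :
    (g - g').comp f = g.comp f - g'.comp f := by
  rw [sub_eq_add_neg, Ser.add_comp, Ser.neg_comp, sub_eq_add_neg]

lemma Ser.comp_sub (g : Ser K V W) (f f' : Ser K U V) :
    g.comp (f - f') = g.comp f - g.comp f' := by
  rw [sub_eq_add_neg, Ser.comp_add, Ser.comp_neg, sub_eq_add_neg]

lemma Ser.zero_comp (f : Ser K U V) : (0 : Ser K V W).comp f = 0 := by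
  funext n; simp [Ser.comp]

lemma Ser.comp_zero (g : Ser K V W) : g.comp (0 : Ser K U V) = 0 := by
  funext n; simp [Ser.comp]

lemma Ser.id_comp (f : Ser K U V) : (Ser.const LinearMap.id).comp f = f := by
  rw [Ser.const_comp]; funext n; rfl

lemma Ser.comp_id (f : Ser K U V) : f.comp (Ser.const LinearMap.id) = f := by
  rw [Ser.comp_const]; funext n; rfl

end Series

/-! ### The tensor coalgebra -/

section Coalgebra

variable (K : Type u) [Field K] (V : Type u) [AddCommGroup V] [Module K V]

/-- Left multiplication by `v` on `T(V)`, together with the corresponding recursive step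
`x ↦ 1 ⊗ v t + (v ⊗ 1) x` for the deconcatenation of `v t`. -/
def deconcStep : V →ₗ[K] Module.End K
    (TensorAlgebra K V × (TensorAlgebra K V ⊗[K] TensorAlgebra K V)) where
  toFun v :=
    LinearMap.prod (LinearMap.mulLeft K (TensorAlgebra.ι K v) ∘ₗ LinearMap.fst K _ _)
      ((TensorProduct.mk K _ _ 1 ∘ₗ LinearMap.mulLeft K (TensorAlgebra.ι K v)) ∘ₗ
          LinearMap.fst K _ _ +
        LinearMap.rTensor _ (LinearMap.mulLeft K (TensorAlgebra.ι K v)) ∘ₗ LinearMap.snd K _ _)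
  map_add' v w := by
    have : ∀ v : V, LinearMap.mulLeft K (TensorAlgebra.ι K v) =
      LinearMap.mul K _ (TensorAlgebra.ι K v) := fun _ => rfl
    ext x <;> simp [this, add_mul, tmul_add, add_tmul]
  map_smul' c v := by
    have : ∀ v : V, LinearMap.mulLeft K (TensorAlgebra.ι K v) =
      LinearMap.mul K _ (TensorAlgebra.ι K v) := fun _ => rfl
    ext x <;> simp [this, smul_tmul']

/-- The deconcatenation coproduct
`v₁ ⋯ vₙ ↦ ∑ₖ (v₁ ⋯ vₖ) ⊗ (vₖ₊₁ ⋯ vₙ)` (`0 ≤ k ≤ n`) on `T(V)`, determined by `deconc_one` and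
`deconc_ι_mul`. -/
def deconc : TensorAlgebra K V →ₗ[K] TensorAlgebra K V ⊗[K] TensorAlgebra K V where
  toFun t := (TensorAlgebra.lift K (deconcStep K V) t (1, 1 ⊗ₜ 1)).2
  map_add' := by simp
  map_smul' := by simp

lemma deconc_aux (t : TensorAlgebra K V) (s : TensorAlgebra K V)
    (x : TensorAlgebra K V ⊗[K] TensorAlgebra K V) :
    (TensorAlgebra.lift K (deconcStep K V) t (s, x)).1 = t * s := by
  induction t using TensorAlgebra.induction generalizing s x with
  | algebraMap r => simp [Algebra.smul_def]
  | ι v => simp [deconcStep]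
  | mul a b ha hb =>
    rw [map_mul, Module.End.mul_apply, ← Prod.mk.eta (p := TensorAlgebra.lift K (deconcStep K V) b (s, x)),
      ha, hb, mul_assoc]
  | add a b ha hb => simp [ha, hb, add_mul]

lemma deconc_one : deconc K V 1 = 1 ⊗ₜ 1 := by simp [deconc]

lemma deconc_ι_mul (v : V) (t : TensorAlgebra K V) :
    deconc K V (TensorAlgebra.ι K v * t) = 1 ⊗ₜ (TensorAlgebra.ι K v * t) +
      LinearMap.rTensor _ (LinearMap.mulLeft K (TensorAlgebra.ι K v)) (deconc K V t) := by
  have := deconc_aux K V t 1 (1 ⊗ₜ 1)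
  simp only [mul_one] at this
  change (TensorAlgebra.lift K (deconcStep K V) _ _).2 = 1 ⊗ₜ (_ * t) +
    LinearMap.rTensor _ _ (TensorAlgebra.lift K (deconcStep K V) _ _).2
  rw [map_mul, Module.End.mul_apply, TensorAlgebra.lift_ι_apply]
  nth_rw 2 [← this]
  rfl

variable {K V} in
/-- To prove something on `T(V)` it suffices to treat `1` and left multiplication by `V`. -/
lemma tensor_induction {P : TensorAlgebra K V → Prop} (h1 : P 1)
    (hmul : ∀ v t, P t → P (TensorAlgebra.ι K v * t)) (hadd : ∀ s t, P s → P t → P (s + t))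
    (hsmul : ∀ (c : K) t, P t → P (c • t)) (t : TensorAlgebra K V) : P t := by
  suffices h : ∀ s : TensorAlgebra K V, ∀ t, P t → P (s * t) by simpa using h t 1 h1
  intro s
  induction s using TensorAlgebra.induction with
  | algebraMap r => intro t ht; rw [← Algebra.smul_def]; exact hsmul _ _ ht
  | ι v => exact hmul v
  | mul a b ha hb => intro t ht; rw [mul_assoc]; exact ha _ (hb _ ht)
  | add a b ha hb => intro t ht; rw [add_mul]; exact hadd _ _ (ha _ ht) (hb _ ht)

/-- The counit `T(V) → K`, the projection onto tensors of length `0`. -/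
abbrev counit : TensorAlgebra K V →ₗ[K] K := TensorAlgebra.algebraMapInv.toLinearMap

lemma counit_deconc (t : TensorAlgebra K V) :
    TensorProduct.lid K _ (LinearMap.rTensor _ (counit K V) (deconc K V t)) = t := by
  induction t using tensor_induction with
  | h1 => simp [deconc_one]
  | hmul v t ih =>
    rw [deconc_ι_mul]
    have : counit K V ∘ₗ LinearMap.mulLeft K (TensorAlgebra.ι K v) = 0 := by
      ext t; simp [TensorAlgebra.algebraMapInv]
    rw [map_add, ← LinearMap.comp_apply (LinearMap.rTensor _ (counit K V)),
      ← LinearMap.rTensor_comp, this]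
    simp
  | hadd s t hs ht => simp only [map_add, hs, ht]
  | hsmul c t ht => simp only [map_smul, ht]

end Coalgebra

/-! ### Cofree comodules over the tensor coalgebra -/

section Cofree

variable (K : Type u) [Field K] (A : Type u) [AddCommGroup A] [Module K A] (M N P : Type u)
  [AddCommGroup M] [Module K M] [AddCommGroup N] [Module K N] [AddCommGroup P] [Module K P]

/-- `M[1] ⊗ T(A[1])`; the suspensions are only visible in the degrees and in the signs below. -/
abbrev Cof : Type u := M ⊗[K] TensorAlgebra K A

/-- The right coaction of `T(A[1])` on `M[1] ⊗ T(A[1])`. -/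
def coact : Cof K A M →ₗ[K] Cof K A M ⊗[K] TensorAlgebra K A :=
  (TensorProduct.assoc K _ _ _).symm.toLinearMap ∘ₗ
    LinearMap.lTensor M (deconc K A)

/-- The projection `M[1] ⊗ T(A[1]) → M[1]`. Composing a map with it and restricting the result
to `M[1] ⊗ A[1]^{⊗ n}` gives the `n`-th Taylor component of the map. -/
def toCogen : Cof K A M →ₗ[K] M :=
  (TensorProduct.rid K _).toLinearMap ∘ₗ LinearMap.lTensor M (counit K A)

variable {M N}

/-- The map `l ⊗ 1 : M[1] ⊗ T(A[1]) → N[1] ⊗ T(A[1])`. -/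
abbrev strictMap (l : M →ₗ[K] N) : Cof K A M →ₗ[K] Cof K A N :=
  LinearMap.rTensor (TensorAlgebra K A) l

/-- `f` is a morphism of right `T(A[1])`-comodules. -/
def IsComoduleMap (f : Cof K A M →ₗ[K] Cof K A N) : Prop :=
  coact K A N ∘ₗ f = LinearMap.rTensor _ f ∘ₗ coact K A M

/-- The Taylor components `fⁿ`, `n ≥ 1`, of `f` vanish as soon as one argument from `A` is `η`. -/
def VanishesOn (η : A) (f : Cof K A M →ₗ[K] Cof K A N) : Prop :=
  ∀ m s t, toCogen K A N (f (m ⊗ₜ (s * TensorAlgebra.ι K η * t))) = 0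

variable {K A P}

lemma toCogen_tmul (m : M) (t : TensorAlgebra K A) :
    toCogen K A M (m ⊗ₜ t) = counit K A t • m := by simp [toCogen]

lemma toCogen_strictMap (l : M →ₗ[K] N) (x : Cof K A M) :
    toCogen K A N (strictMap K A l x) = l (toCogen K A M x) := by
  induction x using TensorProduct.induction_on with
  | zero => simp
  | tmul m t => simp [toCogen_tmul]
  | add x y hx hy => rw [map_add, map_add, map_add, hx, hy, map_add]

/-- A comodule map is determined by its Taylor components. -/
lemma cogen_coact (x : Cof K A M) :
    LinearMap.rTensor _ (toCogen K A M) (coact K A M x) = x := by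
  induction x using TensorProduct.induction_on with
  | zero => simp
  | tmul m t =>
    have key : ∀ y : TensorAlgebra K A ⊗[K] TensorAlgebra K A,
        LinearMap.rTensor _ (toCogen K A M) ((TensorProduct.assoc K _ _ _).symm (m ⊗ₜ y)) =
          m ⊗ₜ[K] TensorProduct.lid K _ (LinearMap.rTensor _ (counit K A) y) := by
      intro y
      induction y using TensorProduct.induction_on with
      | zero => simp
      | tmul a b => simp [toCogen_tmul, smul_tmul]
      | add a b ha hb => simp only [tmul_add, map_add, ha, hb]
    simp only [coact, LinearMap.comp_apply, LinearMap.lTensor_tmul, LinearEquiv.coe_coe]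
    rw [key, counit_deconc]
  | add x y hx hy => simp only [map_add, hx, hy]

lemma coact_strictMap (l : M →ₗ[K] N) : IsComoduleMap K A (strictMap K A l) := by
  refine TensorProduct.ext' fun m t => ?_
  simp only [coact, LinearMap.comp_apply, LinearMap.lTensor_tmul, LinearMap.rTensor_tmul,
    LinearEquiv.coe_coe]
  generalize deconc K A t = y
  induction y using TensorProduct.induction_on with
  | zero => simp
  | tmul a b => simp
  | add a b ha hb => simp only [tmul_add, map_add, ha, hb]

lemma IsComoduleMap.comp {g : Cof K A N →ₗ[K] Cof K A P}
    {f : Cof K A M →ₗ[K] Cof K A N}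
    (hg : IsComoduleMap K A g) (hf : IsComoduleMap K A f) : IsComoduleMap K A (g ∘ₗ f) := by
  unfold IsComoduleMap at *
  rw [← LinearMap.comp_assoc, hg, LinearMap.comp_assoc, hf, ← LinearMap.comp_assoc,
    LinearMap.rTensor_comp]

lemma vanishesOn_strictMap (η : A) (l : M →ₗ[K] N) :
    VanishesOn K A η (strictMap K A l) := by
  intro m s t
  rw [toCogen_strictMap, toCogen_tmul]
  simp [TensorAlgebra.algebraMapInv]

lemma deconc_unit (η : A) {X : Type u} [AddCommGroup X] [Module K X]
    (L : TensorAlgebra K A ⊗[K] TensorAlgebra K A →ₗ[K] X)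
    (hl : ∀ s t b, L ((s * TensorAlgebra.ι K η * t) ⊗ₜ b) = 0)
    (hr : ∀ a s t, L (a ⊗ₜ (s * TensorAlgebra.ι K η * t)) = 0)
    (s t : TensorAlgebra K A) :
    L (deconc K A (s * TensorAlgebra.ι K η * t)) = 0 := by
  let G : Set (TensorAlgebra K A ⊗[K] TensorAlgebra K A) :=
    {x | (∃ s t b, x = (s * TensorAlgebra.ι K η * t) ⊗ₜ b) ∨
      ∃ a s t, x = a ⊗ₜ (s * TensorAlgebra.ι K η * t)}
  have hQ : Submodule.span K G ≤ LinearMap.ker L := by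
    rw [Submodule.span_le]
    rintro _ (⟨s, t, b, rfl⟩ | ⟨a, s, t, rfl⟩)
    · exact hl _ _ _
    · exact hr _ _ _
  apply hQ
  have step : ∀ v : A, ∀ y ∈ Submodule.span K G,
      LinearMap.rTensor _ (LinearMap.mulLeft K (TensorAlgebra.ι K v)) y ∈ Submodule.span K G := by
    intro v y hy
    refine Submodule.span_induction (p := fun y _ => LinearMap.rTensor _
      (LinearMap.mulLeft K (TensorAlgebra.ι K v)) y ∈ Submodule.span K G) ?_ (by simp)
      (fun x y _ _ hx hy => by rw [map_add]; exact add_mem hx hy)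
      (fun c x _ hx => by rw [map_smul]; exact Submodule.smul_mem _ _ hx) hy
    rintro _ (⟨s, t, b, rfl⟩ | ⟨a, s, t, rfl⟩)
    · exact Submodule.subset_span (Or.inl ⟨TensorAlgebra.ι K v * s, t, b, by simp [mul_assoc]⟩)
    · exact Submodule.subset_span (Or.inr ⟨TensorAlgebra.ι K v * a, s, t, by simp⟩)
  induction s using tensor_induction with
  | h1 =>
    rw [one_mul, deconc_ι_mul]
    refine add_mem (Submodule.subset_span (Or.inr ⟨1, 1, t, by simp⟩)) ?_
    generalize deconc K A t = y
    induction y using TensorProduct.induction_on with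
    | zero => simp
    | tmul a b => exact Submodule.subset_span (Or.inl ⟨1, a, b, by simp⟩)
    | add a b ha hb => rw [map_add]; exact add_mem ha hb
  | hmul v s ih =>
    rw [mul_assoc] at ih
    rw [mul_assoc, mul_assoc, deconc_ι_mul]
    refine add_mem (Submodule.subset_span (Or.inr ⟨1, TensorAlgebra.ι K v * s, t, ?_⟩)) ?_
    · simp [mul_assoc]
    · exact step v _ ih
  | hadd a b ha hb => rw [add_mul, add_mul, map_add]; exact add_mem ha hb
  | hsmul c a ha =>
    rw [smul_mul_assoc, smul_mul_assoc, map_smul]; exact Submodule.smul_mem _ _ ha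

lemma VanishesOn.comp {η : A} {g : Cof K A N →ₗ[K] Cof K A P}
    {f : Cof K A M →ₗ[K] Cof K A N} (hg : VanishesOn K A η g) (hf : VanishesOn K A η f)
    (hfc : IsComoduleMap K A f) : VanishesOn K A η (g ∘ₗ f) := by
  intro m s t
  rw [LinearMap.comp_apply, ← cogen_coact (f _), ← LinearMap.comp_apply (coact K A N), hfc]
  simp only [coact, LinearMap.comp_apply, LinearMap.lTensor_tmul, LinearEquiv.coe_coe]
  refine deconc_unit η (toCogen K A P ∘ₗ g ∘ₗ LinearMap.rTensor _ (toCogen K A N) ∘ₗ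
    LinearMap.rTensor _ f ∘ₗ (TensorProduct.assoc K _ _ _).symm.toLinearMap ∘ₗ
    TensorProduct.mk K _ _ m) ?_ ?_ s t
  · intro s t b
    simp [hf m s t]
  · intro a s t
    simpa using hg _ s t

end Cofree

/-! ### Bigraded vector spaces -/

/-- A `ℤ × ℤ`-graded vector space, presented as its total space with the homogeneous components
`gr i j` (`i` the cohomological, `j` the internal degree). It stands for the topologically free
bigraded `K⟦ħ⟧`-module with components `(gr i j)⟦ħ⟧`. -/
structure BigradedSpace (K : Type u) [Field K] where
  carrier : Type u
  [addCommGroup : AddCommGroup carrier]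
  [module : Module K carrier]
  gr : ℤ → ℤ → Submodule K carrier
  isInternal : DirectSum.IsInternal fun p : ℤ × ℤ => gr p.1 p.2

attribute [instance] BigradedSpace.addCommGroup BigradedSpace.module

namespace BigradedSpace

variable {K : Type u} [Field K]

lemma hom_ext (M : BigradedSpace K) {X : Type u} [AddCommGroup X] [Module K X]
    {f g : M.carrier →ₗ[K] X} (h : ∀ i j, ∀ m ∈ M.gr i j, f m = g m) : f = g := by
  have hs := M.isInternal.submodule_iSup_eq_top
  have : (⨆ p : ℤ × ℤ, M.gr p.1 p.2) ≤ LinearMap.eqLocus f g :=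
    iSup_le fun p m hm => h p.1 p.2 m hm
  ext m
  exact this (hs ▸ Submodule.mem_top)

/-- The linear map which is `(-1)^i` on the component of cohomological degree `i`. -/
def parity (M : BigradedSpace K) : M.carrier →ₗ[K] M.carrier :=
  (DirectSum.toModule K (ℤ × ℤ) M.carrier fun p => (-1 : K) ^ p.1 • (M.gr p.1 p.2).subtype) ∘ₗ
    (LinearEquiv.ofBijective (DirectSum.coeLinearMap fun p : ℤ × ℤ => M.gr p.1 p.2)
      M.isInternal).symm.toLinearMap

lemma parity_of_mem (M : BigradedSpace K) {i j : ℤ} {m : M.carrier} (hm : m ∈ M.gr i j) :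
    M.parity m = (-1 : K) ^ i • m := by
  have : (LinearEquiv.ofBijective (DirectSum.coeLinearMap fun p : ℤ × ℤ => M.gr p.1 p.2)
      M.isInternal).symm m =
      DirectSum.lof K (ℤ × ℤ) (fun p : ℤ × ℤ => M.gr p.1 p.2) (i, j) ⟨m, hm⟩ := by
    rw [LinearEquiv.symm_apply_eq]
    exact (DirectSum.coeLinearMap_lof (fun p : ℤ × ℤ => M.gr p.1 p.2) (i, j) ⟨m, hm⟩).symm
  rw [parity, LinearMap.comp_apply, LinearEquiv.coe_coe, this, DirectSum.toModule_lof]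
  rfl

lemma parity_comp {M N : BigradedSpace K} {l : M.carrier →ₗ[K] N.carrier}
    (hl : ∀ i j, ∀ m ∈ M.gr i j, l m ∈ N.gr i j) : N.parity ∘ₗ l = l ∘ₗ M.parity :=
  M.hom_ext fun i j m hm => by
    rw [LinearMap.comp_apply, LinearMap.comp_apply, N.parity_of_mem (hl i j m hm),
      M.parity_of_mem hm, map_smul]

/-- The shift `M[a]`, with `(M[a])^i_j = M^{i+a}_j`. -/
abbrev shift (M : BigradedSpace K) (a : ℤ) : BigradedSpace K where
  carrier := M.carrier
  gr i j := M.gr (i + a) j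
  isInternal := by
    have h := M.isInternal
    rw [DirectSum.isInternal_submodule_iff_iSupIndep_and_iSup_eq_top] at h ⊢
    let e : ℤ × ℤ ≃ ℤ × ℤ := (Equiv.addRight a).prodCongr (Equiv.refl ℤ)
    exact ⟨h.1.comp e.injective, (e.iSup_comp (g := fun p : ℤ × ℤ => M.gr p.1 p.2)).trans h.2⟩

lemma parity_shift (M : BigradedSpace K) (a : ℤ) :
    (M.shift a).parity = (-1 : K) ^ a • M.parity :=
  (M.shift a).hom_ext fun i j m hm => by
    rw [(M.shift a).parity_of_mem hm, LinearMap.smul_apply,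
      M.parity_of_mem (i := i + a) (j := j) hm, zpow_add₀ (by simp), smul_smul, mul_comm,
      mul_assoc, ← mul_zpow]
    simp

/-- The direct sum of bigraded spaces. -/
abbrev prod (M N : BigradedSpace K) : BigradedSpace K where
  carrier := M.carrier × N.carrier
  gr i j := (M.gr i j).prod (N.gr i j)
  isInternal := by
    have hM := M.isInternal
    have hN := N.isInternal
    rw [DirectSum.isInternal_submodule_iff_iSupIndep_and_iSup_eq_top] at hM hN ⊢
    constructor
    · rw [iSupIndep_def]
      intro p
      rw [Submodule.disjoint_def]
      rintro ⟨x, y⟩ hx hy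
      have hle : (⨆ q, ⨆ (_ : q ≠ p), (M.gr q.1 q.2).prod (N.gr q.1 q.2)) ≤
          (⨆ q, ⨆ (_ : q ≠ p), M.gr q.1 q.2).prod (⨆ q, ⨆ (_ : q ≠ p), N.gr q.1 q.2) :=
        iSup₂_le fun q hq => Submodule.prod_mono
          (le_iSup₂ (f := fun q (_ : q ≠ p) => M.gr q.1 q.2) q hq)
          (le_iSup₂ (f := fun q (_ : q ≠ p) => N.gr q.1 q.2) q hq)
      have hy' := hle hy
      have h1 := Submodule.disjoint_def.1 (iSupIndep_def.1 hM.1 p) x hx.1 hy'.1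
      have h2 := Submodule.disjoint_def.1 (iSupIndep_def.1 hN.1 p) y hx.2 hy'.2
      simp [h1, h2]
    · rw [eq_top_iff]
      rintro ⟨x, y⟩ -
      have h1 : (⨆ p : ℤ × ℤ, M.gr p.1 p.2) ≤ (⨆ p : ℤ × ℤ, (M.gr p.1 p.2).prod
          (N.gr p.1 p.2)).comap (LinearMap.inl K M.carrier N.carrier) :=
        iSup_le fun p x hx => Submodule.mem_iSup_of_mem p ⟨hx, Submodule.zero_mem _⟩
      have h2 : (⨆ p : ℤ × ℤ, N.gr p.1 p.2) ≤ (⨆ p : ℤ × ℤ, (M.gr p.1 p.2).prod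
          (N.gr p.1 p.2)).comap (LinearMap.inr K M.carrier N.carrier) :=
        iSup_le fun p x hx => Submodule.mem_iSup_of_mem p ⟨Submodule.zero_mem _, hx⟩
      have hx : x ∈ ⨆ p : ℤ × ℤ, M.gr p.1 p.2 := hM.2 ▸ Submodule.mem_top
      have hy : y ∈ ⨆ p : ℤ × ℤ, N.gr p.1 p.2 := hN.2 ▸ Submodule.mem_top
      have := Submodule.add_mem _ (Submodule.mem_comap.1 (h1 hx)) (Submodule.mem_comap.1 (h2 hy))
      simpa using this

/-- The component `(M^i_j)⟦ħ⟧`, as a set of sequences of coefficients. -/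
def seriesGr (M : BigradedSpace K) (i j : ℤ) : Submodule K (ℕ → M.carrier) :=
  Submodule.pi Set.univ fun _ => M.gr i j

/-- The tensors `a₁ ⊗ ⋯ ⊗ aₙ` of homogeneous elements of `A`, seen in `T(A[1])`, with their
bidegree: each `aᵢ` counts with cohomological degree `|aᵢ| - 1`. -/
inductive BarWord (A : BigradedSpace K) : ℤ → ℤ → TensorAlgebra K A.carrier → Prop
  | nil : BarWord A 0 0 1
  | cons {p q r s : ℤ} {a : A.carrier} {t : TensorAlgebra K A.carrier} :
      a ∈ A.gr p q → BarWord A r s t → BarWord A (p - 1 + r) (q + s) (TensorAlgebra.ι K a * t)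

/-- The component of bidegree `(r, s)` of `T(A[1])`. -/
def barGr (A : BigradedSpace K) (r s : ℤ) : Submodule K (TensorAlgebra K A.carrier) :=
  Submodule.span K {t | BarWord A r s t}

/-- The linear map which is `(-1)^r` on the component of cohomological degree `r` of `T(A[1])`. -/
def barSign (A : BigradedSpace K) : TensorAlgebra K A.carrier →ₗ[K] TensorAlgebra K A.carrier :=
  (TensorAlgebra.lift K (-(TensorAlgebra.ι K ∘ₗ A.parity))).toLinearMap

/-- The component of bidegree `(i, j)` of `M[1] ⊗ T(A[1])`. -/
def cofreeGr (A M : BigradedSpace K) (i j : ℤ) :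
    Submodule K (Cof K A.carrier M.carrier) :=
  Submodule.span K {x | ∃ p q r s m t, m ∈ M.gr p q ∧ t ∈ A.barGr r s ∧
    p - 1 + r = i ∧ q + s = j ∧ x = m ⊗ₜ[K] t}

/-- The linear map which is `(-1)^i` on the component of cohomological degree `i` of
`M[1] ⊗ T(A[1])`. -/
def cofreeSign (A M : BigradedSpace K) : Cof K A.carrier M.carrier →ₗ[K]
    Cof K A.carrier M.carrier :=
  TensorProduct.map (-M.parity) A.barSign

/-- `f` has bidegree `(r, 0)`. -/
def HasDegree (A M N : BigradedSpace K) (r : ℤ) (f : Cof K A.carrier M.carrier →ₗ[K]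
    Cof K A.carrier N.carrier) : Prop :=
  ∀ i j, ∀ x ∈ cofreeGr A M i j, f x ∈ cofreeGr A N (i + r) j

lemma HasDegree.comp {A M N P : BigradedSpace K} {r s k : ℤ}
    {g : Cof K A.carrier N.carrier →ₗ[K] Cof K A.carrier P.carrier}
    {f : Cof K A.carrier M.carrier →ₗ[K] Cof K A.carrier N.carrier}
    (hg : HasDegree A N P r g) (hf : HasDegree A M N s f)
    (hk : s + r = k) : HasDegree A M P k (g ∘ₗ f) := by
  intro i j x hx
  have := hg _ _ _ (hf i j x hx)
  rwa [add_assoc, hk] at this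

lemma hasDegree_strictMap {A M N : BigradedSpace K} {l : M.carrier →ₗ[K] N.carrier}
    (hl : ∀ i j, ∀ m ∈ M.gr i j, l m ∈ N.gr i j) : HasDegree A M N 0 (strictMap K A.carrier l) := by
  intro i j x hx
  rw [add_zero]
  refine Submodule.span_induction (p := fun x _ => strictMap K A.carrier l x ∈ cofreeGr A N i j)
    ?_ (by simp) (fun x y _ _ hx hy => by rw [map_add]; exact add_mem hx hy)
    (fun c x _ hx => by rw [map_smul]; exact Submodule.smul_mem _ _ hx) hx
  rintro _ ⟨p, q, r, s, m, t, hm, ht, hi, hj, rfl⟩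
  exact Submodule.subset_span ⟨p, q, r, s, l m, t, hl _ _ _ hm, ht, hi, hj, by simp⟩

end BigradedSpace

open BigradedSpace

/-! ### Topological A∞-algebras and their modules -/

/-- A topological `A∞`-algebra: a codifferential `d = ∑ d⁽ⁿ⁾ ħⁿ` of bidegree `(1, 0)` on the
topological tensor coalgebra `T(A[1])⟦ħ⟧`. -/
structure TopAInfAlg (K : Type u) [Field K] extends BigradedSpace K where
  d : Ser K (TensorAlgebra K carrier) (TensorAlgebra K carrier)
  d_degree : ∀ n r s, ∀ t ∈ toBigradedSpace.barGr r s, d n t ∈ toBigradedSpace.barGr (r + 1) s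
  d_coderivation : ∀ n, deconc K carrier ∘ₗ d n =
    (TensorProduct.map (d n) LinearMap.id + TensorProduct.map toBigradedSpace.barSign (d n)) ∘ₗ
      deconc K carrier
  d_comp_d : d.comp d = 0

namespace TopAInfAlg

variable {K : Type u} [Field K] (A : TopAInfAlg K)

/-- The algebra is flat: the curvature `K → A[1]` vanishes, at every order in `ħ`. -/
def IsFlat : Prop := ∀ n, A.d n 1 = 0

/-- A strict unit. In terms of `m₂` and `mₙ`, where `d̄ⁿ = -s ∘ mₙ ∘ (s⁻¹)^{⊗ n}`, the conditions
are `m₂(a, 1) = a = m₂(1, a)`, and `mₙ(a₁, …, aₙ) = 0` if `n ≥ 3` and some `aᵢ` is `1`. -/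
structure StrictUnit where
  one : A.carrier
  one_mem : one ∈ A.gr 0 0
  right_unit : ∀ n a, TensorAlgebra.ιInv (A.d n (TensorAlgebra.ι K a * TensorAlgebra.ι K one)) =
    if n = 0 then A.parity a else 0
  left_unit : ∀ n a, TensorAlgebra.ιInv (A.d n (TensorAlgebra.ι K one * TensorAlgebra.ι K a)) =
    if n = 0 then a else 0
  higher_right : ∀ n a b s t, TensorAlgebra.ιInv (A.d n (TensorAlgebra.ι K a *
    TensorAlgebra.ι K b * s * TensorAlgebra.ι K one * t)) = 0
  higher_middle : ∀ n a b s t, TensorAlgebra.ιInv (A.d n (TensorAlgebra.ι K a * s *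
    TensorAlgebra.ι K one * t * TensorAlgebra.ι K b)) = 0
  higher_left : ∀ n a b s t, TensorAlgebra.ιInv (A.d n (s * TensorAlgebra.ι K one * t *
    TensorAlgebra.ι K a * TensorAlgebra.ι K b)) = 0

end TopAInfAlg

variable {K : Type u} [Field K] {A : TopAInfAlg K}

/-- A strictly unital topological right `A∞`-module over `A`: a topologically free bigraded
module with a codifferential `d = ∑ d⁽ⁿ⁾ ħⁿ` of bidegree `(1, 0)` on the `T(A[1])⟦ħ⟧`-comodule
`(M[1] ⊗ T(A[1]))⟦ħ⟧`. The last three fields say that the unit of `A` acts as the identity, and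
that the Taylor components `d̄ⁿ`, `n ≥ 2`, vanish if one argument from `A` is the unit. -/
structure TopMod (e : A.StrictUnit) extends BigradedSpace K where
  d : Ser K (Cof K A.carrier carrier) (Cof K A.carrier carrier)
  d_degree : ∀ n, HasDegree A.toBigradedSpace toBigradedSpace toBigradedSpace 1 (d n)
  d_coderivation : ∀ n, coact K A.carrier carrier ∘ₗ d n =
    (TensorProduct.map (d n) LinearMap.id +
      TensorProduct.map (cofreeSign A.toBigradedSpace toBigradedSpace) (A.d n)) ∘ₗ
        coact K A.carrier carrier
  d_comp_d : d.comp d = 0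
  unit_act : ∀ n m, toCogen K A.carrier carrier (d n (m ⊗ₜ TensorAlgebra.ι K e.one)) =
    if n = 0 then toBigradedSpace.parity m else 0
  unit_right : ∀ n m a s t, toCogen K A.carrier carrier
    (d n (m ⊗ₜ (TensorAlgebra.ι K a * s * TensorAlgebra.ι K e.one * t))) = 0
  unit_left : ∀ n m a s t, toCogen K A.carrier carrier
    (d n (m ⊗ₜ (s * TensorAlgebra.ι K e.one * t * TensorAlgebra.ι K a))) = 0

namespace TopMod

variable {e : A.StrictUnit}

/-- The comodule `M[1] ⊗ T(A[1])`. -/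
abbrev R (M : TopMod e) : Type u := Cof K A.carrier M.carrier

/-- The series of comodule maps `M[1] ⊗ T(A[1]) → N[1] ⊗ T(A[1])` of bidegree `(r, 0)` which are
strictly unital, that is, whose Taylor components of order `≥ 1` vanish if one argument from `A`
is the unit. -/
structure IsPreHom (M N : TopMod e) (r : ℤ) (f : Ser K M.R N.R) : Prop where
  comodule : ∀ n, IsComoduleMap K A.carrier (f n)
  degree : ∀ n, HasDegree A.toBigradedSpace M.toBigradedSpace N.toBigradedSpace r (f n)
  unital : ∀ n, VanishesOn K A.carrier e.one (f n)

lemma IsPreHom.zero (M N : TopMod e) (r : ℤ) : IsPreHom M N r 0 where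
  comodule n := by simp [IsComoduleMap]
  degree n i j x _ := by simp
  unital n m s t := by simp

lemma IsPreHom.add {M N : TopMod e} {r : ℤ} {f g : Ser K M.R N.R} (hf : IsPreHom M N r f)
    (hg : IsPreHom M N r g) : IsPreHom M N r (f + g) where
  comodule n := by
    have h1 := hf.comodule n
    have h2 := hg.comodule n
    unfold IsComoduleMap at *
    rw [Pi.add_apply, LinearMap.comp_add, h1, h2, LinearMap.rTensor_add, LinearMap.add_comp]
  degree n i j x hx := add_mem (hf.degree n i j x hx) (hg.degree n i j x hx)
  unital n m s t := by
    rw [Pi.add_apply, LinearMap.add_apply, map_add, hf.unital n m s t, hg.unital n m s t,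
      add_zero]

lemma IsPreHom.smul {M N : TopMod e} {r : ℤ} {f : Ser K M.R N.R} (c : K)
    (hf : IsPreHom M N r f) : IsPreHom M N r (c • f) where
  comodule n := by
    have h1 := hf.comodule n
    unfold IsComoduleMap at *
    rw [Pi.smul_apply, LinearMap.comp_smul, h1, LinearMap.rTensor_smul, LinearMap.smul_comp]
  degree n i j x hx := Submodule.smul_mem _ _ (hf.degree n i j x hx)
  unital n m s t := by
    rw [Pi.smul_apply, LinearMap.smul_apply, map_smul, hf.unital n m s t, smul_zero]

lemma IsPreHom.neg {M N : TopMod e} {r : ℤ} {f : Ser K M.R N.R} (hf : IsPreHom M N r f) :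
    IsPreHom M N r (-f) := neg_one_smul K f ▸ hf.smul (-1)

lemma IsPreHom.comp {M N P : TopMod e} {r s k : ℤ} {g : Ser K N.R P.R} {f : Ser K M.R N.R}
    (hg : IsPreHom N P r g) (hf : IsPreHom M N s f) (hk : s + r = k) :
    IsPreHom M P k (g.comp f) := by
  have key : ∀ p : ℕ × ℕ, IsPreHom M P k (fun _ => g p.1 ∘ₗ f p.2) := fun p =>
    ⟨fun _ => (hg.comodule p.1).comp (hf.comodule p.2),
      fun _ => (hg.degree p.1).comp (hf.degree p.2) hk,
      fun _ => (hg.unital p.1).comp (hf.unital p.2) (hf.comodule p.2)⟩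
  have h : ∀ s : Finset (ℕ × ℕ), IsPreHom M P k (fun _ => ∑ p ∈ s, g p.1 ∘ₗ f p.2) := by
    classical
    intro s
    induction s using Finset.induction_on with
    | empty => exact IsPreHom.zero M P k
    | insert p s hp ih => simp only [Finset.sum_insert hp]; exact (key p).add ih
  exact ⟨fun n => (h (Finset.HasAntidiagonal.antidiagonal n)).comodule n,
    fun n => (h (Finset.HasAntidiagonal.antidiagonal n)).degree n,
    fun n => (h (Finset.HasAntidiagonal.antidiagonal n)).unital n⟩

lemma IsPreHom.const {M N : TopMod e} {l : M.carrier →ₗ[K] N.carrier}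
    (hl : ∀ i j, ∀ m ∈ M.gr i j, l m ∈ N.gr i j) :
    IsPreHom M N 0 (Ser.const (strictMap K A.carrier l)) := by
  have h0 := IsPreHom.zero M N 0
  constructor <;> intro n <;> by_cases hn : n = 0 <;> simp only [Ser.const, hn, if_true, if_false]
  · exact coact_strictMap l
  · exact h0.comodule 0
  · exact hasDegree_strictMap hl
  · exact h0.degree 0
  · exact vanishesOn_strictMap _ l
  · exact h0.unital 0

/-- The morphisms of strictly unital topological `A∞`-modules. -/
@[ext] structure Hom (M N : TopMod e) where
  ser : Ser K M.R N.R
  isPreHom : IsPreHom M N 0 ser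
  comm : N.d.comp ser = ser.comp M.d

lemma isPreHom_id (M : TopMod e) : IsPreHom M M 0 (Ser.const LinearMap.id) := by
  have := IsPreHom.const (M := M) (N := M) (l := LinearMap.id) (fun _ _ _ h => h)
  rwa [strictMap, LinearMap.rTensor_id] at this

instance : Category (TopMod e) where
  Hom M N := Hom M N
  id M := ⟨Ser.const LinearMap.id, isPreHom_id M, by rw [Ser.comp_id, Ser.id_comp]⟩
  comp f g := ⟨g.ser.comp f.ser, g.isPreHom.comp f.isPreHom (add_zero 0), by
    rw [← Ser.comp_assoc, g.comm, Ser.comp_assoc, f.comm, Ser.comp_assoc]⟩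
  id_comp f := Hom.ext (Ser.comp_id f.ser)
  comp_id f := Hom.ext (Ser.id_comp f.ser)
  assoc f g h := Hom.ext (Ser.comp_assoc h.ser g.ser f.ser).symm

@[ext] lemma hom_ext {M N : TopMod e} {f g : M ⟶ N} (h : f.ser = g.ser) : f = g := Hom.ext h

@[simp] lemma ser_id (M : TopMod e) : Hom.ser (𝟙 M) = Ser.const LinearMap.id := rfl

@[simp] lemma ser_comp {M N P : TopMod e} (f : M ⟶ N) (g : N ⟶ P) :
    (f ≫ g).ser = g.ser.comp f.ser := rfl

instance (M N : TopMod e) : Zero (M ⟶ N) :=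
  ⟨⟨0, IsPreHom.zero M N 0, by rw [Ser.comp_zero, Ser.zero_comp]⟩⟩

instance (M N : TopMod e) : Add (M ⟶ N) :=
  ⟨fun f g => ⟨f.ser + g.ser, f.isPreHom.add g.isPreHom, by
    rw [Ser.comp_add, Ser.add_comp, f.comm, g.comm]⟩⟩

instance (M N : TopMod e) : Neg (M ⟶ N) :=
  ⟨fun f => ⟨-f.ser, f.isPreHom.neg, by rw [Ser.comp_neg, Ser.neg_comp, f.comm]⟩⟩

@[simp] lemma ser_zero {M N : TopMod e} : Hom.ser (0 : M ⟶ N) = 0 := rfl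

@[simp] lemma ser_add {M N : TopMod e} (f g : M ⟶ N) : (f + g).ser = f.ser + g.ser := rfl

@[simp] lemma ser_neg {M N : TopMod e} (f : M ⟶ N) : (-f).ser = -f.ser := rfl

instance (M N : TopMod e) : AddCommGroup (M ⟶ N) where
  add_assoc f g h := Hom.ext (add_assoc f.ser g.ser h.ser)
  zero_add f := Hom.ext (zero_add f.ser)
  add_zero f := Hom.ext (add_zero f.ser)
  add_comm f g := Hom.ext (add_comm f.ser g.ser)
  neg_add_cancel f := Hom.ext (neg_add_cancel f.ser)
  nsmul := nsmulRec
  zsmul := zsmulRec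

instance : Preadditive (TopMod e) where
  add_comp _ _ _ f f' g := Hom.ext (Ser.comp_add g.ser f.ser f'.ser)
  comp_add _ _ _ f g g' := Hom.ext (Ser.add_comp g.ser g'.ser f.ser)

/-- The strict morphism given by a linear map of bidegree `(0, 0)`, constant in `ħ`. -/
def strictHom {M N : TopMod e} (l : M.carrier →ₗ[K] N.carrier)
    (hl : ∀ i j, ∀ m ∈ M.gr i j, l m ∈ N.gr i j)
    (hd : ∀ n, N.d n ∘ₗ strictMap K A.carrier l = strictMap K A.carrier l ∘ₗ M.d n) : M ⟶ N where
  ser := Ser.const (strictMap K A.carrier l)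
  isPreHom := IsPreHom.const hl
  comm := by rw [Ser.comp_const, Ser.const_comp]; exact funext hd

/-! ### The shift -/

lemma cofreeGr_shift (A M : BigradedSpace K) (a i j : ℤ) :
    cofreeGr A (M.shift a) i j = cofreeGr A M (i + a) j := by
  unfold cofreeGr
  congr 1
  ext x
  constructor
  · rintro ⟨p, q, r, s, m, t, hm, ht, hi, hj, rfl⟩
    exact ⟨p + a, q, r, s, m, t, hm, ht, by omega, hj, rfl⟩
  · rintro ⟨p, q, r, s, m, t, hm, ht, hi, hj, rfl⟩
    exact ⟨p - a, q, r, s, m, t, by simpa using hm, ht, by omega, hj, rfl⟩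

lemma hasDegree_shift {A M N : BigradedSpace K}
    {f : Cof K A.carrier M.carrier →ₗ[K] Cof K A.carrier N.carrier} {r : ℤ}
    (hf : HasDegree A M N r f) (a b k : ℤ) (h : r + a = k + b) :
    HasDegree A (M.shift a) (N.shift b) k f := by
  intro i j x hx
  rw [cofreeGr_shift] at hx ⊢
  have := hf _ _ _ hx
  rwa [show i + a + r = i + k + b by omega] at this

lemma cofreeSign_shift (A M : BigradedSpace K) (a : ℤ) :
    cofreeSign A (M.shift a) = (-1 : K) ^ a • cofreeSign A M := by
  rw [cofreeSign, cofreeSign, parity_shift, ← smul_neg, TensorProduct.map_smul_left]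

/-- The shift `M[a]` of a module. On `M[a][1] ⊗ T(A[1])`, whose underlying space is that of
`M[1] ⊗ T(A[1])`, the codifferential is `(-1)^a d`; for `a = 1` its Taylor components are
`-s ∘ d̄ⁿ ∘ (s⁻¹ ⊗ 1)`. -/
abbrev shiftObj (M : TopMod e) (a : ℤ) : TopMod e where
  toBigradedSpace := M.toBigradedSpace.shift a
  d := (-1 : K) ^ a • M.d
  d_degree n := hasDegree_shift (M := M.toBigradedSpace) (N := M.toBigradedSpace)
    (f := (-1 : K) ^ a • M.d n)
    (fun i j x hx => Submodule.smul_mem _ _ (M.d_degree n i j x hx)) a a 1 rfl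
  d_coderivation n := by
    rw [cofreeSign_shift, Pi.smul_apply, LinearMap.comp_smul, M.d_coderivation n,
      TensorProduct.map_smul_left, TensorProduct.map_smul_left, ← smul_add, LinearMap.smul_comp]
  d_comp_d := by rw [Ser.comp_smul, Ser.smul_comp, M.d_comp_d, smul_zero, smul_zero]
  unit_act n m := by
    rw [parity_shift, Pi.smul_apply, LinearMap.smul_apply, map_smul, M.unit_act n m]
    split_ifs <;> simp
  unit_right n m b s t := by
    rw [Pi.smul_apply, LinearMap.smul_apply, map_smul, M.unit_right, smul_zero]
  unit_left n m b s t := by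
    rw [Pi.smul_apply, LinearMap.smul_apply, map_smul, M.unit_left, smul_zero]

lemma IsPreHom.shift {M N : TopMod e} {r : ℤ} {f : Ser K M.R N.R} (hf : IsPreHom M N r f)
    (a b k : ℤ) (h : r + a = k + b) : IsPreHom (M.shiftObj a) (N.shiftObj b) k f where
  comodule n := hf.comodule n
  degree n := hasDegree_shift (hf.degree n) a b k h
  unital n := hf.unital n

end TopMod

lemma Ser.smul_comm_aux {V W : Type u} [AddCommGroup V] [Module K V] [AddCommGroup W]
    [Module K W] (c : K) {d : Ser K V V} {d' : Ser K W W} {f : Ser K V W}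
    (h : d'.comp f = f.comp d) : (c • d').comp f = f.comp (c • d) := by
  rw [Ser.smul_comp, Ser.comp_smul, h]

namespace TopMod

variable {e : A.StrictUnit}

/-- The shift functor `[a]`; it does not change the underlying maps of comodules. -/
def shiftBy (e : A.StrictUnit) (a : ℤ) : TopMod e ⥤ TopMod e where
  obj M := M.shiftObj a
  map {M N} f :=
    { ser := f.ser
      isPreHom := f.isPreHom.shift a a 0 (by omega)
      comm := Ser.smul_comm_aux ((-1 : K) ^ a) f.comm }
  map_id M := Hom.ext rfl
  map_comp f g := Hom.ext rfl

/-- `M[0] ≅ M`, given by the identity. -/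
def shiftZeroIso (M : TopMod e) : M.shiftObj 0 ≅ M where
  hom :=
    { ser := (Ser.const LinearMap.id : Ser K M.R M.R)
      isPreHom :=
        { comodule := (isPreHom_id M).comodule
          degree := fun n i j x hx => by
            rw [cofreeGr_shift] at hx
            simpa using (isPreHom_id M).degree n _ _ _ hx
          unital := (isPreHom_id M).unital }
      comm := by rw [Ser.comp_id, Ser.id_comp]; simp }
  inv :=
    { ser := (Ser.const LinearMap.id : Ser K M.R M.R)
      isPreHom :=
        { comodule := (isPreHom_id M).comodule
          degree := fun n i j x hx => by
            rw [cofreeGr_shift]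
            simpa using (isPreHom_id M).degree n _ _ _ hx
          unital := (isPreHom_id M).unital }
      comm := by rw [Ser.comp_id, Ser.id_comp]; simp }
  hom_inv_id := Hom.ext (Ser.id_comp _)
  inv_hom_id := Hom.ext (Ser.id_comp _)

/-- `M[a + b] ≅ M[a][b]`, given by the identity. -/
def shiftAddIso (M : TopMod e) (a b : ℤ) : M.shiftObj (a + b) ≅ (M.shiftObj a).shiftObj b where
  hom :=
    { ser := (Ser.const LinearMap.id : Ser K M.R M.R)
      isPreHom :=
        { comodule := (isPreHom_id M).comodule
          degree := fun n i j x hx => by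
            rw [cofreeGr_shift] at hx
            rw [cofreeGr_shift, cofreeGr_shift]
            simpa [add_assoc, add_comm a b] using (isPreHom_id M).degree n _ _ _ hx
          unital := (isPreHom_id M).unital }
      comm := by
        rw [Ser.comp_id, Ser.id_comp]
        change (-1 : K) ^ b • (-1 : K) ^ a • M.d = (-1 : K) ^ (a + b) • M.d
        rw [smul_smul, zpow_add₀ (by simp), mul_comm] }
  inv :=
    { ser := (Ser.const LinearMap.id : Ser K M.R M.R)
      isPreHom :=
        { comodule := (isPreHom_id M).comodule
          degree := fun n i j x hx => by
            rw [cofreeGr_shift, cofreeGr_shift] at hx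
            rw [cofreeGr_shift]
            simpa [add_assoc, add_comm a b] using (isPreHom_id M).degree n _ _ _ hx
          unital := (isPreHom_id M).unital }
      comm := by
        rw [Ser.comp_id, Ser.id_comp]
        change (-1 : K) ^ (a + b) • M.d = (-1 : K) ^ b • (-1 : K) ^ a • M.d
        rw [smul_smul, zpow_add₀ (by simp), mul_comm] }
  hom_inv_id := Hom.ext (Ser.id_comp _)
  inv_hom_id := Hom.ext (Ser.id_comp _)

lemma ser_eqToHom (M : TopMod e) {a b : ℤ} (h : a = b) (h' : M.shiftObj a = M.shiftObj b) :
    (eqToHom h').ser = (Ser.const LinearMap.id : Ser K M.R M.R) := by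
  subst h; rfl

lemma ser_comp_of {M N P : TopMod e} {f : M ⟶ N} {g : N ⟶ P} {f' : Ser K M.R N.R}
    {g' : Ser K N.R P.R} (hf : f.ser = f') (hg : g.ser = g') : (f ≫ g).ser = g'.comp f' := by
  rw [ser_comp, hf, hg]

/-- The shift functors `[a]`, with `M[0] ≅ M` and `M[a + b] ≅ M[a][b]` given by identity maps. -/
instance : HasShift (TopMod e) ℤ := hasShiftMk (TopMod e) ℤ
  { F := shiftBy e
    zero := NatIso.ofComponents shiftZeroIso (fun {M N} f =>
      Hom.ext ((Ser.id_comp f.ser).trans (Ser.comp_id f.ser).symm))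
    add := fun a b => NatIso.ofComponents (fun M => shiftAddIso M a b) (fun {M N} f =>
      Hom.ext ((Ser.id_comp f.ser).trans (Ser.comp_id f.ser).symm))
    assoc_hom_app := fun a b c M => Hom.ext (by
      have h := ser_comp_of (g := (shiftAddIso M a (b + c)).hom ≫
        (shiftAddIso (M.shiftObj a) b c).hom) (ser_eqToHom M (add_assoc a b c) (by rw [add_assoc]))
        (Ser.id_comp _)
      exact (Ser.id_comp _).trans ((Ser.id_comp _).symm.trans h.symm))
    zero_add_hom_app := fun a M => Hom.ext (by
      have h := ser_comp_of (g := (shiftBy e a).map (shiftZeroIso M).inv)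
        (ser_eqToHom M (zero_add a) (by rw [zero_add])) rfl
      exact (Ser.id_comp _).symm.trans h.symm)
    add_zero_hom_app := fun a M => Hom.ext (by
      have h := ser_comp_of (g := (shiftZeroIso (M.shiftObj a)).inv)
        (ser_eqToHom M (add_zero a) (by rw [add_zero])) rfl
      exact (Ser.id_comp _).symm.trans h.symm) }

instance (a : ℤ) : (shiftFunctor (TopMod e) a).Additive where
  map_add := rfl

end TopMod

/-! ### The homotopy category -/

section Homotopy

variable (e : A.StrictUnit)

/-- `f` and `g` are homotopic: `f - g = d_N ∘ H + H ∘ d_M` for a strictly unital series `H` of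
comodule maps of bidegree `(-1, 0)`. -/
def homotopic : HomRel (TopMod e) := fun M N f g =>
  ∃ H : Ser K M.R N.R, TopMod.IsPreHom M N (-1) H ∧ f.ser - g.ser = N.d.comp H + H.comp M.d

lemma homotopic_add ⦃M N : TopMod e⦄ (f₁ f₂ g₁ g₂ : M ⟶ N) (hf : homotopic e f₁ f₂)
    (hg : homotopic e g₁ g₂) : homotopic e (f₁ + g₁) (f₂ + g₂) := by
  obtain ⟨H, hH, h⟩ := hf
  obtain ⟨H', hH', h'⟩ := hg
  refine ⟨H + H', hH.add hH', ?_⟩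
  rw [TopMod.ser_add, TopMod.ser_add, add_sub_add_comm, h, h', Ser.comp_add, Ser.add_comp]
  abel

instance homotopic_congruence : Congruence (homotopic e) where
  equivalence {M N} :=
    { refl := fun f => ⟨0, TopMod.IsPreHom.zero _ _ _, by
        rw [Ser.comp_zero, Ser.zero_comp, sub_self, add_zero]⟩
      symm := by
        rintro f g ⟨H, hH, h⟩
        exact ⟨-H, hH.neg, by rw [Ser.comp_neg, Ser.neg_comp, ← neg_sub, h, neg_add]⟩
      trans := by
        rintro f g k ⟨H, hH, h⟩ ⟨H', hH', h'⟩
        refine ⟨H + H', hH.add hH', ?_⟩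
        rw [← sub_add_sub_cancel f.ser g.ser k.ser, h, h', Ser.comp_add, Ser.add_comp]
        abel }
  comp_left := by
    rintro M N P f g g' ⟨H, hH, h⟩
    refine ⟨H.comp f.ser, hH.comp f.isPreHom (by omega), ?_⟩
    rw [TopMod.ser_comp, TopMod.ser_comp, ← Ser.sub_comp, h, Ser.add_comp, Ser.comp_assoc,
      Ser.comp_assoc, Ser.comp_assoc, f.comm]
  comp_right := by
    rintro M N P f f' g ⟨H, hH, h⟩
    refine ⟨g.ser.comp H, g.isPreHom.comp hH (by omega), ?_⟩
    rw [TopMod.ser_comp, TopMod.ser_comp, ← Ser.comp_sub, h, Ser.comp_add, ← Ser.comp_assoc,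
      ← Ser.comp_assoc, ← Ser.comp_assoc, g.comm]

instance : (homotopic e).IsCompatibleWithShift ℤ where
  condition := by
    rintro a M N f g ⟨H, hH, h⟩
    refine ⟨((-1 : K) ^ a • H : Ser K M.R N.R), (hH.smul _).shift a a (-1) rfl, ?_⟩
    change f.ser - g.ser = ((-1 : K) ^ a • N.d).comp ((-1 : K) ^ a • H) +
      ((-1 : K) ^ a • H).comp ((-1 : K) ^ a • M.d)
    have h1 : (-1 : K) ^ a * (-1 : K) ^ a = 1 := by rw [← mul_zpow]; simp
    rw [Ser.comp_smul, Ser.comp_smul, Ser.smul_comp, Ser.smul_comp, smul_smul, smul_smul, h1,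
      one_smul, one_smul, h]

/-- The homotopy category of strictly unital topologically free `A∞`-modules over `A`. -/
abbrev HoCat : Type (u + 1) := CategoryTheory.Quotient (homotopic e)

instance : Preadditive (HoCat e) := Quotient.preadditive _ (homotopic_add e)

/-- The functor which sends a morphism to its homotopy class. -/
abbrev hoFunctor : TopMod e ⥤ HoCat e := CategoryTheory.Quotient.functor (homotopic e)

instance : (hoFunctor e).Additive where
  map_add := rfl

lemma isInternal_of_subsingleton {V : Type u} [AddCommGroup V] [Module K V] [Subsingleton V]
    (p : ℤ × ℤ → Submodule K V) : DirectSum.IsInternal p := by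
  constructor
  · intro x y _
    exact DFinsupp.ext fun i => Subsingleton.elim _ _
  · exact fun y => ⟨0, Subsingleton.elim _ _⟩

/-- The zero module. -/
def zeroMod : TopMod e where
  carrier := PUnit
  gr _ _ := ⊤
  isInternal := isInternal_of_subsingleton _
  d := 0
  d_degree n i j x _ := by simp
  d_coderivation n := by
    refine TensorProduct.ext' fun m t => ?_
    rw [Subsingleton.elim m 0, zero_tmul, map_zero, map_zero]
  d_comp_d := Ser.comp_zero _
  unit_act _ _ := Subsingleton.elim _ _
  unit_right _ _ _ _ _ := Subsingleton.elim _ _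
  unit_left _ _ _ _ _ := Subsingleton.elim _ _

instance : HasZeroObject (TopMod e) :=
  ⟨zeroMod e, by
    rw [IsZero.iff_id_eq_zero]
    ext n : 2
    refine TensorProduct.ext' fun m t => ?_
    have : m = 0 := Subsingleton.elim (α := PUnit) _ _
    rw [this, zero_tmul, map_zero, map_zero]⟩

open ZeroObject in
instance : HasZeroObject (HoCat e) :=
  ⟨(hoFunctor e).obj 0, by
    rw [IsZero.iff_id_eq_zero, ← (hoFunctor e).map_id, id_zero, Functor.map_zero]⟩

instance (n : ℤ) : (shiftFunctor (HoCat e) n).Additive := by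
  have : (hoFunctor e ⋙ shiftFunctor (HoCat e) n).Additive :=
    Functor.additive_of_iso ((hoFunctor e).commShiftIso n)
  exact Functor.additive_of_full_essSurj_comp (hoFunctor e) (shiftFunctor (HoCat e) n)

end Homotopy

/-! ### Cones and cylinders -/

lemma coderivation_sandwich {A : TopAInfAlg K} {M N P Q : Type u}
    [AddCommGroup M] [Module K M] [AddCommGroup N] [Module K N]
    [AddCommGroup P] [Module K P] [AddCommGroup Q] [Module K Q]
    {g : Cof K A.carrier P →ₗ[K] Cof K A.carrier Q}
    {d s : Cof K A.carrier N →ₗ[K] Cof K A.carrier P}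
    {f : Cof K A.carrier M →ₗ[K] Cof K A.carrier N}
    {a : TensorAlgebra K A.carrier →ₗ[K] TensorAlgebra K A.carrier}
    (hg : IsComoduleMap K A.carrier g) (hf : IsComoduleMap K A.carrier f)
    (hd : coact K A.carrier P ∘ₗ d =
      (TensorProduct.map d LinearMap.id + TensorProduct.map s a) ∘ₗ coact K A.carrier N) :
    coact K A.carrier Q ∘ₗ (g ∘ₗ d ∘ₗ f) =
      (TensorProduct.map (g ∘ₗ d ∘ₗ f) LinearMap.id + TensorProduct.map (g ∘ₗ s ∘ₗ f) a) ∘ₗ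
        coact K A.carrier M := by
  unfold IsComoduleMap at hg hf
  rw [← LinearMap.comp_assoc, hg, LinearMap.comp_assoc, ← LinearMap.comp_assoc f d, hd,
    LinearMap.comp_assoc, hf, ← LinearMap.comp_assoc, ← LinearMap.comp_assoc]
  congr 1
  refine TensorProduct.ext' fun x t => ?_
  simp

namespace TopMod

variable {e : A.StrictUnit}

section Twist

variable (M N : TopMod e)

/-- The codifferential `(x, y) ↦ (d_M x, φ x + d_N y)` on `(M ⊕ N)[1] ⊗ T(A[1])`. -/
def twistD (φ : Ser K M.R N.R) :
    Ser K (Cof K A.carrier (M.carrier × N.carrier)) (Cof K A.carrier (M.carrier × N.carrier)) :=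
  fun n =>
    strictMap K A.carrier (LinearMap.inl K M.carrier N.carrier) ∘ₗ M.d n ∘ₗ
        strictMap K A.carrier (LinearMap.fst K M.carrier N.carrier) +
      strictMap K A.carrier (LinearMap.inr K M.carrier N.carrier) ∘ₗ φ n ∘ₗ
        strictMap K A.carrier (LinearMap.fst K M.carrier N.carrier) +
      strictMap K A.carrier (LinearMap.inr K M.carrier N.carrier) ∘ₗ N.d n ∘ₗ
        strictMap K A.carrier (LinearMap.snd K M.carrier N.carrier)

variable {M N}

lemma toCogen_twistD (φ : Ser K M.R N.R) (n : ℕ) (x : Cof K A.carrier (M.carrier × N.carrier)) :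
    toCogen K A.carrier _ (twistD M N φ n x) =
      (toCogen K A.carrier _ (M.d n (strictMap K A.carrier (LinearMap.fst K _ _) x)),
        toCogen K A.carrier _ (φ n (strictMap K A.carrier (LinearMap.fst K _ _) x)) +
        toCogen K A.carrier _ (N.d n (strictMap K A.carrier (LinearMap.snd K _ _) x))) := by
  simp only [twistD, LinearMap.add_apply, LinearMap.comp_apply, map_add, toCogen_strictMap]
  simp

lemma strictMap_comp {U V W B : Type u} [AddCommGroup U] [Module K U] [AddCommGroup V]
    [Module K V] [AddCommGroup W] [Module K W] [AddCommGroup B] [Module K B]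
    (g : V →ₗ[K] W) (f : U →ₗ[K] V) :
    strictMap K B g ∘ₗ strictMap K B f = strictMap K B (g ∘ₗ f) :=
  (LinearMap.rTensor_comp _ g f).symm

lemma fst_twistD (φ : Ser K M.R N.R) (n : ℕ) :
    strictMap K A.carrier (LinearMap.fst K _ _) ∘ₗ twistD M N φ n =
      M.d n ∘ₗ strictMap K A.carrier (LinearMap.fst K _ _) := by
  simp only [twistD, LinearMap.comp_add, ← LinearMap.comp_assoc, strictMap_comp,
    LinearMap.fst_comp_inl, LinearMap.fst_comp_inr]
  simp

lemma snd_twistD (φ : Ser K M.R N.R) (n : ℕ) :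
    strictMap K A.carrier (LinearMap.snd K _ _) ∘ₗ twistD M N φ n =
      φ n ∘ₗ strictMap K A.carrier (LinearMap.fst K _ _) +
      N.d n ∘ₗ strictMap K A.carrier (LinearMap.snd K _ _) := by
  simp only [twistD, LinearMap.comp_add, ← LinearMap.comp_assoc, strictMap_comp,
    LinearMap.snd_comp_inl, LinearMap.snd_comp_inr]
  simp

lemma twistD_inr (φ : Ser K M.R N.R) (n : ℕ) :
    twistD M N φ n ∘ₗ strictMap K A.carrier (LinearMap.inr K _ _) =
      strictMap K A.carrier (LinearMap.inr K _ _) ∘ₗ N.d n := by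
  simp only [twistD, LinearMap.add_comp, LinearMap.comp_assoc, strictMap_comp,
    LinearMap.fst_comp_inr, LinearMap.snd_comp_inr]
  simp

lemma ext_prod {B U V X : Type u} [AddCommGroup B] [Module K B] [AddCommGroup U] [Module K U]
    [AddCommGroup V] [Module K V] [AddCommGroup X] [Module K X]
    {f g : X →ₗ[K] Cof K B (U × V)}
    (h1 : strictMap K B (LinearMap.fst K U V) ∘ₗ f = strictMap K B (LinearMap.fst K U V) ∘ₗ g)
    (h2 : strictMap K B (LinearMap.snd K U V) ∘ₗ f = strictMap K B (LinearMap.snd K U V) ∘ₗ g) :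
    f = g := by
  have key : strictMap K B (LinearMap.inl K U V) ∘ₗ strictMap K B (LinearMap.fst K U V) +
      strictMap K B (LinearMap.inr K U V) ∘ₗ strictMap K B (LinearMap.snd K U V) =
      LinearMap.id := by
    rw [strictMap_comp, strictMap_comp, ← LinearMap.rTensor_add]
    convert! LinearMap.rTensor_id (TensorAlgebra K B) (U × V) using 2
    ext <;> simp
  rw [← LinearMap.id_comp f, ← LinearMap.id_comp g, ← key, LinearMap.add_comp, LinearMap.add_comp,
    LinearMap.comp_assoc, LinearMap.comp_assoc, LinearMap.comp_assoc, LinearMap.comp_assoc, h1, h2]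

lemma twistD_comp (φ : Ser K M.R N.R) (h : N.d.comp φ + φ.comp M.d = 0) :
    (twistD M N φ).comp (twistD M N φ) = 0 := by
  have f1 : (Ser.const (strictMap K A.carrier (LinearMap.fst K M.carrier N.carrier))).comp
      (twistD M N φ) = M.d.comp (Ser.const (strictMap K A.carrier (LinearMap.fst K _ _))) := by
    rw [Ser.const_comp, Ser.comp_const]; exact funext (fst_twistD φ)
  have f2 : (Ser.const (strictMap K A.carrier (LinearMap.snd K M.carrier N.carrier))).comp
      (twistD M N φ) = φ.comp (Ser.const (strictMap K A.carrier (LinearMap.fst K _ _))) +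
        N.d.comp (Ser.const (strictMap K A.carrier (LinearMap.snd K _ _))) := by
    rw [Ser.const_comp, Ser.comp_const, Ser.comp_const]; exact funext (snd_twistD φ)
  have g1 : (Ser.const (strictMap K A.carrier (LinearMap.fst K M.carrier N.carrier))).comp
      ((twistD M N φ).comp (twistD M N φ)) = 0 := by
    rw [← Ser.comp_assoc, f1, Ser.comp_assoc, f1, ← Ser.comp_assoc, M.d_comp_d, Ser.zero_comp]
  have g2 : (Ser.const (strictMap K A.carrier (LinearMap.snd K M.carrier N.carrier))).comp
      ((twistD M N φ).comp (twistD M N φ)) = 0 := by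
    rw [← Ser.comp_assoc, f2, Ser.add_comp, Ser.comp_assoc, f1, Ser.comp_assoc, f2, Ser.comp_add,
      ← Ser.comp_assoc, ← Ser.comp_assoc, ← Ser.comp_assoc, N.d_comp_d, Ser.zero_comp, add_zero,
      ← Ser.add_comp, add_comm, h, Ser.zero_comp]
  rw [Ser.const_comp] at g1 g2
  funext n
  exact ext_prod ((congrFun g1 n).trans (LinearMap.comp_zero _).symm)
    ((congrFun g2 n).trans (LinearMap.comp_zero _).symm)

variable (M N)

lemma cofreeSign_prod : cofreeSign A.toBigradedSpace (M.toBigradedSpace.prod N.toBigradedSpace) =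
    strictMap K A.carrier (LinearMap.inl K _ _) ∘ₗ cofreeSign A.toBigradedSpace M.toBigradedSpace ∘ₗ
        strictMap K A.carrier (LinearMap.fst K _ _) +
      strictMap K A.carrier (LinearMap.inr K _ _) ∘ₗ
        cofreeSign A.toBigradedSpace N.toBigradedSpace ∘ₗ
        strictMap K A.carrier (LinearMap.snd K _ _) := by
  have hp : (M.toBigradedSpace.prod N.toBigradedSpace).parity =
      LinearMap.inl K _ _ ∘ₗ M.parity ∘ₗ LinearMap.fst K _ _ +
      LinearMap.inr K _ _ ∘ₗ N.parity ∘ₗ LinearMap.snd K _ _ := by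
    refine BigradedSpace.hom_ext _ fun i j m hm => ?_
    rw [BigradedSpace.parity_of_mem _ hm]
    have h1 : M.parity m.1 = (-1 : K) ^ i • m.1 := BigradedSpace.parity_of_mem _ hm.1
    have h2 : N.parity m.2 = (-1 : K) ^ i • m.2 := BigradedSpace.parity_of_mem _ hm.2
    ext <;> simp [h1, h2]
  refine TensorProduct.ext' fun x t => ?_
  simp only [cofreeSign, hp, LinearMap.add_apply, LinearMap.comp_apply, LinearMap.rTensor_tmul,
    TensorProduct.map_tmul, LinearMap.neg_apply, neg_add, add_tmul, map_neg]

/-- The module on `M ⊕ N` with codifferential `(x, y) ↦ (d_M x, φ x + d_N y)`, for a strictly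
unital series `φ` of comodule maps of bidegree `(1, 0)` with `d_N ∘ φ + φ ∘ d_M = 0`. -/
abbrev twist (φ : Ser K M.R N.R) (hφ : IsPreHom M N 1 φ) (h : N.d.comp φ + φ.comp M.d = 0) :
    TopMod e where
  toBigradedSpace := M.toBigradedSpace.prod N.toBigradedSpace
  d := twistD M N φ
  d_degree n := by
    have i1 := hasDegree_strictMap (A := A.toBigradedSpace) (M := M.toBigradedSpace)
      (N := M.toBigradedSpace.prod N.toBigradedSpace) (l := LinearMap.inl K _ _)
      (fun i j m hm => ⟨hm, Submodule.zero_mem _⟩)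
    have i2 := hasDegree_strictMap (A := A.toBigradedSpace) (M := N.toBigradedSpace)
      (N := M.toBigradedSpace.prod N.toBigradedSpace) (l := LinearMap.inr K _ _)
      (fun i j m hm => ⟨Submodule.zero_mem _, hm⟩)
    have p1 := hasDegree_strictMap (A := A.toBigradedSpace)
      (M := M.toBigradedSpace.prod N.toBigradedSpace) (N := M.toBigradedSpace)
      (l := LinearMap.fst K _ _) (fun i j m hm => hm.1)
    have p2 := hasDegree_strictMap (A := A.toBigradedSpace)
      (M := M.toBigradedSpace.prod N.toBigradedSpace) (N := N.toBigradedSpace)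
      (l := LinearMap.snd K _ _) (fun i j m hm => hm.2)
    have c1 := i1.comp ((M.d_degree n).comp p1 (zero_add 1)) (add_zero 1)
    have c2 := i2.comp ((hφ.degree n).comp p1 (zero_add 1)) (add_zero 1)
    have c3 := i2.comp ((N.d_degree n).comp p2 (zero_add 1)) (add_zero 1)
    exact fun i j x hx => add_mem (add_mem (c1 i j x hx) (c2 i j x hx)) (c3 i j x hx)
  d_coderivation n := by
    have hz : coact K A.carrier N.carrier ∘ₗ φ n = (TensorProduct.map (φ n) LinearMap.id +
        TensorProduct.map (0 : M.R →ₗ[K] N.R) (A.d n)) ∘ₗ coact K A.carrier M.carrier := by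
      rw [TensorProduct.map_zero_left, add_zero]
      exact hφ.comodule n
    have c1 := coderivation_sandwich (coact_strictMap (LinearMap.inl K M.carrier N.carrier))
      (coact_strictMap (LinearMap.fst K M.carrier N.carrier)) (M.d_coderivation n)
    have c2 := coderivation_sandwich (coact_strictMap (LinearMap.inr K M.carrier N.carrier))
      (coact_strictMap (LinearMap.fst K M.carrier N.carrier)) hz
    have c3 := coderivation_sandwich (coact_strictMap (LinearMap.inr K M.carrier N.carrier))
      (coact_strictMap (LinearMap.snd K M.carrier N.carrier)) (N.d_coderivation n)
    rw [cofreeSign_prod, twistD, LinearMap.comp_add, LinearMap.comp_add, c1, c2, c3,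
      ← LinearMap.add_comp, ← LinearMap.add_comp]
    congr 1
    refine TensorProduct.ext' fun x t => ?_
    simp only [LinearMap.add_apply, TensorProduct.map_tmul, add_tmul, LinearMap.zero_comp,
      LinearMap.comp_zero, LinearMap.zero_apply, zero_tmul]
    abel
  d_comp_d := twistD_comp φ h
  unit_act n m := by
    have h0 : toCogen K A.carrier N.carrier (φ n (m.1 ⊗ₜ TensorAlgebra.ι K e.one)) = 0 := by
      have := hφ.unital n m.1 1 1
      rwa [one_mul, mul_one] at this
    have h1 := BigradedSpace.parity_comp (M := M.toBigradedSpace.prod N.toBigradedSpace)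
      (N := M.toBigradedSpace) (l := LinearMap.fst K _ _) (fun i j m hm => hm.1)
    have h2 := BigradedSpace.parity_comp (M := M.toBigradedSpace.prod N.toBigradedSpace)
      (N := N.toBigradedSpace) (l := LinearMap.snd K _ _) (fun i j m hm => hm.2)
    have h1' := LinearMap.congr_fun h1 m
    have h2' := LinearMap.congr_fun h2 m
    simp only [LinearMap.comp_apply, LinearMap.fst_apply, LinearMap.snd_apply] at h1' h2'
    rw [toCogen_twistD, LinearMap.rTensor_tmul, LinearMap.rTensor_tmul, LinearMap.fst_apply,
      LinearMap.snd_apply, h0, M.unit_act, N.unit_act, zero_add]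
    split_ifs
    · exact Prod.ext h1' h2'
    · rfl
  unit_right n m a s t := by
    have h0 := hφ.unital n m.1 (TensorAlgebra.ι K a * s) t
    rw [toCogen_twistD, LinearMap.rTensor_tmul, LinearMap.rTensor_tmul, LinearMap.fst_apply,
      LinearMap.snd_apply, h0, M.unit_right, N.unit_right, zero_add]
    rfl
  unit_left n m a s t := by
    have h0 := hφ.unital n m.1 s (t * TensorAlgebra.ι K a)
    rw [← mul_assoc] at h0
    rw [toCogen_twistD, LinearMap.rTensor_tmul, LinearMap.rTensor_tmul, LinearMap.fst_apply,
      LinearMap.snd_apply, h0, M.unit_left, N.unit_left, zero_add]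
    rfl

end Twist

end TopMod

section Aux

variable {U V W X Y : Type u} [AddCommGroup U] [Module K U] [AddCommGroup V] [Module K V]
  [AddCommGroup W] [Module K W] [AddCommGroup X] [Module K X] [AddCommGroup Y] [Module K Y]

lemma Ser.anticomm_aux {d : Ser K V V} {d' : Ser K W W} {f : Ser K V W}
    (h : d'.comp f = f.comp d) : d'.comp f + f.comp ((-1 : K) ^ (1 : ℤ) • d) = 0 := by
  rw [Ser.comp_smul, h, zpow_one, neg_one_smul, add_neg_cancel]

lemma comp_comm_aux {D : W →ₗ[K] W} {D' : V →ₗ[K] V} {d : U →ₗ[K] U} {i : V →ₗ[K] W}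
    {j : U →ₗ[K] V} (h1 : D ∘ₗ i = i ∘ₗ D') (h2 : D' ∘ₗ j = j ∘ₗ d) :
    D ∘ₗ (i ∘ₗ j) = (i ∘ₗ j) ∘ₗ d := by
  rw [← LinearMap.comp_assoc, h1, LinearMap.comp_assoc, h2, LinearMap.comp_assoc]

lemma comp_add_aux {S : V →ₗ[K] W} {c : X →ₗ[K] V} {f : X →ₗ[K] W} {D : V →ₗ[K] V}
    {d : W →ₗ[K] W} {P : Y →ₗ[K] X} {Q T : Y →ₗ[K] V} (h1 : S ∘ₗ c = f) (h2 : S ∘ₗ D = d ∘ₗ S)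
    (h3 : T = c ∘ₗ P + D ∘ₗ Q) : f ∘ₗ P + d ∘ₗ S ∘ₗ Q = S ∘ₗ T := by
  rw [h3, LinearMap.comp_add, ← h1, LinearMap.comp_assoc, ← LinearMap.comp_assoc Q S d, ← h2,
    LinearMap.comp_assoc]

end Aux

namespace TopMod

variable {e : A.StrictUnit}

lemma IsPreHom.shiftSource {M N : TopMod e} {r : ℤ} {f : Ser K M.R N.R} (hf : IsPreHom M N r f)
    (a k : ℤ) (h : r + a = k) : IsPreHom (M.shiftObj a) N k f where
  comodule n := hf.comodule n
  degree n i j x hx := by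
    rw [cofreeGr_shift] at hx
    have := hf.degree n _ _ _ hx
    rwa [show i + a + r = i + k by omega] at this
  unital n := hf.unital n

/-- The direct sum `M ⊕ N`. -/
abbrev prod (M N : TopMod e) : TopMod e :=
  twist M N 0 (IsPreHom.zero M N 1) (by rw [Ser.comp_zero, Ser.zero_comp, add_zero])

/-- The cone `C(f) = M[1] ⊕ N`, with codifferential `(x, y) ↦ (-d_M x, f x + d_N y)`. -/
abbrev cone {M N : TopMod e} (f : M ⟶ N) : TopMod e :=
  twist (M.shiftObj 1) N f.ser (f.isPreHom.shiftSource 1 1 (zero_add 1)) (by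
    exact Ser.anticomm_aux f.comm)

/-- The map `M → M ⊕ N`, `m ↦ (-m, f m)`. -/
def cylMap {M N : TopMod e} (f : M ⟶ N) : Ser K M.R (M.prod N).R :=
  -(Ser.const (strictMap K A.carrier (LinearMap.inl K M.carrier N.carrier))) +
    (Ser.const (strictMap K A.carrier (LinearMap.inr K M.carrier N.carrier))).comp f.ser

lemma isPreHom_cylMap {M N : TopMod e} (f : M ⟶ N) : IsPreHom M (M.prod N) 0 (cylMap f) :=
  (IsPreHom.const (M := M) (N := M.prod N) (l := LinearMap.inl K M.carrier N.carrier)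
    (fun _ _ _ hm => ⟨hm, Submodule.zero_mem _⟩)).neg.add
  ((IsPreHom.const (M := N) (N := M.prod N) (l := LinearMap.inr K M.carrier N.carrier)
    (fun _ _ _ hm => ⟨Submodule.zero_mem _, hm⟩)).comp f.isPreHom (add_zero 0))

lemma twistD_inl {M N : TopMod e} (φ : Ser K M.R N.R) (n : ℕ) :
    twistD M N φ n ∘ₗ strictMap K A.carrier (LinearMap.inl K _ _) =
      strictMap K A.carrier (LinearMap.inl K _ _) ∘ₗ M.d n +
        strictMap K A.carrier (LinearMap.inr K _ _) ∘ₗ φ n := by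
  simp only [twistD, LinearMap.add_comp, LinearMap.comp_assoc, strictMap_comp,
    LinearMap.fst_comp_inl, LinearMap.snd_comp_inl]
  simp

lemma cylMap_comm {M N : TopMod e} (f : M ⟶ N) :
    (M.prod N).d.comp (cylMap f) = (cylMap f).comp M.d := by
  have h1 : (twistD M N 0).comp (Ser.const (strictMap K A.carrier (LinearMap.inl K _ _))) =
      (Ser.const (strictMap K A.carrier (LinearMap.inl K M.carrier N.carrier))).comp M.d := by
    rw [Ser.const_comp, Ser.comp_const]
    funext n
    rw [twistD_inl, Pi.zero_apply, LinearMap.comp_zero, add_zero]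
  have h2 : (twistD M N 0).comp (Ser.const (strictMap K A.carrier (LinearMap.inr K _ _))) =
      (Ser.const (strictMap K A.carrier (LinearMap.inr K M.carrier N.carrier))).comp N.d := by
    rw [Ser.const_comp, Ser.comp_const]
    funext n
    rw [twistD_inr]
  change (twistD M N 0).comp (cylMap f) = _
  rw [cylMap, Ser.comp_add, Ser.comp_neg, h1, ← Ser.comp_assoc, h2, Ser.comp_assoc, f.comm,
    Ser.add_comp, Ser.neg_comp, Ser.comp_assoc]

/-- The cylinder `Cyl(f) = M ⊕ M[1] ⊕ N`, with codifferential
`(m, m', n) ↦ (d_M m - m', -d_M m', f m' + d_N n)`. The underlying space is written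
`M[1] ⊕ (M ⊕ N)`, with elements `(m', (m, n))`. -/
abbrev cyl {M N : TopMod e} (f : M ⟶ N) : TopMod e :=
  twist (M.shiftObj 1) (M.prod N) (cylMap (M := M) f) ((isPreHom_cylMap f).shiftSource 1 1 (zero_add 1)) (by
    exact Ser.anticomm_aux (cylMap_comm f))

/-- The inclusion `N → C(f)`. -/
def coneIn {M N : TopMod e} (f : M ⟶ N) : N ⟶ cone f :=
  strictHom (LinearMap.inr K M.carrier N.carrier) (fun _ _ _ hm => ⟨Submodule.zero_mem _, hm⟩)
    (twistD_inr (M := M.shiftObj 1) f.ser)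

/-- The projection `C(f) → M[1]`. -/
def coneOut {M N : TopMod e} (f : M ⟶ N) : cone f ⟶ M.shiftObj 1 :=
  strictHom (LinearMap.fst K M.carrier N.carrier) (fun _ _ _ hm => hm.1)
    (fun n => (fst_twistD (M := M.shiftObj 1) f.ser n).symm)

/-- The inclusion `M → Cyl(f)`. -/
def cylIn {M N : TopMod e} (f : M ⟶ N) : M ⟶ cyl f :=
  strictHom (LinearMap.inr K M.carrier (M.carrier × N.carrier) ∘ₗ
      LinearMap.inl K M.carrier N.carrier)
    (fun _ _ _ hm => ⟨Submodule.zero_mem _, hm, Submodule.zero_mem _⟩)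
    (fun n => by
      have h1 := twistD_inr (M := M.shiftObj 1) (N := M.prod N) (cylMap (M := M) f) n
      have h2 := twistD_inl (M := M) (N := N) 0 n
      rw [Pi.zero_apply, LinearMap.comp_zero, add_zero] at h2
      rw [← strictMap_comp]
      exact comp_comm_aux h1 h2)

/-- The projection `Cyl(f) → C(f)`. -/
def cylOut {M N : TopMod e} (f : M ⟶ N) : cyl f ⟶ cone f :=
  strictHom ((LinearMap.id : M.carrier →ₗ[K] M.carrier).prodMap
      (LinearMap.snd K M.carrier N.carrier))
    (fun _ _ _ hm => ⟨hm.1, hm.2.2⟩)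
    (fun n => by
      have a1 := fst_twistD (M := M.shiftObj 1) (N := M.prod N) (cylMap (M := M) f) n
      have a2 := snd_twistD (M := M.shiftObj 1) (N := M.prod N) (cylMap (M := M) f) n
      have b1 := fst_twistD (M := M.shiftObj 1) (N := N) f.ser n
      have b2 := snd_twistD (M := M.shiftObj 1) (N := N) f.ser n
      have b3 := snd_twistD (M := M) (N := N) 0 n
      have c1 : strictMap K A.carrier (LinearMap.snd K M.carrier N.carrier) ∘ₗ cylMap f n =
          f.ser n := by
        rw [cylMap, Pi.add_apply, Ser.const_comp, LinearMap.comp_add, ← LinearMap.comp_assoc,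
          strictMap_comp, LinearMap.snd_comp_inr, Pi.neg_apply, Ser.const]
        split_ifs
        · rw [LinearMap.comp_neg, strictMap_comp, LinearMap.snd_comp_inl]; simp
        · simp
      have q1 : LinearMap.fst K M.carrier N.carrier ∘ₗ
          (LinearMap.id : M.carrier →ₗ[K] M.carrier).prodMap (LinearMap.snd K M.carrier N.carrier) =
          LinearMap.fst K M.carrier (M.carrier × N.carrier) := rfl
      have q2 : LinearMap.snd K M.carrier N.carrier ∘ₗ
          (LinearMap.id : M.carrier →ₗ[K] M.carrier).prodMap (LinearMap.snd K M.carrier N.carrier) =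
          LinearMap.snd K M.carrier N.carrier ∘ₗ
            LinearMap.snd K M.carrier (M.carrier × N.carrier) := rfl
      rw [Pi.zero_apply, LinearMap.zero_comp, zero_add] at b3
      apply ext_prod
      · rw [← LinearMap.comp_assoc, b1, LinearMap.comp_assoc, strictMap_comp, q1,
          ← LinearMap.comp_assoc, strictMap_comp, q1]
        exact a1.symm
      · rw [← LinearMap.comp_assoc, b2, LinearMap.add_comp, LinearMap.comp_assoc, strictMap_comp,
          LinearMap.comp_assoc, strictMap_comp, q1, q2, ← LinearMap.comp_assoc, strictMap_comp, q2,
          ← strictMap_comp, LinearMap.comp_assoc]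
        exact comp_add_aux c1 b3 a2)

/-- The sequence `M → N → C(f) → M[1]`. -/
def coneTriangle {M N : TopMod e} (f : M ⟶ N) : Pretriangulated.Triangle (TopMod e) :=
  Pretriangulated.Triangle.mk f (coneIn f) (coneOut f)

/-- The sequence `M → Cyl(f) → C(f) → M[1]`. -/
def cylTriangle {M N : TopMod e} (f : M ⟶ N) : Pretriangulated.Triangle (TopMod e) :=
  Pretriangulated.Triangle.mk (cylIn f) (cylOut f) (coneOut f)

/-! ### Semi-split sequences -/

/-- The Taylor component `m ↦ f̄ⁿ(m | a₁, …, aₙ)` of `f`, for `w = a₁ ⊗ ⋯ ⊗ aₙ`. -/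
def taylor {M N : TopMod e} (f : Ser K M.R N.R) (w : TensorAlgebra K A.carrier) :
    Ser K M.carrier N.carrier :=
  fun n => toCogen K A.carrier N.carrier ∘ₗ f n ∘ₗ
    (TensorProduct.mk K M.carrier (TensorAlgebra K A.carrier)).flip w

/-- `f` is strict: its Taylor components `f̄ⁿ`, `n ≥ 1`, vanish. -/
def IsStrict {M N : TopMod e} (f : M ⟶ N) : Prop :=
  ∀ a t, taylor f.ser (TensorAlgebra.ι K a * t) = 0

/-- `M → M' → M''` is a semi-split sequence of strict morphisms, with splitting `ρ`: it is short
exact in every bidegree, and `ρ` is a `K⟦ħ⟧`-linear map `M' → M` of bidegree `(0, 0)`, regarded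
as a strict map, with `ρ ∘ f = 1` and `ρ ∘ d̄ⁿ = d̄ⁿ ∘ (ρ ⊗ 1)` for `n ≥ 1`. -/
structure IsSemiSplit {M M' M'' : TopMod e} (f : M ⟶ M') (g : M' ⟶ M'')
    (ρ : Ser K M'.carrier M.carrier) : Prop where
  strict_left : IsStrict f
  strict_right : IsStrict g
  injective : ∀ i j, ∀ x ∈ M.seriesGr i j, (taylor f.ser 1).eval x = 0 → x = 0
  exact : ∀ i j, ∀ y ∈ M'.seriesGr i j, (taylor g.ser 1).eval y = 0 ↔
    ∃ x ∈ M.seriesGr i j, (taylor f.ser 1).eval x = y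
  surjective : ∀ i j, ∀ z ∈ M''.seriesGr i j, ∃ y ∈ M'.seriesGr i j, (taylor g.ser 1).eval y = z
  degree : ∀ n i j, ∀ y ∈ M'.gr i j, ρ n y ∈ M.gr i j
  retraction : ρ.comp (taylor f.ser 1) = Ser.const LinearMap.id
  compatible : ∀ a t, ρ.comp (taylor M'.d (TensorAlgebra.ι K a * t)) =
    (taylor M.d (TensorAlgebra.ι K a * t)).comp ρ

/-- `h : M'' → M[1]` is the connecting morphism of a semi-split sequence `M → M' → M''` with
splitting `ρ`: `h ∘ g = d_M ∘ P - P ∘ d_M'` with `P = ρ ⊗ 1`. In other words, the codifferential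
of `M' = M ⊕ M''` is `(x, z) ↦ (d_M x - h z, d_M'' z)`. -/
def IsConnecting {M M' M'' : TopMod e} (g : M' ⟶ M'') (ρ : Ser K M'.carrier M.carrier)
    (h : M'' ⟶ M.shiftObj 1) : Prop :=
  (h.ser.comp g.ser : Ser K M'.R M.R) =
    M.d.comp (fun n => strictMap K A.carrier (ρ n)) -
      Ser.comp (fun n => strictMap K A.carrier (ρ n)) M'.d

/-! ### Quasi-isomorphisms -/

/-- `f` is a quasi-isomorphism: `f⁰` induces in every bidegree a bijection between the
cohomology of `M` and that of `N` with respect to the differentials `d⁰`. -/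
structure IsQuasiIso {M N : TopMod e} (f : M ⟶ N) : Prop where
  injective : ∀ i j, ∀ x ∈ M.seriesGr i j, (taylor M.d 1).eval x = 0 →
    (∃ y ∈ N.seriesGr (i - 1) j, (taylor N.d 1).eval y = (taylor f.ser 1).eval x) →
      ∃ x' ∈ M.seriesGr (i - 1) j, (taylor M.d 1).eval x' = x
  surjective : ∀ i j, ∀ y ∈ N.seriesGr i j, (taylor N.d 1).eval y = 0 →
    ∃ x ∈ M.seriesGr i j, (taylor M.d 1).eval x = 0 ∧
      ∃ y' ∈ N.seriesGr (i - 1) j, y = (taylor f.ser 1).eval x + (taylor N.d 1).eval y'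

end TopMod

section

variable (e : A.StrictUnit)

/-- The triangles in the homotopy category which are isomorphic to a triangle
`M → M' → M'' → M[1]` coming from a semi-split sequence of strict morphisms. -/
def semiSplitTriangles : Set (Pretriangulated.Triangle (HoCat e)) :=
  {T | ∃ (M M' M'' : TopMod e) (f : M ⟶ M') (g : M' ⟶ M'') (ρ : Ser K M'.carrier M.carrier)
    (h : M'' ⟶ M.shiftObj 1), TopMod.IsSemiSplit f g ρ ∧ TopMod.IsConnecting g ρ h ∧
      Nonempty (T ≅ (hoFunctor e).mapTriangle.obj (Pretriangulated.Triangle.mk f g h))}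

/-- The class of quasi-isomorphisms in the homotopy category. -/
def qis : MorphismProperty (HoCat e) := fun X Y φ =>
  ∃ f : X.as ⟶ Y.as, (hoFunctor e).map f = φ ∧ TopMod.IsQuasiIso f

end

end

end TopAInf

open CategoryTheory.Pretriangulated TopAInf

/-! A series of comodule maps is treated as one morphism with a Cauchy-product composition. Almost
everything then reduces to matrix identities on direct sums of cofree comodules, checked entry by
entry with `Ser.prod_ext` and `Ser.coprod_ext`.

Connecting morphism. The retraction `ρ` and exactness make `(g, ρ)` jointly injective in every
bidegree. The lift of an element of `M''` that is killed by `ρ` is therefore unique, hence linear in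
that element, and these lifts assemble to a section `σ` with `f ρ + σ g = 1`
(`IsSemiSplit.exists_section`). The defect `E = d P - P d` with `P = ρ ⊗ 1` is a comodule map
because the `d_A`-terms of the two coderivations cancel. It is strict because `ρ` commutes with the
higher Taylor components, and it kills `f`. Hence `E = (E σ) g`, and `h = E σ` is forced because `g`
is a split epimorphism.

Triangulation. The semi-split triangles are exactly those isomorphic to cone triangles
(`mem_semiSplitTriangles_iff`). A split sequence has `M''` homotopy equivalent to `C(f)` through `z
↦ (h z, σ z)`. Conversely the cylinder sequence is semi-split and `N → Cyl(f)` is a homotopy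
equivalence. The axioms are then checked on cones. The cone of an identity is contractible. The
rotated cone triangle is again split, with connecting map `-f[1]`. In a split sequence `M'` is the
cone of `-h[-1]`. A homotopy commuting square induces a map of cones. For the octahedron, `C(g)` is
a homotopy retract, in fact an equivalent copy, of `C(C(f) → C(f ≫ g))`.

Localization. Flatness makes `m ↦ m ⊗ 1` compatible with the codifferential, so `d⁰` is a
differential and homotopies restrict to the underlying complexes. Acyclic modules form a
triangulated subcategory of the homotopy category, and a morphism is a quasi-isomorphism exactly
when its cone is acyclic (`qis_eq_trW`). The statements about fractions and the derived category are
then those of a Verdier quotient. -/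

namespace TopAInf

noncomputable section

open BigradedSpace

/-! ### Calculus of series on direct sums -/

namespace Ser

section General

variable {K : Type u} [Field K] {U V W X : Type u} [AddCommGroup U] [Module K U]
  [AddCommGroup V] [Module K V] [AddCommGroup W] [Module K W] [AddCommGroup X] [Module K X]

/-- Composites are kept nested to the right, so an equation between two factors has to be usable in
front of a further factor; the lemmas ending in `_assoc` come from this one. -/
lemma comp_eq_assoc {g : Ser K V W} {f : Ser K U V} {k : Ser K U W} (h : g.comp f = k)
    (x : Ser K X U) : g.comp (f.comp x) = k.comp x := by
  rw [← Ser.comp_assoc, h]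

lemma const_comp_const (l : V →ₗ[K] W) (l' : U →ₗ[K] V) :
    (Ser.const l).comp (Ser.const l') = Ser.const (l ∘ₗ l') := by
  rw [Ser.const_comp]
  funext n
  simp only [Ser.const]
  split_ifs <;> simp

lemma const_zero : Ser.const (0 : V →ₗ[K] W) = 0 := by
  funext n
  simp [Ser.const]

lemma const_add (l l' : V →ₗ[K] W) : Ser.const (l + l') = Ser.const l + Ser.const l' := by
  funext n
  simp only [Ser.const, Pi.add_apply]
  split_ifs <;> simp

end General

section Sum

variable (K : Type u) [Field K] (B U V : Type u) [AddCommGroup B] [Module K B]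
  [AddCommGroup U] [Module K U] [AddCommGroup V] [Module K V]

/-- The first inclusion `U ⊗ T(B) → (U × V) ⊗ T(B)`. -/
def inl : Ser K (Cof K B U) (Cof K B (U × V)) := Ser.const (strictMap K B (LinearMap.inl K U V))

/-- The second inclusion `V ⊗ T(B) → (U × V) ⊗ T(B)`. -/
def inr : Ser K (Cof K B V) (Cof K B (U × V)) := Ser.const (strictMap K B (LinearMap.inr K U V))

/-- The first projection `(U × V) ⊗ T(B) → U ⊗ T(B)`. -/
def fst : Ser K (Cof K B (U × V)) (Cof K B U) := Ser.const (strictMap K B (LinearMap.fst K U V))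

/-- The second projection `(U × V) ⊗ T(B) → V ⊗ T(B)`. -/
def snd : Ser K (Cof K B (U × V)) (Cof K B V) := Ser.const (strictMap K B (LinearMap.snd K U V))

lemma fst_inl : (fst K B U V).comp (inl K B U V) = Ser.const LinearMap.id := by
  rw [fst, inl, const_comp_const, TopMod.strictMap_comp, LinearMap.fst_comp_inl, strictMap,
    LinearMap.rTensor_id]

lemma fst_inr : (fst K B U V).comp (inr K B U V) = 0 := by
  rw [fst, inr, const_comp_const, TopMod.strictMap_comp, LinearMap.fst_comp_inr, strictMap,
    LinearMap.rTensor_zero, const_zero]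

lemma snd_inl : (snd K B U V).comp (inl K B U V) = 0 := by
  rw [snd, inl, const_comp_const, TopMod.strictMap_comp, LinearMap.snd_comp_inl, strictMap,
    LinearMap.rTensor_zero, const_zero]

lemma snd_inr : (snd K B U V).comp (inr K B U V) = Ser.const LinearMap.id := by
  rw [snd, inr, const_comp_const, TopMod.strictMap_comp, LinearMap.snd_comp_inr, strictMap,
    LinearMap.rTensor_id]

lemma inl_fst_add_inr_snd :
    (inl K B U V).comp (fst K B U V) + (inr K B U V).comp (snd K B U V) = Ser.const LinearMap.id := by
  rw [inl, inr, fst, snd, const_comp_const, const_comp_const, TopMod.strictMap_comp,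
    TopMod.strictMap_comp, ← const_add, ← LinearMap.rTensor_add]
  congr 1
  convert! LinearMap.rTensor_id (TensorAlgebra K B) (U × V) using 2
  ext <;> simp

variable {K B U V} {X : Type u} [AddCommGroup X] [Module K X]

lemma fst_inl_assoc (x : Ser K X (Cof K B U)) :
    (fst K B U V).comp ((inl K B U V).comp x) = x := by
  rw [comp_eq_assoc (fst_inl K B U V), Ser.id_comp]

lemma fst_inr_assoc (x : Ser K X (Cof K B V)) : (fst K B U V).comp ((inr K B U V).comp x) = 0 := by
  rw [comp_eq_assoc (fst_inr K B U V), Ser.zero_comp]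

lemma snd_inl_assoc (x : Ser K X (Cof K B U)) : (snd K B U V).comp ((inl K B U V).comp x) = 0 := by
  rw [comp_eq_assoc (snd_inl K B U V), Ser.zero_comp]

lemma snd_inr_assoc (x : Ser K X (Cof K B V)) : (snd K B U V).comp ((inr K B U V).comp x) = x := by
  rw [comp_eq_assoc (snd_inr K B U V), Ser.id_comp]

/-- Follows from the decomposition of the identity into the two summands. Together with `coprod_ext`
it turns identities on cones and cylinders into equations between matrix entries. -/
lemma prod_ext {f g : Ser K X (Cof K B (U × V))}
    (h₁ : (fst K B U V).comp f = (fst K B U V).comp g)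
    (h₂ : (snd K B U V).comp f = (snd K B U V).comp g) : f = g := by
  rw [← Ser.id_comp f, ← Ser.id_comp g, ← inl_fst_add_inr_snd, Ser.add_comp, Ser.add_comp,
    Ser.comp_assoc, Ser.comp_assoc, Ser.comp_assoc, Ser.comp_assoc, h₁, h₂]

lemma coprod_ext {f g : Ser K (Cof K B (U × V)) X}
    (h₁ : f.comp (inl K B U V) = g.comp (inl K B U V))
    (h₂ : f.comp (inr K B U V) = g.comp (inr K B U V)) : f = g := by
  rw [← Ser.comp_id f, ← Ser.comp_id g, ← inl_fst_add_inr_snd, Ser.comp_add, Ser.comp_add,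
    ← Ser.comp_assoc, ← Ser.comp_assoc, ← Ser.comp_assoc, ← Ser.comp_assoc, h₁, h₂]

/-- The series `(x, y) ↦ (d x, φ x + d' y)` on a direct sum. -/
def twisted (d : Ser K (Cof K B U) (Cof K B U)) (φ : Ser K (Cof K B U) (Cof K B V))
    (d' : Ser K (Cof K B V) (Cof K B V)) : Ser K (Cof K B (U × V)) (Cof K B (U × V)) :=
  (inl K B U V).comp (d.comp (fst K B U V)) + (inr K B U V).comp (φ.comp (fst K B U V)) +
    (inr K B U V).comp (d'.comp (snd K B U V))

end Sum

end Ser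

variable {K : Type u} [Field K] {A : TopAInfAlg K} {e : A.StrictUnit}

/-! ### Codifferentials and degrees on twisted sums and cones -/

namespace TopMod

/-- Passes from the coefficientwise formula to composites of series, where the matrix calculus
applies. -/
lemma twistD_eq_twisted (M N : TopMod e) (φ : Ser K M.R N.R) :
    twistD M N φ = Ser.twisted M.d φ N.d := by
  simp only [Ser.twisted, Ser.inl, Ser.inr, Ser.fst, Ser.snd, Ser.const_comp, Ser.comp_const]
  rfl

lemma shiftObj_one_d (M : TopMod e) : (M.shiftObj 1).d = (-M.d : Ser K M.R M.R) := by
  change (-1 : K) ^ (1 : ℤ) • M.d = -M.d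
  rw [zpow_one]
  exact neg_one_smul K M.d

lemma cone_d {M N : TopMod e} (f : M ⟶ N) : (cone f).d = Ser.twisted (-M.d) f.ser N.d := by
  change twistD (M.shiftObj 1) N f.ser = _
  rw [twistD_eq_twisted, shiftObj_one_d]

/-- Shifting only renames bidegrees: the comodule and unit conditions see nothing but the underlying
spaces. A component `M[1]` of a cone can thus be handled as `M` itself, at the price of maps of
degree `±1`. -/
lemma isPreHom_shift_source {M N : TopMod e} {f : Ser K M.R N.R} {a k r : ℤ} (h : r + a = k) :
    IsPreHom (M.shiftObj a) N k f ↔ IsPreHom M N r f := by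
  refine ⟨fun hf => ⟨hf.comodule, fun n i j x hx => ?_, hf.unital⟩,
    fun hf => hf.shiftSource a k h⟩
  have := hf.degree n (i - a) j x (by rw [cofreeGr_shift]; simpa using hx)
  rwa [show i - a + k = i + r by omega] at this

lemma isPreHom_shift_target {M N : TopMod e} {f : Ser K M.R N.R} {a k r : ℤ} (h : k + a = r) :
    IsPreHom M (N.shiftObj a) k f ↔ IsPreHom M N r f := by
  have key : ∀ i, i + k + a = i + r := fun i => by omega
  refine ⟨fun hf => ⟨hf.comodule, fun n i j x hx => ?_, hf.unital⟩,
    fun hf => ⟨hf.comodule, fun n i j x hx => ?_, hf.unital⟩⟩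
  · have := hf.degree n i j x hx
    rwa [cofreeGr_shift, key] at this
  · rw [cofreeGr_shift, key]
    exact hf.degree n i j x hx

section Twist

variable (M N : TopMod e) (φ : Ser K M.R N.R) (hφ : IsPreHom M N 1 φ)
  (h : N.d.comp φ + φ.comp M.d = 0)

lemma isPreHom_inl :
    IsPreHom M (twist M N φ hφ h) 0 (Ser.inl K A.carrier M.carrier N.carrier) :=
  IsPreHom.const (M := M) (N := twist M N φ hφ h) (fun _ _ _ hm => ⟨hm, Submodule.zero_mem _⟩)

lemma isPreHom_inr :
    IsPreHom N (twist M N φ hφ h) 0 (Ser.inr K A.carrier M.carrier N.carrier) :=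
  IsPreHom.const (M := N) (N := twist M N φ hφ h) (fun _ _ _ hm => ⟨Submodule.zero_mem _, hm⟩)

lemma isPreHom_fst :
    IsPreHom (twist M N φ hφ h) M 0 (Ser.fst K A.carrier M.carrier N.carrier) :=
  IsPreHom.const (M := twist M N φ hφ h) (N := M) (fun _ _ _ hm => hm.1)

lemma isPreHom_snd :
    IsPreHom (twist M N φ hφ h) N 0 (Ser.snd K A.carrier M.carrier N.carrier) :=
  IsPreHom.const (M := twist M N φ hφ h) (N := N) (fun _ _ _ hm => hm.2)

end Twist

section Cone

variable {M N : TopMod e} (f : M ⟶ N)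

/-- The summand `M[1]` seen from the unshifted `M`: its inclusion has degree `-1`, so composing it
with maps of degree `0` produces candidates for homotopies, and its projection has degree `1`. -/
lemma isPreHom_cone_inl : IsPreHom M (cone f) (-1) (Ser.inl K A.carrier M.carrier N.carrier) :=
  (isPreHom_shift_source (M := M) (a := 1) (by omega)).1 (isPreHom_inl (M.shiftObj 1) N _ _ _)

lemma isPreHom_cone_inr : IsPreHom N (cone f) 0 (Ser.inr K A.carrier M.carrier N.carrier) :=
  isPreHom_inr (M.shiftObj 1) N _ _ _

lemma isPreHom_cone_fst : IsPreHom (cone f) M 1 (Ser.fst K A.carrier M.carrier N.carrier) :=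
  (isPreHom_shift_target (N := M) (a := 1) (by omega)).1 (isPreHom_fst (M.shiftObj 1) N _ _ _)

lemma isPreHom_cone_snd : IsPreHom (cone f) N 0 (Ser.snd K A.carrier M.carrier N.carrier) :=
  isPreHom_snd (M.shiftObj 1) N _ _ _

end Cone

end TopMod

end

end TopAInf

namespace TopAInf

noncomputable section

open BigradedSpace

/-! ### Matrix calculus and identities for split sequences -/

namespace Ser

section Sum

variable {K : Type u} [Field K] {B U V X Y : Type u} [AddCommGroup B] [Module K B]
  [AddCommGroup U] [Module K U] [AddCommGroup V] [Module K V] [AddCommGroup X] [Module K X]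
  [AddCommGroup Y] [Module K Y]

/-- The series `x ↦ (a x, b x)`. -/
def lift (a : Ser K X (Cof K B U)) (b : Ser K X (Cof K B V)) : Ser K X (Cof K B (U × V)) :=
  (inl K B U V).comp a + (inr K B U V).comp b

/-- The series `(x, y) ↦ a x + b y`. -/
def desc (a : Ser K (Cof K B U) X) (b : Ser K (Cof K B V) X) : Ser K (Cof K B (U × V)) X :=
  a.comp (fst K B U V) + b.comp (snd K B U V)

variable (a : Ser K X (Cof K B U)) (b : Ser K X (Cof K B V)) (a' : Ser K (Cof K B U) X)
  (b' : Ser K (Cof K B V) X) (d : Ser K (Cof K B U) (Cof K B U))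
  (φ : Ser K (Cof K B U) (Cof K B V)) (d' : Ser K (Cof K B V) (Cof K B V))

lemma fst_lift : (fst K B U V).comp (lift a b) = a := by
  rw [lift, Ser.comp_add, fst_inl_assoc, fst_inr_assoc, add_zero]

lemma snd_lift : (snd K B U V).comp (lift a b) = b := by
  rw [lift, Ser.comp_add, snd_inl_assoc, snd_inr_assoc, zero_add]

lemma fst_lift_assoc (x : Ser K Y X) : (fst K B U V).comp ((lift a b).comp x) = a.comp x :=
  comp_eq_assoc (fst_lift a b) x

lemma snd_lift_assoc (x : Ser K Y X) : (snd K B U V).comp ((lift a b).comp x) = b.comp x :=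
  comp_eq_assoc (snd_lift a b) x

lemma desc_inl : (desc a' b').comp (inl K B U V) = a' := by
  rw [desc, Ser.add_comp, Ser.comp_assoc, Ser.comp_assoc, fst_inl, snd_inl, Ser.comp_id,
    Ser.comp_zero, add_zero]

lemma desc_inr : (desc a' b').comp (inr K B U V) = b' := by
  rw [desc, Ser.add_comp, Ser.comp_assoc, Ser.comp_assoc, fst_inr, snd_inr, Ser.comp_id,
    Ser.comp_zero, zero_add]

lemma desc_inl_assoc (x : Ser K Y (Cof K B U)) :
    (desc a' b').comp ((inl K B U V).comp x) = a'.comp x :=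
  comp_eq_assoc (desc_inl a' b') x

lemma desc_inr_assoc (x : Ser K Y (Cof K B V)) :
    (desc a' b').comp ((inr K B U V).comp x) = b'.comp x :=
  comp_eq_assoc (desc_inr a' b') x

lemma fst_twisted : (fst K B U V).comp (twisted d φ d') = d.comp (fst K B U V) := by
  rw [twisted, Ser.comp_add, Ser.comp_add, fst_inl_assoc, fst_inr_assoc, fst_inr_assoc, add_zero,
    add_zero]

lemma snd_twisted : (snd K B U V).comp (twisted d φ d') =
    φ.comp (fst K B U V) + d'.comp (snd K B U V) := by
  rw [twisted, Ser.comp_add, Ser.comp_add, snd_inl_assoc, snd_inr_assoc, snd_inr_assoc, zero_add]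

lemma twisted_inl : (twisted d φ d').comp (inl K B U V) =
    (inl K B U V).comp d + (inr K B U V).comp φ := by
  simp only [twisted, Ser.add_comp, Ser.comp_assoc, fst_inl, snd_inl, Ser.comp_id, Ser.comp_zero,
    add_zero]

lemma twisted_inr : (twisted d φ d').comp (inr K B U V) = (inr K B U V).comp d' := by
  simp only [twisted, Ser.add_comp, Ser.comp_assoc, fst_inr, snd_inr, Ser.comp_id, Ser.comp_zero,
    zero_add]

lemma fst_twisted_assoc (x : Ser K Y (Cof K B (U × V))) :
    (fst K B U V).comp ((twisted d φ d').comp x) = d.comp ((fst K B U V).comp x) := by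
  rw [comp_eq_assoc (fst_twisted d φ d'), Ser.comp_assoc]

lemma snd_twisted_assoc (x : Ser K Y (Cof K B (U × V))) :
    (snd K B U V).comp ((twisted d φ d').comp x) =
      φ.comp ((fst K B U V).comp x) + d'.comp ((snd K B U V).comp x) := by
  rw [comp_eq_assoc (snd_twisted d φ d'), Ser.add_comp, Ser.comp_assoc, Ser.comp_assoc]

lemma twisted_inl_assoc (x : Ser K Y (Cof K B U)) :
    (twisted d φ d').comp ((inl K B U V).comp x) =
      (inl K B U V).comp (d.comp x) + (inr K B U V).comp (φ.comp x) := by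
  rw [comp_eq_assoc (twisted_inl d φ d'), Ser.add_comp, Ser.comp_assoc, Ser.comp_assoc]

lemma twisted_inr_assoc (x : Ser K Y (Cof K B V)) :
    (twisted d φ d').comp ((inr K B U V).comp x) = (inr K B U V).comp (d'.comp x) := by
  rw [comp_eq_assoc (twisted_inr d φ d'), Ser.comp_assoc]

end Sum

attribute [local simp] Ser.comp_assoc Ser.add_comp Ser.comp_add Ser.sub_comp Ser.comp_sub
  Ser.neg_comp Ser.comp_neg Ser.zero_comp Ser.comp_zero Ser.id_comp Ser.comp_id
  fst_inl fst_inr snd_inl snd_inr fst_inl_assoc fst_inr_assoc snd_inl_assoc snd_inr_assoc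
  fst_lift snd_lift fst_lift_assoc snd_lift_assoc desc_inl desc_inr desc_inl_assoc desc_inr_assoc
  fst_twisted snd_twisted twisted_inl twisted_inr fst_twisted_assoc snd_twisted_assoc
  twisted_inl_assoc twisted_inr_assoc

section Cone

variable {K : Type u} [Field K] {B U V X Y : Type u} [AddCommGroup B] [Module K B]
  [AddCommGroup U] [Module K U] [AddCommGroup V] [Module K V] [AddCommGroup X] [Module K X]
  {dU : Ser K (Cof K B U) (Cof K B U)} {dV : Ser K (Cof K B V) (Cof K B V)}
  {f : Ser K (Cof K B U) (Cof K B V)} {dX : Ser K X X}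

/-- The hypotheses are the two rows of the equation. The first is an anticommutation because the
cone carries `-dU` on its first summand. -/
lemma twisted_lift {a : Ser K X (Cof K B U)} {b : Ser K X (Cof K B V)}
    (ha : dU.comp a + a.comp dX = 0) (hb : f.comp a + dV.comp b = b.comp dX) :
    (twisted (-dU) f dV).comp (lift a b) = (lift a b).comp dX := by
  apply prod_ext
  · simpa using (eq_neg_of_add_eq_zero_right ha).symm
  · simpa using hb

lemma desc_twisted {a : Ser K (Cof K B U) X} {b : Ser K (Cof K B V) X}
    (ha : dX.comp a + a.comp dU = b.comp f) (hb : dX.comp b = b.comp dV) :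
    dX.comp (desc a b) = (desc a b).comp (twisted (-dU) f dV) := by
  apply coprod_ext
  · simp [← ha]
  · simpa using hb

end Cone

section Split

variable {K : Type u} [Field K] {X Y Z : Type u} [AddCommGroup X] [Module K X]
  [AddCommGroup Y] [Module K Y] [AddCommGroup Z] [Module K Z]
  {f : Ser K X Y} {g : Ser K Y Z} {ρ : Ser K Y X} {σ : Ser K Z Y}
  (hρ : ρ.comp f = Ser.const LinearMap.id) (hσ : g.comp σ = Ser.const LinearMap.id)
  (ht : f.comp ρ + σ.comp g = Ser.const LinearMap.id)

include hρ hσ ht in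
-- Placing `f ρ + σ g = 1` between `g` and `f` gives `g f + g f = g f`.
lemma comp_eq_zero_of_split : g.comp f = 0 := by
  have h := congrArg (fun x => (g.comp x).comp f) ht
  simpa [hρ, comp_eq_assoc hσ] using h

include hρ hσ ht in
-- The same argument with `ρ` and `σ` as outer factors.
lemma retraction_section_eq_zero : ρ.comp σ = 0 := by
  have h := congrArg (fun x => (ρ.comp x).comp σ) ht
  simpa [hσ, comp_eq_assoc hρ] using h

variable {dX : Ser K X X} {dY : Ser K Y Y} {dZ : Ser K Z Z} {h : Ser K Z X}

include hρ hσ ht in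
-- This is the condition for `(h, σ)` to be a morphism to the cone of `f`. Composing the formula for
-- `h g` with `σ` gives `h = -ρ dY σ`, and `dZ = g dY σ`; the claim is then `f ρ + σ g = 1` applied
-- to `dY σ`.
lemma comp_connecting_add (hg : dZ.comp g = g.comp dY) (hh : h.comp g = dX.comp ρ - ρ.comp dY) :
    f.comp h + dY.comp σ = σ.comp dZ := by
  have h₀ : h = -ρ.comp (dY.comp σ) := by
    rw [← Ser.comp_id h, ← hσ, ← Ser.comp_assoc, hh]
    simp [retraction_section_eq_zero hρ hσ ht]
  have h₁ : σ.comp dZ = σ.comp (g.comp (dY.comp σ)) := by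
    rw [← Ser.comp_assoc g, ← hg, Ser.comp_assoc, hσ, Ser.comp_id]
  have h₂ := congrArg (fun x => x.comp (dY.comp σ)) ht
  simp only [Ser.add_comp, Ser.comp_assoc, Ser.id_comp] at h₂
  rw [h₁, h₀, Ser.comp_neg, neg_add_eq_iff_eq_add, h₂]

end Split

end Ser

variable {K : Type u} [Field K] {A : TopAInfAlg K} {e : A.StrictUnit}

/-! ### Morphisms to and from cones, split sequences -/

namespace TopMod

/-- The morphism `x ↦ (a x, b x)` to a cone. -/
def coneLift {X M N : TopMod e} (f : M ⟶ N) {a : Ser K X.R M.R} {b : Ser K X.R N.R}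
    (ha : IsPreHom X M 1 a) (hb : IsPreHom X N 0 b) (h₁ : M.d.comp a + a.comp X.d = 0)
    (h₂ : f.ser.comp a + N.d.comp b = b.comp X.d) : X ⟶ cone f where
  ser := Ser.lift a b
  isPreHom := ((isPreHom_cone_inl f).comp ha (by omega)).add
    ((isPreHom_cone_inr f).comp hb (by omega))
  comm := by
    rw [cone_d]
    exact Ser.twisted_lift h₁ h₂

/-- The morphism `(x, y) ↦ a x + b y` from a cone. -/
def coneDesc {X M N : TopMod e} (f : M ⟶ N) {a : Ser K M.R X.R} (b : N ⟶ X)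
    (ha : IsPreHom M X (-1) a) (h : X.d.comp a + a.comp M.d = b.ser.comp f.ser) : cone f ⟶ X where
  ser := Ser.desc a b.ser
  isPreHom := (ha.comp (isPreHom_cone_fst f) (by omega)).add
    (b.isPreHom.comp (isPreHom_cone_snd f) (by omega))
  comm := by
    rw [cone_d]
    exact Ser.desc_twisted h b.comm

/-- The sequence `M → M' → M''`, not necessarily consisting of strict morphisms, is split by
`ρ : M' → M` and `σ : M'' → M'` as a sequence of cofree comodules, and `h` is the corresponding
connecting morphism. -/
structure IsSplit {M M' M'' : TopMod e} (f : M ⟶ M') (g : M' ⟶ M'') (h : M'' ⟶ M.shiftObj 1)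
    (ρ : Ser K M'.R M.R) (σ : Ser K M''.R M'.R) : Prop where
  retraction_isPreHom : IsPreHom M' M 0 ρ
  section_isPreHom : IsPreHom M'' M' 0 σ
  retraction : ρ.comp f.ser = Ser.const LinearMap.id
  sect : g.ser.comp σ = Ser.const LinearMap.id
  total : f.ser.comp ρ + σ.comp g.ser = Ser.const LinearMap.id
  connecting : (h.ser.comp g.ser : Ser K M'.R M.R) = M.d.comp ρ - ρ.comp M'.d

/-- The sign of the codifferential of `M[1]` turns commutation into anticommutation, the form
required by `coneLift`. -/
lemma comm_shift_one {M N : TopMod e} (h : N ⟶ M.shiftObj 1) :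
    (M.d.comp h.ser + Ser.comp (h.ser : Ser K N.R M.R) N.d : Ser K N.R M.R) = 0 := by
  have h₁ := h.comm
  rw [shiftObj_one_d] at h₁
  rw [← show (Ser.comp (-M.d) (h.ser : Ser K N.R M.R) : Ser K N.R M.R) =
    Ser.comp (h.ser : Ser K N.R M.R) N.d from h₁, Ser.neg_comp, add_neg_cancel]

lemma isPreHom_of_shift_one {M N : TopMod e} (h : N ⟶ M.shiftObj 1) :
    IsPreHom N M 1 (h.ser : Ser K N.R M.R) :=
  (isPreHom_shift_target (by omega)).1 h.isPreHom

namespace IsSplit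

variable {M M' M'' : TopMod e} {f : M ⟶ M'} {g : M' ⟶ M''} {h : M'' ⟶ M.shiftObj 1}
  {ρ : Ser K M'.R M.R} {σ : Ser K M''.R M'.R} (H : IsSplit f g h ρ σ)

include H

/-- The homotopy equivalence `M'' → C(f)` for a split sequence `M → M' → M''`. -/
def toCone : M'' ⟶ cone f :=
  coneLift f (a := h.ser) (isPreHom_of_shift_one h) H.section_isPreHom (comm_shift_one h)
    (Ser.comp_connecting_add H.retraction H.sect H.total g.comm H.connecting)

/-- The homotopy equivalence `C(f) → M''` for a split sequence `M → M' → M''`. -/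
def fromCone : cone f ⟶ M'' :=
  coneDesc f (a := 0) g (IsPreHom.zero _ _ _) (by
    rw [Ser.comp_zero, Ser.zero_comp, add_zero,
      Ser.comp_eq_zero_of_split H.retraction H.sect H.total])

end IsSplit

end TopMod

end

end TopAInf

namespace TopAInf

noncomputable section

open BigradedSpace

/-! ### The homotopy for the cone of a split sequence -/

namespace Ser

attribute [local simp] Ser.comp_assoc Ser.add_comp Ser.comp_add Ser.sub_comp Ser.comp_sub
  Ser.neg_comp Ser.comp_neg Ser.zero_comp Ser.comp_zero Ser.id_comp Ser.comp_id
  fst_inl fst_inr snd_inl snd_inr fst_inl_assoc fst_inr_assoc snd_inl_assoc snd_inr_assoc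
  fst_lift snd_lift fst_lift_assoc snd_lift_assoc desc_inl desc_inr desc_inl_assoc desc_inr_assoc
  fst_twisted snd_twisted twisted_inl twisted_inr fst_twisted_assoc snd_twisted_assoc
  twisted_inl_assoc twisted_inr_assoc

section Split

variable {K : Type u} [Field K] {B X Y Z : Type u} [AddCommGroup B] [Module K B]
  [AddCommGroup X] [Module K X] [AddCommGroup Y] [Module K Y] [AddCommGroup Z] [Module K Z]
  {f : Ser K (Cof K B X) (Cof K B Y)} {g : Ser K (Cof K B Y) Z} {ρ : Ser K (Cof K B Y) (Cof K B X)}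
  {σ : Ser K Z (Cof K B Y)} {h : Ser K Z (Cof K B X)}
  {dX : Ser K (Cof K B X) (Cof K B X)} {dY : Ser K (Cof K B Y) (Cof K B Y)} {dZ : Ser K Z Z}

/-- The homotopy is `(x, y) ↦ (ρ y, 0)`. Its nontrivial matrix entries are `ρ f = 1`, the formula
for `h g`, and `1 - σ g = f ρ`. -/
lemma split_cone_homotopy (hρ : ρ.comp f = Ser.const LinearMap.id)
    (ht : f.comp ρ + σ.comp g = Ser.const LinearMap.id) (hh : h.comp g = dX.comp ρ - ρ.comp dY) :
    Ser.const LinearMap.id - (lift h σ).comp (desc 0 g) =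
      (twisted (-dX) f dY).comp ((inl K B X Y).comp (ρ.comp (snd K B X Y))) +
        ((inl K B X Y).comp (ρ.comp (snd K B X Y))).comp (twisted (-dX) f dY) := by
  have ht' : Ser.const LinearMap.id - σ.comp g = f.comp ρ := by rw [← ht, add_sub_cancel_right]
  apply prod_ext <;> apply coprod_ext
  · simp [hρ]
  · simp [hh, sub_eq_neg_add]
  · simp
  · simp [ht']

end Split

end Ser

variable {K : Type u} [Field K] {A : TopAInfAlg K} {e : A.StrictUnit}

/-! ### Isomorphisms of triangles in the homotopy category -/

namespace TopMod

lemma hoFunctor_map_eq {M N : TopMod e} {f g : M ⟶ N} {H : Ser K M.R N.R}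
    (hH : IsPreHom M N (-1) H) (h : f.ser - g.ser = N.d.comp H + H.comp M.d) :
    (hoFunctor e).map f = (hoFunctor e).map g :=
  CategoryTheory.Quotient.sound _ ⟨H, hH, h⟩

lemma isIso_hoFunctor_map {M N : TopMod e} (f : M ⟶ N) (g : N ⟶ M)
    (h₁ : (hoFunctor e).map (f ≫ g) = (hoFunctor e).map (𝟙 M))
    (h₂ : (hoFunctor e).map (g ≫ f) = (hoFunctor e).map (𝟙 N)) :
    IsIso ((hoFunctor e).map f) :=
  ⟨(hoFunctor e).map g, by rw [← Functor.map_comp, h₁, CategoryTheory.Functor.map_id],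
    by rw [← Functor.map_comp, h₂, CategoryTheory.Functor.map_id]⟩

/-- A morphism of triangles in the homotopy category, from morphisms of modules which make the
diagram commute up to homotopy. -/
def hoTriangleHom {T₁ T₂ : Triangle (TopMod e)} (a : T₁.obj₁ ⟶ T₂.obj₁) (b : T₁.obj₂ ⟶ T₂.obj₂)
    (c : T₁.obj₃ ⟶ T₂.obj₃)
    (h₁ : (hoFunctor e).map (T₁.mor₁ ≫ b) = (hoFunctor e).map (a ≫ T₂.mor₁))
    (h₂ : (hoFunctor e).map (T₁.mor₂ ≫ c) = (hoFunctor e).map (b ≫ T₂.mor₂))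
    (h₃ : (hoFunctor e).map (T₁.mor₃ ≫ a⟦(1 : ℤ)⟧') = (hoFunctor e).map (c ≫ T₂.mor₃)) :
    (hoFunctor e).mapTriangle.obj T₁ ⟶ (hoFunctor e).mapTriangle.obj T₂ :=
  Triangle.homMk _ _ ((hoFunctor e).map a) ((hoFunctor e).map b) ((hoFunctor e).map c)
    ((Functor.map_comp _ _ _).symm.trans (h₁.trans (Functor.map_comp _ _ _)))
    ((Functor.map_comp _ _ _).symm.trans (h₂.trans (Functor.map_comp _ _ _)))
    (by
      -- The third arrow of the image triangle contains the isomorphism comparing the functor with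
      -- the shift; its naturality carries it past the shift of `a`.
      have h := congrArg (fun x => x ≫ ((hoFunctor e).commShiftIso (1 : ℤ)).hom.app T₂.obj₁) h₃
      simp only [Functor.map_comp, Category.assoc, Functor.commShiftIso_hom_naturality] at h
      exact (Category.assoc _ _ _).trans h)

lemma nonempty_hoTriangleIso {T₁ T₂ : Triangle (TopMod e)} (a : T₁.obj₁ ⟶ T₂.obj₁)
    (b : T₁.obj₂ ⟶ T₂.obj₂) (c : T₁.obj₃ ⟶ T₂.obj₃)
    (ha : IsIso ((hoFunctor e).map a)) (hb : IsIso ((hoFunctor e).map b))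
    (hc : IsIso ((hoFunctor e).map c))
    (h₁ : (hoFunctor e).map (T₁.mor₁ ≫ b) = (hoFunctor e).map (a ≫ T₂.mor₁))
    (h₂ : (hoFunctor e).map (T₁.mor₂ ≫ c) = (hoFunctor e).map (b ≫ T₂.mor₂))
    (h₃ : (hoFunctor e).map (T₁.mor₃ ≫ a⟦(1 : ℤ)⟧') = (hoFunctor e).map (c ≫ T₂.mor₃)) :
    Nonempty ((hoFunctor e).mapTriangle.obj T₁ ≅ (hoFunctor e).mapTriangle.obj T₂) := by
  have := Triangle.isIso_of_isIsos (hoTriangleHom a b c h₁ h₂ h₃) ha hb hc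
  exact ⟨asIso (hoTriangleHom a b c h₁ h₂ h₃)⟩

/-- A criterion serving both split sequences and the octahedron. The map `s` goes to the cone, while
the second arrow is given through `t`, so the middle square commutes only up to the homotopy `t ≫ s
∼ 1`. -/
lemma nonempty_iso_coneTriangle_of_equiv {M M' M'' : TopMod e} {f : M ⟶ M'} {g : M' ⟶ M''}
    {h : M'' ⟶ M.shiftObj 1} (s : M'' ⟶ cone f) (t : cone f ⟶ M'') (hst : s ≫ t = 𝟙 M'')
    (hts : (hoFunctor e).map (t ≫ s) = (hoFunctor e).map (𝟙 (cone f))) (hg : coneIn f ≫ t = g)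
    (hh : s ≫ coneOut f = h) :
    Nonempty ((hoFunctor e).mapTriangle.obj (Triangle.mk f g h) ≅
      (hoFunctor e).mapTriangle.obj (coneTriangle f)) := by
  refine nonempty_hoTriangleIso (T₁ := Triangle.mk f g h) (T₂ := coneTriangle f) (𝟙 _) (𝟙 _) s
    (inferInstanceAs (IsIso ((hoFunctor e).map (𝟙 M))))
    (inferInstanceAs (IsIso ((hoFunctor e).map (𝟙 M'))))
    (isIso_hoFunctor_map s t (by rw [hst]) hts) ?_ ?_ ?_
  · exact congrArg _ ((Category.comp_id _).trans (Category.id_comp _).symm)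
  · change (hoFunctor e).map (g ≫ s) = (hoFunctor e).map (𝟙 M' ≫ coneIn f)
    rw [← hg, Category.assoc, Functor.map_comp, hts, CategoryTheory.Functor.map_id,
      Category.comp_id, Category.id_comp]
  · change (hoFunctor e).map (h ≫ (𝟙 M)⟦(1 : ℤ)⟧') = (hoFunctor e).map (s ≫ coneOut f)
    rw [hh, CategoryTheory.Functor.map_id]
    exact congrArg _ (Category.comp_id h)

namespace IsSplit

variable {M M' M'' : TopMod e} {f : M ⟶ M'} {g : M' ⟶ M''} {h : M'' ⟶ M.shiftObj 1}
  {ρ : Ser K M'.R M.R} {σ : Ser K M''.R M'.R} (H : IsSplit f g h ρ σ)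

include H

lemma toCone_fromCone : H.toCone ≫ H.fromCone = 𝟙 M'' := by
  ext1
  change (Ser.desc 0 g.ser).comp (Ser.lift h.ser σ) = Ser.const LinearMap.id
  rw [Ser.desc, Ser.zero_comp, zero_add, Ser.comp_assoc, Ser.snd_lift, H.sect]

lemma fromCone_toCone :
    (hoFunctor e).map (H.fromCone ≫ H.toCone) = (hoFunctor e).map (𝟙 (cone f)) := by
  symm
  refine hoFunctor_map_eq ((isPreHom_cone_inl f).comp
    (H.retraction_isPreHom.comp (isPreHom_cone_snd f) (add_zero 0)) (by omega)) ?_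
  rw [cone_d]
  exact Ser.split_cone_homotopy H.retraction H.total H.connecting

/-- A split sequence gives rise to a triangle isomorphic to that of a cone. -/
lemma nonempty_iso_coneTriangle :
    Nonempty ((hoFunctor e).mapTriangle.obj (Triangle.mk f g h) ≅
      (hoFunctor e).mapTriangle.obj (coneTriangle f)) :=
  nonempty_iso_coneTriangle_of_equiv H.toCone H.fromCone H.toCone_fromCone H.fromCone_toCone
    (hom_ext (Ser.desc_inr _ _)) (hom_ext (Ser.fst_lift _ _))

end IsSplit

/-- The sequence `N → C(f) → M[1]` is split. -/
lemma isSplit_cone {M N : TopMod e} (f : M ⟶ N) :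
    IsSplit (coneIn f) (coneOut f) (-f⟦(1 : ℤ)⟧') (Ser.snd K A.carrier M.carrier N.carrier)
      (Ser.inl K A.carrier M.carrier N.carrier) where
  retraction_isPreHom := isPreHom_cone_snd f
  section_isPreHom := isPreHom_inl (M.shiftObj 1) N _ _ _
  retraction := Ser.snd_inr K A.carrier M.carrier N.carrier
  sect := Ser.fst_inl K A.carrier M.carrier N.carrier
  total := by
    rw [add_comm]
    exact Ser.inl_fst_add_inr_snd K A.carrier M.carrier N.carrier
  -- The second row of the cone codifferential is `f x + d y`, so the commutator of `d` with the
  -- projection is `-f` on the first summand. This is the sign of the rotated triangle.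
  connecting := by
    rw [cone_d, Ser.snd_twisted]
    change (-f.ser).comp (Ser.fst K A.carrier M.carrier N.carrier) = _
    rw [Ser.neg_comp]
    abel

end TopMod

end

end TopAInf

namespace TopAInf

noncomputable section

open BigradedSpace

/-! ### Matrix identities for cones, octahedra, cylinders and inverse rotation -/

namespace Ser

attribute [local simp] Ser.comp_assoc Ser.add_comp Ser.comp_add Ser.sub_comp Ser.comp_sub
  Ser.neg_comp Ser.comp_neg Ser.zero_comp Ser.comp_zero Ser.id_comp Ser.comp_id
  fst_inl fst_inr snd_inl snd_inr fst_inl_assoc fst_inr_assoc snd_inl_assoc snd_inr_assoc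
  fst_lift snd_lift fst_lift_assoc snd_lift_assoc desc_inl desc_inr desc_inl_assoc desc_inr_assoc
  fst_twisted snd_twisted twisted_inl twisted_inr fst_twisted_assoc snd_twisted_assoc
  twisted_inl_assoc twisted_inr_assoc

variable {K : Type u} [Field K] {B X Y Z W : Type u} [AddCommGroup B] [Module K B]
  [AddCommGroup X] [Module K X] [AddCommGroup Y] [Module K Y] [AddCommGroup Z] [Module K Z]
  [AddCommGroup W] [Module K W]

section ConeMap

variable {f : Ser K (Cof K B X) (Cof K B Y)} {f' : Ser K (Cof K B Z) (Cof K B W)}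
  {a : Ser K (Cof K B X) (Cof K B Z)} {b : Ser K (Cof K B Y) (Cof K B W)}
  {H : Ser K (Cof K B X) (Cof K B W)}
  {dX : Ser K (Cof K B X) (Cof K B X)} {dY : Ser K (Cof K B Y) (Cof K B Y)}
  {dZ : Ser K (Cof K B Z) (Cof K B Z)} {dW : Ser K (Cof K B W) (Cof K B W)}

lemma coneMap_comm_fst (ha : dZ.comp a = a.comp dX) :
    dZ.comp (a.comp (fst K B X Y)) + (a.comp (fst K B X Y)).comp (twisted (-dX) f dY) = 0 := by
  simp [comp_eq_assoc ha]

/-- Restricted to the first summand this is `f' a + d H = b f - H d`, which is the homotopy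
relation; restricted to the second it is the commutation of `b`. -/
lemma coneMap_comm_snd (hb : dW.comp b = b.comp dY)
    (hH : b.comp f - f'.comp a = dW.comp H + H.comp dX) :
    f'.comp (a.comp (fst K B X Y)) + dW.comp (desc H b) =
      (desc H b).comp (twisted (-dX) f dY) := by
  apply coprod_ext
  · simp [sub_eq_iff_eq_add.1 hH]
    abel
  · simp [hb]

end ConeMap

/-- The homotopy is `(x, y) ↦ (y, 0)`. The subtracted zero is the series of the zero morphism, to
which the identity is compared. -/
lemma contractible_cone (dX : Ser K (Cof K B X) (Cof K B X)) :
    Ser.const LinearMap.id - 0 =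
      (twisted (-dX) (Ser.const LinearMap.id) dX).comp ((inl K B X X).comp (snd K B X X)) +
        ((inl K B X X).comp (snd K B X X)).comp (twisted (-dX) (Ser.const LinearMap.id) dX) := by
  apply prod_ext <;> apply coprod_ext <;> simp

section Octahedron

variable {f : Ser K (Cof K B X) (Cof K B Y)} {g : Ser K (Cof K B Y) (Cof K B Z)}
  {dX : Ser K (Cof K B X) (Cof K B X)} {dY : Ser K (Cof K B Y) (Cof K B Y)}
  {dZ : Ser K (Cof K B Z) (Cof K B Z)}

/-- With `octahedron_lift_snd`, this makes `(y, z) ↦ ((0, y), (0, z))` a morphism from `C(g)` to the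
cone of `C(f) → C(f ≫ g)`. -/
lemma octahedron_lift_fst :
    (twisted (-dX) f dY).comp ((inr K B X Y).comp (fst K B Y Z)) +
      ((inr K B X Y).comp (fst K B Y Z)).comp (twisted (-dY) g dZ) = 0 := by
  simp only [Ser.comp_assoc, fst_twisted, twisted_inr_assoc, Ser.neg_comp, Ser.comp_neg]
  exact add_neg_cancel ((inr K B X Y).comp (dY.comp (fst K B Y Z)))

lemma octahedron_lift_snd :
    (lift ((Ser.const LinearMap.id).comp (fst K B X Y)) (desc 0 g)).comp
        ((inr K B X Y).comp (fst K B Y Z)) +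
      (twisted (-dX) (g.comp f) dZ).comp ((inr K B X Z).comp (snd K B Y Z)) =
      ((inr K B X Z).comp (snd K B Y Z)).comp (twisted (-dY) g dZ) := by
  apply prod_ext <;> apply coprod_ext <;> simp

/-- Concerns the backward map `((x, y), (x', z)) ↦ (y + f x', z)`. The entry `(x, y) ↦ (y, 0)` is a
null-homotopy of the composite `C(f) → C(f ≫ g) → C(g)`, which is what a morphism out of the cone
needs. -/
lemma octahedron_desc :
    (twisted (-dY) g dZ).comp ((inl K B Y Z).comp (snd K B X Y)) +
      ((inl K B Y Z).comp (snd K B X Y)).comp (twisted (-dX) f dY) =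
      (lift (f.comp (fst K B X Z)) (desc 0 (Ser.const LinearMap.id))).comp
        (lift ((Ser.const LinearMap.id).comp (fst K B X Y)) (desc 0 g)) := by
  apply prod_ext <;> apply coprod_ext <;> simp [desc]

lemma octahedron_section :
    (desc ((inl K B Y Z).comp (snd K B X Y))
        (lift (f.comp (fst K B X Z)) (desc 0 (Ser.const LinearMap.id)))).comp
      (lift ((inr K B X Y).comp (fst K B Y Z)) ((inr K B X Z).comp (snd K B Y Z))) =
      Ser.const LinearMap.id := by
  apply prod_ext <;> apply coprod_ext <;> simp [desc]

/-- The composite in the other order differs from the identity in `x` and `x'`; the homotopy `((x,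
y), (x', z)) ↦ ((x', 0), (0, 0))` contracts this pair. -/
lemma octahedron_homotopy :
    Ser.const LinearMap.id -
      (lift ((inr K B X Y).comp (fst K B Y Z)) ((inr K B X Z).comp (snd K B Y Z))).comp
      (desc ((inl K B Y Z).comp (snd K B X Y))
        (lift (f.comp (fst K B X Z)) (desc 0 (Ser.const LinearMap.id)))) =
    (twisted (-twisted (-dX) f dY)
        (lift ((Ser.const LinearMap.id).comp (fst K B X Y)) (desc 0 g))
        (twisted (-dX) (g.comp f) dZ)).comp ((inl K B (X × Y) (X × Z)).comp
          ((inl K B X Y).comp ((fst K B X Z).comp (snd K B (X × Y) (X × Z))))) +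
      ((inl K B (X × Y) (X × Z)).comp
          ((inl K B X Y).comp ((fst K B X Z).comp (snd K B (X × Y) (X × Z))))).comp
      (twisted (-twisted (-dX) f dY)
        (lift ((Ser.const LinearMap.id).comp (fst K B X Y)) (desc 0 g))
        (twisted (-dX) (g.comp f) dZ)) := by
  apply prod_ext <;> apply prod_ext <;> apply coprod_ext <;> apply coprod_ext <;> simp [desc]

end Octahedron

section Cylinder

variable {f : Ser K (Cof K B X) (Cof K B Y)}
  {dX : Ser K (Cof K B X) (Cof K B X)} {dY : Ser K (Cof K B Y) (Cof K B Y)}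

lemma cyl_inclusion_comm :
    (twisted (-dX) (lift (-Ser.const LinearMap.id) f) (twisted dX 0 dY)).comp
      ((inr K B X (X × Y)).comp (inr K B X Y)) =
      ((inr K B X (X × Y)).comp (inr K B X Y)).comp dY := by
  simp

lemma cyl_projection_comm (hf : dY.comp f = f.comp dX) :
    dY.comp ((desc f (Ser.const LinearMap.id)).comp (snd K B X (X × Y))) =
      ((desc f (Ser.const LinearMap.id)).comp (snd K B X (X × Y))).comp
      (twisted (-dX) (lift (-Ser.const LinearMap.id) f) (twisted dX 0 dY)) := by
  apply coprod_ext
  · simp [desc]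
  · apply coprod_ext <;> simp [hf]

/-- In the coordinates `(m', (m, n))` the homotopy is `(m', (m, n)) ↦ (-m, (0, 0))`. The entry `-m'`
of the cylinder codifferential makes `M` and `M[1]` cancel each other. -/
lemma cyl_homotopy :
    Ser.const LinearMap.id - ((inr K B X (X × Y)).comp (inr K B X Y)).comp
      ((desc f (Ser.const LinearMap.id)).comp (snd K B X (X × Y))) =
    (twisted (-dX) (lift (-Ser.const LinearMap.id) f) (twisted dX 0 dY)).comp
      (-((inl K B X (X × Y)).comp ((fst K B X Y).comp (snd K B X (X × Y))))) +
      (-((inl K B X (X × Y)).comp ((fst K B X Y).comp (snd K B X (X × Y))))).comp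
      (twisted (-dX) (lift (-Ser.const LinearMap.id) f) (twisted dX 0 dY)) := by
  apply prod_ext
  · apply coprod_ext
    · simp
    · apply coprod_ext <;> simp
  · apply prod_ext <;> apply coprod_ext
    · simp
    · apply coprod_ext <;> simp
    · simp
    · apply coprod_ext <;> simp

/-- The two maps `M → Cyl(f)`, through the end `N` and through the end `M`, are joined by the
summand `M[1]`: its inclusion is the homotopy. -/
lemma cyl_square_homotopy :
    ((inr K B X (X × Y)).comp (inr K B X Y)).comp f - (inr K B X (X × Y)).comp (inl K B X Y) =
    (twisted (-dX) (lift (-Ser.const LinearMap.id) f) (twisted dX 0 dY)).comp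
      (inl K B X (X × Y)) + (inl K B X (X × Y)).comp dX := by
  apply prod_ext
  · simp
  · apply prod_ext <;> simp

end Cylinder

section InvRotate

variable {f : Ser K (Cof K B X) (Cof K B Y)} {g : Ser K (Cof K B Y) (Cof K B Z)}
  {ρ : Ser K (Cof K B Y) (Cof K B X)} {σ : Ser K (Cof K B Z) (Cof K B Y)}

lemma desc_lift_of_split (ht : f.comp ρ + σ.comp g = Ser.const LinearMap.id) :
    (desc σ f).comp (lift g ρ) = Ser.const LinearMap.id := by
  simp [desc, ← ht, add_comm]

lemma lift_desc_of_split (hρ : ρ.comp f = Ser.const LinearMap.id)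
    (hσ : g.comp σ = Ser.const LinearMap.id)
    (ht : f.comp ρ + σ.comp g = Ser.const LinearMap.id) :
    (lift g ρ).comp (desc σ f) = Ser.const LinearMap.id := by
  apply prod_ext <;> apply coprod_ext <;>
    simp [hρ, hσ, comp_eq_zero_of_split hρ hσ ht, retraction_section_eq_zero hρ hσ ht]

end InvRotate

end Ser

end

end TopAInf

namespace TopAInf

noncomputable section

open BigradedSpace

variable {K : Type u} [Field K] {A : TopAInfAlg K} {e : A.StrictUnit}

namespace TopMod

/-! ### Functoriality of cones -/

section ConeMap

variable {M N M' N' : TopMod e} (f : M ⟶ N) (f' : M' ⟶ N') (a : M ⟶ M') (b : N ⟶ N')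
  {H : Ser K M.R N'.R} (hH : IsPreHom M N' (-1) H)
  (h : (f ≫ b).ser - (a ≫ f').ser = N'.d.comp H + H.comp M.d)

/-- The morphism `C(f) → C(f')`, `(x, y) ↦ (a x, H x + b y)`, given by a square which commutes up
to the homotopy `H`. -/
def coneMap : cone f ⟶ cone f' :=
  coneLift f' (a := a.ser.comp (Ser.fst K A.carrier M.carrier N.carrier)) (b := Ser.desc H b.ser)
    (a.isPreHom.comp (isPreHom_cone_fst f) (by omega))
    ((hH.comp (isPreHom_cone_fst f) (by omega)).add
      (b.isPreHom.comp (isPreHom_cone_snd f) (by omega)))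
    (by rw [cone_d]; exact Ser.coneMap_comm_fst a.comm)
    (by rw [cone_d]; exact Ser.coneMap_comm_snd b.comm h)

lemma coneIn_coneMap : coneIn f ≫ coneMap f f' a b hH h = b ≫ coneIn f' := by
  ext1
  change (Ser.lift (a.ser.comp (Ser.fst K A.carrier M.carrier N.carrier))
    (Ser.desc H b.ser)).comp (Ser.inr K A.carrier M.carrier N.carrier) =
    (Ser.inr K A.carrier M'.carrier N'.carrier).comp b.ser
  apply Ser.prod_ext
  · rw [Ser.fst_lift_assoc, Ser.comp_assoc, Ser.fst_inr, Ser.comp_zero, Ser.fst_inr_assoc]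
  · rw [Ser.snd_lift_assoc, Ser.desc_inr, Ser.snd_inr_assoc]

lemma coneMap_coneOut : coneMap f f' a b hH h ≫ coneOut f' = coneOut f ≫ a⟦(1 : ℤ)⟧' :=
  hom_ext (Ser.fst_lift _ _)

end ConeMap

/-! ### The octahedron of a composition -/

section Octahedron

variable {X Y Z : TopMod e} (f : X ⟶ Y) (g : Y ⟶ Z)

/-- The morphism `C(f) → C(f ≫ g)`. -/
def coneCompRight : cone f ⟶ cone (f ≫ g) :=
  coneMap f (f ≫ g) (𝟙 X) g (IsPreHom.zero _ _ _) (by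
    rw [Category.id_comp, sub_self, Ser.comp_zero, Ser.zero_comp, add_zero])

/-- The morphism `C(f ≫ g) → C(g)`. -/
def coneCompLeft : cone (f ≫ g) ⟶ cone g :=
  coneMap (f ≫ g) g f (𝟙 Z) (IsPreHom.zero _ _ _) (by
    rw [Category.comp_id, sub_self, Ser.comp_zero, Ser.zero_comp, add_zero])

/-- The homotopy equivalence `C(g) → C(C(f) → C(f ≫ g))`. -/
def coneCompLift : cone g ⟶ cone (coneCompRight f g) :=
  coneLift (coneCompRight f g)
    (a := (Ser.inr K A.carrier X.carrier Y.carrier).comp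
      (Ser.fst K A.carrier Y.carrier Z.carrier))
    (b := (Ser.inr K A.carrier X.carrier Z.carrier).comp
      (Ser.snd K A.carrier Y.carrier Z.carrier))
    ((isPreHom_cone_inr f).comp (isPreHom_cone_fst g) (by omega))
    ((isPreHom_cone_inr (f ≫ g)).comp (isPreHom_cone_snd g) (by omega))
    (by rw [cone_d, cone_d]; exact Ser.octahedron_lift_fst)
    (by rw [cone_d, cone_d]; exact Ser.octahedron_lift_snd)

/-- The homotopy equivalence `C(C(f) → C(f ≫ g)) → C(g)`. -/
def coneCompDesc : cone (coneCompRight f g) ⟶ cone g :=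
  coneDesc (coneCompRight f g)
    (a := (Ser.inl K A.carrier Y.carrier Z.carrier).comp
      (Ser.snd K A.carrier X.carrier Y.carrier)) (coneCompLeft f g)
    ((isPreHom_cone_inl g).comp (isPreHom_cone_snd f) (by omega))
    (by rw [cone_d, cone_d]; exact Ser.octahedron_desc)

lemma coneCompLift_coneCompDesc : coneCompLift f g ≫ coneCompDesc f g = 𝟙 (cone g) :=
  hom_ext Ser.octahedron_section

lemma coneCompDesc_coneCompLift : (hoFunctor e).map (coneCompDesc f g ≫ coneCompLift f g) =
    (hoFunctor e).map (𝟙 (cone (coneCompRight f g))) := by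
  symm
  -- The homotopy sends `((x, y), (x', z))` to `((x', 0), (0, 0))`: the projection to `x'`
  -- contributes degree `1` and each of the two inclusions `-1`, so the total is `-1`.
  refine hoFunctor_map_eq ((isPreHom_cone_inl (coneCompRight f g)).comp
    (r := -1) (s := 0) ((isPreHom_cone_inl f).comp ((isPreHom_cone_fst (f ≫ g)).comp
      (isPreHom_cone_snd (coneCompRight f g)) (k := 1) (by omega)) (by omega)) (by omega)) ?_
  rw [cone_d, cone_d, cone_d]
  exact Ser.octahedron_homotopy

lemma nonempty_iso_coneCompTriangle :
    Nonempty ((hoFunctor e).mapTriangle.obj (Triangle.mk (coneCompRight f g) (coneCompLeft f g)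
      (coneOut g ≫ (coneIn f)⟦(1 : ℤ)⟧')) ≅
      (hoFunctor e).mapTriangle.obj (coneTriangle (coneCompRight f g))) :=
  nonempty_iso_coneTriangle_of_equiv (coneCompLift f g) (coneCompDesc f g)
    (coneCompLift_coneCompDesc f g) (coneCompDesc_coneCompLift f g)
    (hom_ext (Ser.desc_inr _ _)) (hom_ext (Ser.fst_lift _ _))

end Octahedron

/-! ### Cylinders -/

section Cylinder

variable {M N : TopMod e} (f : M ⟶ N)

lemma cylMap_eq : cylMap f = Ser.lift (-Ser.const LinearMap.id) f.ser := by
  rw [cylMap, Ser.lift, Ser.comp_neg, Ser.comp_id]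
  rfl

lemma cyl_d : (cyl f).d =
    Ser.twisted (-M.d) (Ser.lift (-Ser.const LinearMap.id) f.ser) (Ser.twisted M.d 0 N.d) := by
  change twistD (M.shiftObj 1) (M.prod N) (cylMap (M := M) f) = _
  rw [twistD_eq_twisted, shiftObj_one_d, cylMap_eq]
  change Ser.twisted (-M.d) _ (twistD M N 0) = _
  rw [twistD_eq_twisted]

lemma isPreHom_cyl_snd :
    IsPreHom (cyl f) (M.prod N) 0 (Ser.snd K A.carrier M.carrier (M.carrier × N.carrier)) :=
  isPreHom_snd (M.shiftObj 1) (M.prod N) _ _ _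

lemma isPreHom_cyl_inr :
    IsPreHom (M.prod N) (cyl f) 0 (Ser.inr K A.carrier M.carrier (M.carrier × N.carrier)) :=
  isPreHom_inr (M.shiftObj 1) (M.prod N) _ _ _

lemma isPreHom_cyl_inl :
    IsPreHom M (cyl f) (-1) (Ser.inl K A.carrier M.carrier (M.carrier × N.carrier)) :=
  (isPreHom_shift_source (M := M) (a := 1) (by omega)).1
    (isPreHom_inl (M.shiftObj 1) (M.prod N) _ _ _)

/-- The inclusion `N → Cyl(f)`. -/
def cylInclusion : N ⟶ cyl f where
  ser := (Ser.inr K A.carrier M.carrier (M.carrier × N.carrier)).comp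
    (Ser.inr K A.carrier M.carrier N.carrier)
  isPreHom := (isPreHom_cyl_inr f).comp (isPreHom_inr M N _ _ _) (add_zero 0)
  comm := by
    rw [cyl_d]
    exact Ser.cyl_inclusion_comm

/-- The projection `Cyl(f) → N`, `(m, m', n) ↦ f m + n`. -/
def cylProjection : cyl f ⟶ N where
  ser := (Ser.desc f.ser (Ser.const LinearMap.id)).comp
    (Ser.snd K A.carrier M.carrier (M.carrier × N.carrier))
  isPreHom := IsPreHom.comp (N := M.prod N) ((f.isPreHom.comp
    (isPreHom_fst M N 0 (IsPreHom.zero _ _ _) _) (add_zero 0)).add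
      ((isPreHom_id N).comp (isPreHom_snd M N 0 (IsPreHom.zero _ _ _) _) (add_zero 0)))
      (isPreHom_cyl_snd f) (add_zero 0)
  comm := by
    rw [cyl_d]
    exact Ser.cyl_projection_comm f.comm

lemma cylInclusion_cylProjection : cylInclusion f ≫ cylProjection f = 𝟙 N := by
  ext1
  change ((Ser.desc f.ser (Ser.const LinearMap.id)).comp
    (Ser.snd K A.carrier M.carrier (M.carrier × N.carrier))).comp
    ((Ser.inr K A.carrier M.carrier (M.carrier × N.carrier)).comp
    (Ser.inr K A.carrier M.carrier N.carrier)) = Ser.const LinearMap.id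
  rw [Ser.comp_assoc, Ser.snd_inr_assoc, Ser.desc_inr]

lemma isPreHom_cyl_fst_snd : IsPreHom (cyl f) M 0 ((Ser.fst K A.carrier M.carrier N.carrier).comp
    (Ser.snd K A.carrier M.carrier (M.carrier × N.carrier))) :=
  IsPreHom.comp (N := M.prod N) (isPreHom_fst M N 0 (IsPreHom.zero _ _ _) _)
    (isPreHom_cyl_snd f) (add_zero 0)

lemma isIso_cylInclusion : IsIso ((hoFunctor e).map (cylInclusion f)) := by
  refine isIso_hoFunctor_map _ (cylProjection f) (by rw [cylInclusion_cylProjection])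
    (Eq.symm ?_)
  refine hoFunctor_map_eq ((isPreHom_cyl_inl f).comp (isPreHom_cyl_fst_snd f) (by omega)).neg ?_
  rw [cyl_d]
  exact Ser.cyl_homotopy

lemma ser_cylIn : (cylIn f).ser = (Ser.inr K A.carrier M.carrier (M.carrier × N.carrier)).comp
    (Ser.inl K A.carrier M.carrier N.carrier) := by
  rw [Ser.inr, Ser.inl, Ser.const_comp_const, strictMap_comp]
  rfl

lemma cylIn_homotopic :
    (hoFunctor e).map (f ≫ cylInclusion f) = (hoFunctor e).map (cylIn f) := by
  refine hoFunctor_map_eq (isPreHom_cyl_inl f) ?_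
  rw [cyl_d, ser_cylIn]
  exact Ser.cyl_square_homotopy

lemma ser_cylOut : (cylOut f).ser = Ser.lift
    (Ser.fst K A.carrier M.carrier (M.carrier × N.carrier))
    ((Ser.snd K A.carrier M.carrier N.carrier).comp
      (Ser.snd K A.carrier M.carrier (M.carrier × N.carrier))) := by
  change Ser.const (strictMap K A.carrier ((LinearMap.id : M.carrier →ₗ[K] M.carrier).prodMap
      (LinearMap.snd K M.carrier N.carrier))) = _
  apply Ser.prod_ext
  · rw [Ser.fst_lift, Ser.fst, Ser.fst, Ser.const_comp_const, strictMap_comp]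
    rfl
  · rw [Ser.snd_lift, Ser.snd, Ser.snd, Ser.const_comp_const, Ser.const_comp_const,
      strictMap_comp, strictMap_comp]
    rfl

lemma cylInclusion_cylOut : cylInclusion f ≫ cylOut f = coneIn f := by
  ext1
  rw [ser_comp, ser_cylOut]
  change (Ser.lift _ _).comp ((Ser.inr K A.carrier M.carrier (M.carrier × N.carrier)).comp
    (Ser.inr K A.carrier M.carrier N.carrier)) = Ser.inr K A.carrier M.carrier N.carrier
  apply Ser.prod_ext
  · rw [Ser.fst_lift_assoc, Ser.fst_inr_assoc, Ser.fst_inr]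
  · rw [Ser.snd_lift_assoc, Ser.comp_assoc, Ser.snd_inr_assoc, Ser.snd_inr]

/-- The isomorphism is the identity on `M` and on `C(f)` and the inclusion `N → Cyl(f)` in the
middle. Only the first square needs a homotopy; the other two commute already as morphisms of
modules. -/
lemma nonempty_iso_cylTriangle :
    Nonempty ((hoFunctor e).mapTriangle.obj (coneTriangle f) ≅
      (hoFunctor e).mapTriangle.obj (cylTriangle f)) := by
  refine nonempty_hoTriangleIso (T₁ := coneTriangle f) (T₂ := cylTriangle f) (𝟙 M)
    (cylInclusion f) (𝟙 (cone f)) (inferInstanceAs (IsIso ((hoFunctor e).map (𝟙 M))))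
    (isIso_cylInclusion f) (inferInstanceAs (IsIso ((hoFunctor e).map (𝟙 (cone f))))) ?_ ?_ ?_
  · exact (cylIn_homotopic f).trans (congrArg _ (Category.id_comp _).symm)
  · exact congrArg _ ((Category.comp_id _).trans (cylInclusion_cylOut f).symm)
  · change (hoFunctor e).map (coneOut f ≫ (𝟙 M)⟦(1 : ℤ)⟧') =
      (hoFunctor e).map (𝟙 (cone f) ≫ coneOut f)
    rw [CategoryTheory.Functor.map_id]
    exact congrArg _ ((Category.comp_id _).trans (Category.id_comp _).symm)

end Cylinder

/-! ### Inverse rotation -/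

/-- The coherence isomorphisms of the shift have identity series. This and the next three lemmas
make the arrows of an inversely rotated triangle computable. -/
lemma ser_shiftFunctorAdd'_inv_app (M : TopMod e) (a b c : ℤ) (h : a + b = c) :
    ((shiftFunctorAdd' (TopMod e) a b c h).inv.app M).ser =
      (Ser.const LinearMap.id : Ser K M.R M.R) := by
  subst h
  rw [shiftFunctorAdd'_eq_shiftFunctorAdd]
  rfl

lemma ser_shiftFunctorAdd'_hom_app (M : TopMod e) (a b c : ℤ) (h : a + b = c) :
    ((shiftFunctorAdd' (TopMod e) a b c h).hom.app M).ser =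
      (Ser.const LinearMap.id : Ser K M.R M.R) := by
  subst h
  rw [shiftFunctorAdd'_eq_shiftFunctorAdd]
  rfl

lemma ser_shiftFunctorCompIsoId_hom_app (M : TopMod e) (a b : ℤ) (h : a + b = 0) :
    ((shiftFunctorCompIsoId (TopMod e) a b h).hom.app M).ser =
      (Ser.const LinearMap.id : Ser K M.R M.R) :=
  (ser_comp_of (ser_shiftFunctorAdd'_inv_app M a b 0 h) rfl).trans (Ser.id_comp _)

lemma ser_shiftFunctorCompIsoId_inv_app (M : TopMod e) (a b : ℤ) (h : a + b = 0) :
    ((shiftFunctorCompIsoId (TopMod e) a b h).inv.app M).ser =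
      (Ser.const LinearMap.id : Ser K M.R M.R) :=
  (ser_comp_of rfl (ser_shiftFunctorAdd'_hom_app M a b 0 h)).trans (Ser.comp_id _)

lemma comp_shift_id {M N : TopMod e} (h : N ⟶ M⟦(1 : ℤ)⟧) : h ≫ (𝟙 M)⟦(1 : ℤ)⟧' = h := by
  rw [CategoryTheory.Functor.map_id, Category.comp_id]

lemma shiftObj_neg_one_d (M : TopMod e) : (M.shiftObj (-1)).d = (-M.d : Ser K M.R M.R) := by
  change (-1 : K) ^ (-1 : ℤ) • M.d = -M.d
  rw [zpow_neg, zpow_one, inv_neg, inv_one]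
  exact neg_one_smul K M.d

namespace IsSplit

variable {M M' M'' : TopMod e} {f : M ⟶ M'} {g : M' ⟶ M''} {h : M'' ⟶ M.shiftObj 1}
  {ρ : Ser K M'.R M.R} {σ : Ser K M''.R M'.R} (H : IsSplit f g h ρ σ)

variable (h) in
/-- The morphism `-h[-1] : M''[-1] → M`. -/
def negConnecting : M''.shiftObj (-1) ⟶ M where
  ser := (-h.ser : Ser K M''.R M.R)
  isPreHom := ((isPreHom_of_shift_one h).neg).shiftSource (-1) 0 (by omega)
  comm := by
    have h₁ := comm_shift_one h
    rw [shiftObj_neg_one_d, Ser.comp_neg]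
    change -(M.d.comp h.ser : Ser K M''.R M.R) =
      Ser.comp (-(h.ser : Ser K M''.R M.R)) (-M''.d)
    rw [Ser.comp_neg, Ser.neg_comp, neg_neg]
    exact neg_eq_of_add_eq_zero_right h₁

/-- Stated for any `ι` with identity series, so that the shift isomorphism in the inverse rotation
enters only through its series. -/
lemma neg_shift_comp_eq (ι : (M.shiftObj 1).shiftObj (-1) ⟶ M)
    (hι : ι.ser = (Ser.const LinearMap.id : Ser K M.R M.R)) :
    -((shiftBy e (-1)).map h ≫ ι) = negConnecting h := by
  ext1
  change -Ser.comp ι.ser h.ser = _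
  rw [hι]
  exact congrArg Neg.neg (Ser.id_comp _)

lemma invRotate_mor₁ : (Triangle.mk f g h).invRotate.mor₁ = negConnecting h :=
  neg_shift_comp_eq (h := h) _ (ser_shiftFunctorCompIsoId_hom_app M 1 (-1) (add_neg_cancel 1))

lemma ser_comp_of_ser_id {X Y : TopMod e} (g : X ⟶ Y) (ι : Y ⟶ (Y.shiftObj (-1)).shiftObj 1)
    (hι : ι.ser = (Ser.const LinearMap.id : Ser K Y.R Y.R)) :
    (g ≫ ι).ser = (g.ser : Ser K X.R Y.R) := by
  change Ser.comp ι.ser g.ser = _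
  rw [hι]
  exact Ser.id_comp _

lemma ser_invRotate_mor₃ :
    (Triangle.mk f g h).invRotate.mor₃.ser = (g.ser : Ser K M'.R M''.R) :=
  ser_comp_of_ser_id g _ (ser_shiftFunctorCompIsoId_inv_app M'' (-1) 1 (neg_add_cancel 1))

include H

/-- For a split sequence, `M'` is isomorphic to the cone of `-h[-1] : M''[-1] → M`. -/
def toConeNeg : M' ⟶ cone (negConnecting h) :=
  -- The first summand of this cone is `M''[-1][1]`, so `g` enters as a map of degree `1` to
  -- `M''[-1]`. Its two conditions are the commutation of `g` and the formula for `h g`.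
  coneLift (negConnecting h) (a := (g.ser : Ser K M'.R M''.R)) (b := ρ)
    ((isPreHom_shift_target (by omega)).2 g.isPreHom) H.retraction_isPreHom
    (by
      rw [shiftObj_neg_one_d]
      change (-M''.d).comp g.ser + g.ser.comp M'.d = 0
      rw [Ser.neg_comp, g.comm, neg_add_cancel])
    (by
      change Ser.comp (-(h.ser : Ser K M''.R M.R)) g.ser + M.d.comp ρ = ρ.comp M'.d
      rw [Ser.neg_comp, H.connecting]
      abel)

/-- The inverse of `toConeNeg`. -/
def fromConeNeg : cone (negConnecting h) ⟶ M' :=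
  coneDesc (negConnecting h) (a := (σ : Ser K M''.R M'.R)) f
    ((isPreHom_shift_source (by omega)).2 H.section_isPreHom)
    (by
      rw [shiftObj_neg_one_d]
      change M'.d.comp σ + σ.comp (-M''.d) = f.ser.comp (-(h.ser : Ser K M''.R M.R))
      rw [Ser.comp_neg, Ser.comp_neg,
        ← Ser.comp_connecting_add H.retraction H.sect H.total g.comm H.connecting]
      abel)

/-- With the opposite composite, this is an isomorphism of modules and not merely a homotopy
equivalence: `(g, ρ)` are coordinates on `M'` in which its codifferential is that of the cone. -/
lemma toConeNeg_fromConeNeg : H.toConeNeg ≫ H.fromConeNeg = 𝟙 M' :=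
  hom_ext (Ser.desc_lift_of_split H.total)

lemma fromConeNeg_toConeNeg : H.fromConeNeg ≫ H.toConeNeg = 𝟙 (cone (negConnecting h)) :=
  hom_ext (Ser.lift_desc_of_split H.retraction H.sect H.total)

lemma isIso_toConeNeg : IsIso ((hoFunctor e).map H.toConeNeg) :=
  isIso_hoFunctor_map _ H.fromConeNeg (by rw [H.toConeNeg_fromConeNeg])
    (by rw [H.fromConeNeg_toConeNeg])

lemma coneIn_toConeNeg : f ≫ H.toConeNeg = coneIn (negConnecting h) := by
  ext1
  change (Ser.lift g.ser ρ).comp f.ser = Ser.inr K A.carrier M''.carrier M.carrier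
  apply Ser.prod_ext
  · rw [Ser.fst_lift_assoc, Ser.comp_eq_zero_of_split H.retraction H.sect H.total, Ser.fst_inr]
  · rw [Ser.snd_lift_assoc, H.retraction, Ser.snd_inr]

lemma toConeNeg_coneOut :
    H.toConeNeg ≫ coneOut (negConnecting h) = (Triangle.mk f g h).invRotate.mor₃ :=
  hom_ext ((Ser.fst_lift _ _).trans ser_invRotate_mor₃.symm)

lemma nonempty_iso_invRotate :
    Nonempty ((hoFunctor e).mapTriangle.obj (Triangle.mk f g h).invRotate ≅
      (hoFunctor e).mapTriangle.obj (coneTriangle (negConnecting h))) := by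
  refine nonempty_hoTriangleIso (T₁ := (Triangle.mk f g h).invRotate)
    (T₂ := coneTriangle (negConnecting h)) (𝟙 (M''.shiftObj (-1))) (𝟙 M) H.toConeNeg
    (inferInstanceAs (IsIso ((hoFunctor e).map (𝟙 (M''.shiftObj (-1))))))
    (inferInstanceAs (IsIso ((hoFunctor e).map (𝟙 M)))) H.isIso_toConeNeg ?_ ?_ ?_
  · exact congrArg _ ((Category.comp_id _).trans (invRotate_mor₁.trans (Category.id_comp _).symm))
  · exact congrArg _ (H.coneIn_toConeNeg.trans (Category.id_comp _).symm)
  · exact congrArg _ ((comp_shift_id _).trans H.toConeNeg_coneOut.symm)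

end IsSplit

end TopMod

end

end TopAInf

namespace TopAInf

noncomputable section

open BigradedSpace

/-! ### Evaluation of series and coefficientwise strict maps -/

namespace Ser

section Eval

variable {K : Type u} [Field K] {U V W : Type u} [AddCommGroup U] [Module K U]
  [AddCommGroup V] [Module K V] [AddCommGroup W] [Module K W]

lemma eval_apply (f : Ser K V W) (x : ℕ → V) (n : ℕ) :
    f.eval x n = ∑ p ∈ Finset.HasAntidiagonal.antidiagonal n, f p.1 (x p.2) := by
  simp [Ser.eval]

/-- The constant power series `v`. -/
def constant (v : V) : ℕ → V := Pi.single 0 v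

lemma eval_constant (f : Ser K V W) (v : V) : f.eval (constant v) = fun n => f n v := by
  funext n
  rw [eval_apply, Finset.sum_eq_single (n, 0)]
  · simp [constant]
  · rintro ⟨i, j⟩ hb hne
    have : j ≠ 0 := by
      rintro rfl
      simp at hb
      exact hne (by simp [hb])
    simp [constant, this]
  · simp

lemma eval_comp (g : Ser K V W) (f : Ser K U V) (x : ℕ → U) :
    (g.comp f).eval x = g.eval (f.eval x) := by
  funext n
  simp only [eval_apply, Ser.comp, LinearMap.sum_apply, LinearMap.comp_apply, map_sum]
  rw [Finset.sum_sigma', Finset.sum_sigma']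
  refine Finset.sum_nbij' (fun ⟨⟨_, j⟩, ⟨k, l⟩⟩ ↦ ⟨(k, l + j), (l, j)⟩)
    (fun ⟨⟨i, _⟩, ⟨k, l⟩⟩ ↦ ⟨(i + k, l), (i, k)⟩) ?_ ?_ ?_ ?_ ?_ <;>
    simp only [Finset.mem_sigma, Finset.HasAntidiagonal.mem_antidiagonal, Sigma.forall, Prod.forall] <;>
    rintro a b c d ⟨rfl, rfl⟩ <;> simp [add_assoc]

lemma eval_const (l : V →ₗ[K] W) (x : ℕ → V) : (Ser.const l).eval x = fun n => l (x n) := by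
  funext n
  rw [eval_apply, Finset.sum_eq_single (0, n)]
  · simp [Ser.const]
  · rintro ⟨i, j⟩ hb hne
    have : i ≠ 0 := by
      rintro rfl
      simp at hb
      exact hne (by simp [hb])
    simp [Ser.const, this]
  · simp

lemma eval_add (f g : Ser K V W) (x : ℕ → V) : (f + g).eval x = f.eval x + g.eval x := by
  funext n
  simp [eval_apply, Finset.sum_add_distrib]

lemma eval_sub (f g : Ser K V W) (x : ℕ → V) : (f - g).eval x = f.eval x - g.eval x := by
  funext n
  simp [eval_apply, Finset.sum_sub_distrib]

lemma eval_neg (f : Ser K V W) (x : ℕ → V) : (-f).eval x = -f.eval x := by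
  funext n
  simp [eval_apply]

lemma eval_zero (x : ℕ → V) : (0 : Ser K V W).eval x = 0 := by
  funext n
  simp [eval_apply]

/-- The coefficientwise extension of a series of linear maps to cofree comodules. -/
def strict (B : Type u) [AddCommGroup B] [Module K B] (f : Ser K V W) :
    Ser K (Cof K B V) (Cof K B W) := fun n => strictMap K B (f n)

variable (B : Type u) [AddCommGroup B] [Module K B]

lemma strict_comp (g : Ser K V W) (f : Ser K U V) :
    (strict B g).comp (strict B f) = strict B (g.comp f) := by
  funext n
  refine TensorProduct.ext' fun x t => ?_
  simp [Ser.comp, strict, TensorProduct.sum_tmul]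

lemma strict_const (l : V →ₗ[K] W) : strict B (Ser.const l) = Ser.const (strictMap K B l) := by
  funext n
  simp only [strict, Ser.const]
  split_ifs <;> simp

lemma strict_id : strict B (Ser.const (LinearMap.id : V →ₗ[K] V)) = Ser.const LinearMap.id := by
  rw [strict_const, strictMap, LinearMap.rTensor_id]

lemma strict_add (f g : Ser K V W) : strict B (f + g) = strict B f + strict B g := by
  funext n
  exact LinearMap.rTensor_add _ _ _

end Eval

end Ser

/-! ### Comodule maps and their projections to cogenerators -/

section Cogenerators

variable {K : Type u} [Field K] {B V W : Type u} [AddCommGroup B] [Module K B] [AddCommGroup V]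
  [Module K V] [AddCommGroup W] [Module K W]

lemma counit_ι_mul (a : B) (t : TensorAlgebra K B) : counit K B (TensorAlgebra.ι K a * t) = 0 := by
  simp [TensorAlgebra.algebraMapInv]

/-- A comodule map whose Taylor components of order `≥ 1` vanish is induced by a linear map. -/
lemma IsComoduleMap.eq_strictMap {f : Cof K B V →ₗ[K] Cof K B W} (hf : IsComoduleMap K B f)
    (h : ∀ m a t, toCogen K B W (f (m ⊗ₜ (TensorAlgebra.ι K a * t))) = 0) :
    f = strictMap K B (toCogen K B W ∘ₗ f ∘ₗ (TensorProduct.mk K V (TensorAlgebra K B)).flip 1) := by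
  set l := toCogen K B W ∘ₗ f ∘ₗ (TensorProduct.mk K V (TensorAlgebra K B)).flip 1
  -- The two sides agree on `m ⊗ 1` by the choice of `l`, and both vanish on words of positive
  -- length, where the counit is zero.
  have key : toCogen K B W ∘ₗ f = l ∘ₗ toCogen K B V := by
    refine TensorProduct.ext' fun m t => ?_
    rw [LinearMap.comp_apply, LinearMap.comp_apply, toCogen_tmul]
    induction t using tensor_induction with
    | h1 => simp [l]
    | hmul a t _ => rw [h, counit_ι_mul, zero_smul, map_zero]
    | hadd s t hs ht => rw [tmul_add, map_add, map_add, hs, ht, map_add, add_smul, map_add]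
    | hsmul c t ht => simp only [tmul_smul, map_smul, ht, smul_eq_mul, mul_smul]
  refine TensorProduct.ext' fun x y => ?_
  -- Projecting the left factor of the coaction to cogenerators recovers an element, so the comodule
  -- identity transports `key` from cogenerators to the whole map.
  have h₁ := LinearMap.congr_fun hf (x ⊗ₜ y)
  have h₂ := congrArg (LinearMap.rTensor (TensorAlgebra K B) (toCogen K B W)) h₁
  rw [LinearMap.comp_apply, cogen_coact, LinearMap.comp_apply,
    ← LinearMap.comp_apply (LinearMap.rTensor (TensorAlgebra K B) (toCogen K B W)),
    ← LinearMap.rTensor_comp, key, LinearMap.rTensor_comp, LinearMap.comp_apply,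
    cogen_coact] at h₂
  exact h₂

end Cogenerators

/-! ### Homogeneous components and power series -/

namespace BigradedSpace

variable {K : Type u} [Field K]

/-- Only the empty word survives the counit, and it lies in bidegree `(0, 0)`. -/
lemma counit_of_mem_barGr {A : BigradedSpace K} {r s : ℤ} {t : TensorAlgebra K A.carrier}
    (ht : t ∈ A.barGr r s) (h : ¬ (r = 0 ∧ s = 0)) : counit K A.carrier t = 0 := by
  have : A.barGr r s ≤ LinearMap.ker (counit K A.carrier) := by
    refine Submodule.span_le.2 fun t ht => ?_
    cases ht with
    | nil => exact absurd ⟨rfl, rfl⟩ h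
    | cons _ _ => exact counit_ι_mul _ _
  exact this ht

/-- The index moves by one because `m ⊗ 1` with `m ∈ M^k` has degree `k - 1` in `M[1] ⊗ T(A[1])`. -/
lemma toCogen_mem {A M : BigradedSpace K} {i j k : ℤ} (hk : i + 1 = k)
    {x : Cof K A.carrier M.carrier} (hx : x ∈ cofreeGr A M i j) :
    toCogen K A.carrier M.carrier x ∈ M.gr k j := by
  have : cofreeGr A M i j ≤ (M.gr k j).comap (toCogen K A.carrier M.carrier) := by
    refine Submodule.span_le.2 ?_
    rintro _ ⟨p, q, r, s, m, t, hm, ht, hi, hj, rfl⟩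
    rw [SetLike.mem_coe, Submodule.mem_comap, toCogen_tmul]
    by_cases h : r = 0 ∧ s = 0
    · obtain ⟨rfl, rfl⟩ := h
      obtain rfl : p = k := by omega
      obtain rfl : q = j := by omega
      exact Submodule.smul_mem _ _ hm
    · rw [counit_of_mem_barGr ht h, zero_smul]
      exact Submodule.zero_mem _
  exact this hx

lemma tmul_one_mem {A M : BigradedSpace K} {i j : ℤ} {m : M.carrier} (hm : m ∈ M.gr i j) :
    m ⊗ₜ[K] (1 : TensorAlgebra K A.carrier) ∈ cofreeGr A M (i - 1) j :=
  Submodule.subset_span ⟨i, j, 0, 0, m, 1, hm, Submodule.subset_span BarWord.nil, by omega,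
    by omega, rfl⟩

/-- Used to glue sections that are only constructed bidegree by bidegree. -/
lemma exists_linearMap (M : BigradedSpace K) {X : Type u} [AddCommGroup X] [Module K X]
    (s : ∀ i j, M.gr i j →ₗ[K] X) :
    ∃ σ : M.carrier →ₗ[K] X, ∀ i j m (hm : m ∈ M.gr i j), σ m = s i j ⟨m, hm⟩ := by
  refine ⟨(DirectSum.toModule K (ℤ × ℤ) X fun p => s p.1 p.2) ∘ₗ
    (LinearEquiv.ofBijective (DirectSum.coeLinearMap fun p : ℤ × ℤ => M.gr p.1 p.2)
      M.isInternal).symm.toLinearMap, fun i j m hm => ?_⟩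
  have : (LinearEquiv.ofBijective (DirectSum.coeLinearMap fun p : ℤ × ℤ => M.gr p.1 p.2)
      M.isInternal).symm m =
      DirectSum.lof K (ℤ × ℤ) (fun p : ℤ × ℤ => M.gr p.1 p.2) (i, j) ⟨m, hm⟩ := by
    rw [LinearEquiv.symm_apply_eq]
    exact (DirectSum.coeLinearMap_lof (fun p : ℤ × ℤ => M.gr p.1 p.2) (i, j) ⟨m, hm⟩).symm
  rw [LinearMap.comp_apply, LinearEquiv.coe_coe, this, DirectSum.toModule_lof]

lemma mem_seriesGr {M : BigradedSpace K} {i j : ℤ} {x : ℕ → M.carrier} :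
    x ∈ M.seriesGr i j ↔ ∀ n, x n ∈ M.gr i j := by
  simp [seriesGr]

lemma constant_mem_seriesGr {M : BigradedSpace K} {i j : ℤ} {m : M.carrier} (hm : m ∈ M.gr i j) :
    Ser.constant m ∈ M.seriesGr i j := by
  rw [mem_seriesGr]
  intro n
  by_cases hn : n = 0
  · subst hn
    simpa [Ser.constant] using hm
  · simp [Ser.constant, hn]

lemma eval_mem_seriesGr {M N : BigradedSpace K} {i j k l : ℤ} {f : Ser K M.carrier N.carrier}
    (hf : ∀ n, ∀ m ∈ M.gr i j, f n m ∈ N.gr k l) {x : ℕ → M.carrier} (hx : x ∈ M.seriesGr i j) :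
    f.eval x ∈ N.seriesGr k l := by
  rw [mem_seriesGr] at hx ⊢
  intro n
  rw [Ser.eval_apply]
  exact Submodule.sum_mem _ fun p _ => hf _ _ (hx _)

/-- The values at constant power series list the coefficients. It thus suffices to verify an
identity of series on constant homogeneous elements, where exactness is available. -/
lemma ser_ext (M : BigradedSpace K) {X : Type u} [AddCommGroup X] [Module K X]
    {f g : Ser K M.carrier X}
    (h : ∀ i j, ∀ m ∈ M.gr i j, f.eval (Ser.constant m) = g.eval (Ser.constant m)) : f = g := by
  funext n
  refine M.hom_ext fun i j m hm => ?_
  have := congrFun (h i j m hm) n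
  rwa [Ser.eval_constant, Ser.eval_constant] at this

end BigradedSpace

end

end TopAInf

namespace TopAInf

noncomputable section

open BigradedSpace

variable {K : Type u} [Field K] {A : TopAInfAlg K} {e : A.StrictUnit}

namespace TopMod

/-! ### Taylor components -/

section Taylor

variable {M N P : TopMod e}

lemma taylor_apply (f : Ser K M.R N.R) (w : TensorAlgebra K A.carrier) (n : ℕ) (m : M.carrier) :
    taylor f w n m = toCogen K A.carrier N.carrier (f n (m ⊗ₜ w)) := rfl

lemma taylor_add (f g : Ser K M.R N.R) (w : TensorAlgebra K A.carrier) :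
    taylor (f + g) w = taylor f w + taylor g w := by
  funext n
  ext m
  simp [taylor_apply]

lemma taylor_sub (f g : Ser K M.R N.R) (w : TensorAlgebra K A.carrier) :
    taylor (f - g) w = taylor f w - taylor g w := by
  funext n
  ext m
  simp [taylor_apply]

lemma taylor_neg (f : Ser K M.R N.R) (w : TensorAlgebra K A.carrier) :
    taylor (-f) w = -taylor f w := by
  funext n
  ext m
  simp [taylor_apply]

lemma taylor_strict_comp (ρ : Ser K N.carrier P.carrier) (f : Ser K M.R N.R)
    (w : TensorAlgebra K A.carrier) :
    taylor (N := P) ((Ser.strict A.carrier ρ).comp f) w = ρ.comp (taylor f w) := by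
  funext n
  ext m
  simp only [taylor_apply, Ser.comp, LinearMap.sum_apply, LinearMap.comp_apply, map_sum]
  exact Finset.sum_congr rfl fun p _ => toCogen_strictMap _ _

lemma taylor_comp_strict (f : Ser K N.R P.R) (ρ : Ser K M.carrier N.carrier)
    (w : TensorAlgebra K A.carrier) :
    taylor (M := M) (f.comp (Ser.strict A.carrier ρ)) w = (taylor f w).comp ρ := by
  funext n
  ext m
  simp only [taylor_apply, Ser.comp, LinearMap.sum_apply, LinearMap.comp_apply, map_sum]
  rfl

lemma taylor_strict_one (ρ : Ser K M.carrier N.carrier) :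
    taylor (M := M) (N := N) (Ser.strict A.carrier ρ) 1 = ρ := by
  funext n
  ext m
  have h : counit K A.carrier 1 = 1 := map_one TensorAlgebra.algebraMapInv
  rw [taylor_apply, Ser.strict, toCogen_strictMap, toCogen_tmul, h, one_smul]

lemma taylor_strict_ι_mul (ρ : Ser K M.carrier N.carrier) (a : A.carrier)
    (t : TensorAlgebra K A.carrier) :
    taylor (M := M) (N := N) (Ser.strict A.carrier ρ) (TensorAlgebra.ι K a * t) = 0 := by
  funext n
  ext m
  rw [taylor_apply, Ser.strict, toCogen_strictMap, toCogen_tmul, counit_ι_mul, zero_smul, map_zero]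
  rfl

/-- Strictness, a condition on Taylor components, becomes an equality of series, so strict morphisms
can be composed through their linear parts. -/
lemma eq_strict_of_taylor {f : Ser K M.R N.R} (hf : ∀ n, IsComoduleMap K A.carrier (f n))
    (h : ∀ a t, taylor f (TensorAlgebra.ι K a * t) = 0) :
    f = Ser.strict A.carrier (taylor f 1) := by
  funext n
  exact (hf n).eq_strictMap fun m a t => LinearMap.congr_fun (congrFun (h a t) n) m

lemma taylor_one_mem {f : Ser K M.R N.R} {r : ℤ}
    (hf : ∀ n, HasDegree A.toBigradedSpace M.toBigradedSpace N.toBigradedSpace r (f n))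
    {i j k : ℤ} (hk : i + r = k) (n : ℕ) {m : M.carrier} (hm : m ∈ M.gr i j) :
    taylor f 1 n m ∈ N.gr k j :=
  toCogen_mem (by omega) (hf n _ _ _ (tmul_one_mem hm))

lemma taylor_eval_mem (f : M ⟶ N) {i j : ℤ} {x : ℕ → M.carrier} (hx : x ∈ M.seriesGr i j) :
    (taylor f.ser 1).eval x ∈ N.seriesGr i j :=
  eval_mem_seriesGr (fun n _ hm => taylor_one_mem f.isPreHom.degree (add_zero i) n hm) hx

lemma isPreHom_strict {ρ : Ser K M.carrier N.carrier}
    (hρ : ∀ n i j, ∀ m ∈ M.gr i j, ρ n m ∈ N.gr i j) :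
    IsPreHom M N 0 (Ser.strict A.carrier ρ) where
  comodule n := coact_strictMap (ρ n)
  degree n := hasDegree_strictMap (hρ n)
  unital n := vanishesOn_strictMap _ (ρ n)

end Taylor

/-! ### Splittings of semi-split sequences -/

namespace IsSemiSplit

variable {M M' M'' : TopMod e} {f : M ⟶ M'} {g : M' ⟶ M''} {ρ : Ser K M'.carrier M.carrier}
  (H : IsSemiSplit f g ρ)

include H

lemma ser_left : f.ser = Ser.strict A.carrier (taylor f.ser 1) :=
  eq_strict_of_taylor f.isPreHom.comodule H.strict_left

lemma ser_right : g.ser = Ser.strict A.carrier (taylor g.ser 1) :=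
  eq_strict_of_taylor g.isPreHom.comodule H.strict_right

/-- Exactness gives `y = f x`, and then `x = ρ f x = 0`. This joint injectivity of `(g, ρ)` yields
the uniqueness and the linearity of lifts. -/
lemma eq_zero_of_eval {i j : ℤ} {y : ℕ → M'.carrier} (hy : y ∈ M'.seriesGr i j)
    (hg : (taylor g.ser 1).eval y = 0) (hρ : ρ.eval y = 0) : y = 0 := by
  obtain ⟨x, -, rfl⟩ := (H.exact i j y hy).1 hg
  rw [← Ser.eval_comp, H.retraction, Ser.eval_const] at hρ
  have hx : x = 0 := hρ
  rw [hx, map_zero]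

lemma retraction_eval_mem {i j : ℤ} {y : ℕ → M'.carrier} (hy : y ∈ M'.seriesGr i j) :
    ρ.eval y ∈ M.seriesGr i j :=
  eval_mem_seriesGr (fun n m hm => H.degree n i j m hm) hy

/-- Subtracting `f ρ y` from any lift `y` keeps its image under `g` and makes it vanish under `ρ`.
-/
lemma exists_lift {i j : ℤ} {z : M''.carrier} (hz : z ∈ M''.gr i j) :
    ∃ y ∈ M'.seriesGr i j, (taylor g.ser 1).eval y = Ser.constant z ∧ ρ.eval y = 0 := by
  obtain ⟨y, hy, hyz⟩ := H.surjective i j _ (constant_mem_seriesGr hz)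
  have hx := taylor_eval_mem f (H.retraction_eval_mem hy)
  refine ⟨y - (taylor f.ser 1).eval (ρ.eval y), sub_mem hy hx, ?_, ?_⟩
  · rw [map_sub, hyz, (H.exact i j _ hx).2 ⟨_, H.retraction_eval_mem hy, rfl⟩, sub_zero]
  · rw [map_sub, ← Ser.eval_comp ρ, H.retraction, Ser.eval_const]
    exact sub_self _

/-- Lifts killed by `ρ` are unique, so an arbitrary choice of them is automatically additive and
`K`-linear. -/
lemma exists_homogeneous_section (i j : ℤ) : ∃ s : M''.gr i j →ₗ[K] (ℕ → M'.carrier),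
    ∀ z, s z ∈ M'.seriesGr i j ∧ (taylor g.ser 1).eval (s z) = Ser.constant z.1 ∧
      ρ.eval (s z) = 0 := by
  choose s hs using fun z : M''.gr i j => H.exists_lift z.2
  refine ⟨⟨⟨s, fun y z => ?_⟩, fun c z => ?_⟩, hs⟩
  · rw [← sub_eq_zero]
    refine H.eq_zero_of_eval (sub_mem (hs _).1 (add_mem (hs _).1 (hs _).1)) ?_ ?_
    · rw [map_sub, map_add, (hs _).2.1, (hs _).2.1, (hs _).2.1, sub_eq_zero]
      exact Pi.single_add _ _ _
    · rw [map_sub, map_add, (hs _).2.2, (hs _).2.2, (hs _).2.2, add_zero, sub_zero]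
  · rw [← sub_eq_zero, RingHom.id_apply]
    refine H.eq_zero_of_eval (sub_mem (hs _).1 (Submodule.smul_mem _ _ (hs _).1)) ?_ ?_
    · rw [map_sub, map_smul, (hs _).2.1, (hs _).2.1, sub_eq_zero]
      exact Pi.single_smul _ _ _
    · rw [map_sub, map_smul, (hs _).2.2, (hs _).2.2, smul_zero, sub_zero]

/-- A semi-split sequence is split as a sequence of topologically free modules. -/
lemma exists_section : ∃ σ : Ser K M''.carrier M'.carrier,
    (∀ n i j, ∀ z ∈ M''.gr i j, σ n z ∈ M'.gr i j) ∧
    (taylor g.ser 1).comp σ = Ser.const LinearMap.id ∧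
    (taylor f.ser 1).comp ρ + σ.comp (taylor g.ser 1) = Ser.const LinearMap.id := by
  choose s hs using H.exists_homogeneous_section
  obtain ⟨S, hS⟩ := M''.exists_linearMap s
  -- A linear map `M'' → M'⟦ħ⟧` is the same as a series of linear maps: the `n`-th term reads off
  -- the coefficient of `ħⁿ`.
  let σ : Ser K M''.carrier M'.carrier := fun n => LinearMap.proj n ∘ₗ S
  have hσ : ∀ z, σ.eval (Ser.constant z) = S z := fun z => Ser.eval_constant σ z
  have hmem : ∀ i j, ∀ z ∈ M''.gr i j, S z ∈ M'.seriesGr i j := fun i j z hz => by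
    rw [hS i j z hz]
    exact (hs i j _).1
  have hdeg : ∀ n i j, ∀ z ∈ M''.gr i j, σ n z ∈ M'.gr i j := fun n i j z hz =>
    mem_seriesGr.1 (hmem i j z hz) n
  have hgσ : (taylor g.ser 1).comp σ = Ser.const LinearMap.id := by
    refine M''.ser_ext fun i j z hz => ?_
    rw [Ser.eval_comp, hσ, hS i j z hz, (hs i j _).2.1, Ser.eval_const]
    rfl
  have hρσ : ρ.comp σ = 0 := by
    refine M''.ser_ext fun i j z hz => ?_
    rw [Ser.eval_comp, hσ, hS i j z hz, (hs i j _).2.2, Ser.eval_zero]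
  have hgf : (taylor g.ser 1).comp (taylor f.ser 1) = 0 := by
    refine M.ser_ext fun i j x hx => ?_
    have hx' := constant_mem_seriesGr hx
    rw [Ser.eval_comp, (H.exact i j _ (taylor_eval_mem f hx')).2 ⟨_, hx', rfl⟩, Ser.eval_zero]
  refine ⟨σ, hdeg, hgσ, M'.ser_ext fun i j y hy => ?_⟩
  have hy' := constant_mem_seriesGr hy
  rw [← sub_eq_zero]
  -- The difference of `f ρ + σ g` and the identity is killed by `g` and by `ρ`, since `g f = 0` and
  -- `ρ σ = 0`; joint injectivity concludes.
  refine H.eq_zero_of_eval (i := i) (j := j) (sub_mem ?_ ?_) ?_ ?_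
  · rw [Ser.eval_add, Ser.eval_comp, Ser.eval_comp]
    refine add_mem (taylor_eval_mem f (H.retraction_eval_mem hy')) (eval_mem_seriesGr
      (fun n z hz => hdeg n i j z hz) (taylor_eval_mem g hy'))
  · rw [Ser.eval_const]
    exact hy'
  · rw [← Ser.eval_sub, ← Ser.eval_comp, Ser.comp_sub, Ser.comp_add, ← Ser.comp_assoc, hgf,
      ← Ser.comp_assoc, hgσ, Ser.id_comp, Ser.comp_id, Ser.zero_comp, zero_add, sub_self,
      Ser.eval_zero]
  · rw [← Ser.eval_sub, ← Ser.eval_comp, Ser.comp_sub, Ser.comp_add, ← Ser.comp_assoc,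
      H.retraction, ← Ser.comp_assoc, hρσ, Ser.id_comp, Ser.comp_id, Ser.zero_comp, add_zero,
      sub_self, Ser.eval_zero]

end IsSemiSplit

/-! ### The connecting morphism -/

/-- The series `d_M ∘ P - P ∘ d_M'` for `P = ρ ⊗ 1`. -/
def defect (M' M : TopMod e) (ρ : Ser K M'.carrier M.carrier) : Ser K M'.R M.R :=
  M.d.comp (Ser.strict A.carrier ρ) - (Ser.strict A.carrier ρ).comp M'.d

/-- Both codifferentials are coderivations over the same `d_A`. As `l` preserves degrees it commutes
with the sign operator, so the terms containing `d_A` cancel in the commutator. -/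
lemma isComoduleMap_commutator {M M' : TopMod e} {l : M'.carrier →ₗ[K] M.carrier}
    (hl : ∀ i j, ∀ m ∈ M'.gr i j, l m ∈ M.gr i j) (n : ℕ) :
    IsComoduleMap K A.carrier (M.d n ∘ₗ strictMap K A.carrier l -
      strictMap K A.carrier l ∘ₗ M'.d n) := by
  have hs : cofreeSign A.toBigradedSpace M.toBigradedSpace ∘ₗ strictMap K A.carrier l =
      strictMap K A.carrier l ∘ₗ cofreeSign A.toBigradedSpace M'.toBigradedSpace := by
    refine TensorProduct.ext' fun m t => ?_
    have := LinearMap.congr_fun (parity_comp (M := M'.toBigradedSpace) hl) m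
    simp only [LinearMap.comp_apply] at this
    simp [cofreeSign, this]
  have hc : coact K A.carrier M.carrier ∘ₗ strictMap K A.carrier l =
      LinearMap.rTensor _ (strictMap K A.carrier l) ∘ₗ coact K A.carrier M'.carrier :=
    coact_strictMap l
  unfold IsComoduleMap
  rw [LinearMap.comp_sub, ← LinearMap.comp_assoc, M.d_coderivation, LinearMap.comp_assoc, hc,
    ← LinearMap.comp_assoc (M'.d n), hc, LinearMap.comp_assoc (M'.d n), M'.d_coderivation,
    ← LinearMap.comp_assoc, ← LinearMap.comp_assoc, ← LinearMap.sub_comp]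
  congr 1
  refine TensorProduct.ext' fun x t => ?_
  have := LinearMap.congr_fun hs x
  simp only [LinearMap.comp_apply] at this
  simp [this]

lemma isComoduleMap_sum {M N : TopMod e} {ι : Type} (s : Finset ι)
    (F : ι → M.R →ₗ[K] N.R) (h : ∀ i ∈ s, IsComoduleMap K A.carrier (F i)) :
    IsComoduleMap K A.carrier (∑ i ∈ s, F i) := by
  classical
  induction s using Finset.induction_on with
  | empty => simp [IsComoduleMap]
  | insert a s ha ih =>
    have h₁ := h a (Finset.mem_insert_self a s)
    have h₂ := ih fun i hi => h i (Finset.mem_insert_of_mem hi)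
    unfold IsComoduleMap at *
    rw [Finset.sum_insert ha, LinearMap.comp_add, h₁, h₂, LinearMap.rTensor_add,
      LinearMap.add_comp]

lemma isComoduleMap_defect {M M' : TopMod e} {ρ : Ser K M'.carrier M.carrier}
    (hρ : ∀ n i j, ∀ m ∈ M'.gr i j, ρ n m ∈ M.gr i j) (n : ℕ) :
    IsComoduleMap K A.carrier (defect M' M ρ n) := by
  have : defect M' M ρ n = ∑ p ∈ Finset.HasAntidiagonal.antidiagonal n,
      (M.d p.1 ∘ₗ strictMap K A.carrier (ρ p.2) - strictMap K A.carrier (ρ p.2) ∘ₗ M'.d p.1) := by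
    -- In the two Cauchy products `d` and `ρ` carry opposite indices; swapping one antidiagonal
    -- pairs them into commutators.
    rw [Finset.sum_sub_distrib, ← Finset.Nat.sum_antidiagonal_swap
      (f := fun p => strictMap K A.carrier (ρ p.2) ∘ₗ M'.d p.1)]
    rfl
  rw [this]
  exact isComoduleMap_sum _ _ fun p _ => isComoduleMap_commutator (hρ p.2) p.1

lemma hasDegree_comp {M N P : TopMod e} {r s k : ℤ} {g : Ser K N.R P.R} {f : Ser K M.R N.R}
    (hg : ∀ n, HasDegree A.toBigradedSpace N.toBigradedSpace P.toBigradedSpace r (g n))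
    (hf : ∀ n, HasDegree A.toBigradedSpace M.toBigradedSpace N.toBigradedSpace s (f n))
    (hk : s + r = k) (n : ℕ) :
    HasDegree A.toBigradedSpace M.toBigradedSpace P.toBigradedSpace k (g.comp f n) := by
  intro i j x hx
  rw [Ser.comp, LinearMap.sum_apply]
  exact Submodule.sum_mem _ fun p _ => (hg p.1).comp (hf p.2) hk i j x hx

namespace IsSemiSplit

variable {M M' M'' : TopMod e} {f : M ⟶ M'} {g : M' ⟶ M''} {ρ : Ser K M'.carrier M.carrier}
  (H : IsSemiSplit f g ρ)

include H

lemma isPreHom_retraction : IsPreHom M' M 0 (Ser.strict A.carrier ρ) := isPreHom_strict H.degree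

/-- The unit condition fails for the codifferentials themselves, since the unit acts as the
identity. In the defect, the compatibility of `ρ` removes every Taylor component of order `≥ 1`, so
the defect is strict and the condition is automatic. -/
lemma isPreHom_defect : IsPreHom M' M 1 (defect M' M ρ) where
  comodule := isComoduleMap_defect H.degree
  degree n i j x hx := sub_mem
    (hasDegree_comp M.d_degree H.isPreHom_retraction.degree (zero_add 1) n i j x hx)
    (hasDegree_comp H.isPreHom_retraction.degree M'.d_degree (add_zero 1) n i j x hx)
  unital := by
    have h : defect M' M ρ = Ser.strict A.carrier (taylor (defect M' M ρ) 1) := by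
      refine eq_strict_of_taylor (isComoduleMap_defect H.degree) fun a t => ?_
      rw [defect, taylor_sub, taylor_comp_strict, taylor_strict_comp, H.compatible, sub_self]
    intro n
    rw [h]
    exact vanishesOn_strictMap _ _

/-- The structure maps of a semi-split sequence, as a splitting of cofree comodules. -/
lemma exists_isSplit {h : M'' ⟶ M.shiftObj 1} (hh : IsConnecting g ρ h) :
    ∃ σ, IsSplit f g h (Ser.strict A.carrier ρ) σ := by
  obtain ⟨σ, hσ, hgσ, ht⟩ := H.exists_section
  refine ⟨Ser.strict A.carrier σ, H.isPreHom_retraction, isPreHom_strict hσ, ?_, ?_, ?_, hh⟩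
  · rw [H.ser_left, Ser.strict_comp, H.retraction, Ser.strict_id]
  · rw [H.ser_right, Ser.strict_comp, hgσ, Ser.strict_id]
  · rw [H.ser_left, H.ser_right, Ser.strict_comp, Ser.strict_comp, ← Ser.strict_add, ht,
      Ser.strict_id]

/-- Existence and uniqueness of the connecting morphism of a semi-split sequence. -/
lemma existsUnique_connecting : ∃! h : M'' ⟶ M.shiftObj 1, IsConnecting g ρ h := by
  obtain ⟨σ, hσ, hgσ, ht⟩ := H.exists_section
  have hS : IsPreHom M'' M' 0 (Ser.strict A.carrier σ) := isPreHom_strict hσ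
  have hGS : g.ser.comp (Ser.strict A.carrier σ) = Ser.const LinearMap.id := by
    rw [H.ser_right, Ser.strict_comp, hgσ, Ser.strict_id]
  have hT : f.ser.comp (Ser.strict A.carrier ρ) + (Ser.strict A.carrier σ).comp g.ser =
      Ser.const LinearMap.id := by
    rw [H.ser_left, H.ser_right, Ser.strict_comp, Ser.strict_comp, ← Ser.strict_add, ht,
      Ser.strict_id]
  have hPF : (Ser.strict A.carrier ρ).comp f.ser = Ser.const LinearMap.id := by
    rw [H.ser_left, Ser.strict_comp, H.retraction, Ser.strict_id]
  have hEF : (defect M' M ρ).comp f.ser = 0 := by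
    rw [defect, Ser.sub_comp, Ser.comp_assoc, hPF, Ser.comp_assoc, f.comm, ← Ser.comp_assoc, hPF,
      Ser.comp_id, Ser.id_comp, sub_self]
  -- The defect kills `f`, so composing it with `f ρ + σ g = 1` leaves only the part through `g`.
  -- This provides the factorization `E = (E σ) g`.
  have hEG : ((defect M' M ρ).comp (Ser.strict A.carrier σ)).comp g.ser = defect M' M ρ := by
    have h₁ := congrArg (fun x => (defect M' M ρ).comp x) hT
    simp only [Ser.comp_add, ← Ser.comp_assoc, hEF, Ser.zero_comp, zero_add, Ser.comp_id] at h₁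
    exact h₁
  -- Precomposition with `g` is injective because `g` has a section; this gives uniqueness, and the
  -- commutation of `h` can be checked after composing with `g`.
  have hcancel : ∀ a b : Ser K M''.R M.R, a.comp g.ser = b.comp g.ser → a = b := by
    intro a b hab
    have h₁ := congrArg (fun x => x.comp (Ser.strict A.carrier σ)) hab
    simpa only [Ser.comp_assoc, hGS, Ser.comp_id] using h₁
  have hEd : (defect M' M ρ).comp M'.d = M.d.comp ((Ser.strict A.carrier ρ).comp M'.d) := by
    rw [defect, Ser.sub_comp, Ser.comp_assoc, Ser.comp_assoc, M'.d_comp_d, Ser.comp_zero, sub_zero]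
  have hdE : M.d.comp (defect M' M ρ) = -M.d.comp ((Ser.strict A.carrier ρ).comp M'.d) := by
    rw [defect, Ser.comp_sub, ← Ser.comp_assoc, M.d_comp_d, Ser.zero_comp, zero_sub]
  refine ⟨{ ser := (defect M' M ρ).comp (Ser.strict A.carrier σ)
            isPreHom := (isPreHom_shift_target (zero_add 1)).2
              (H.isPreHom_defect.comp hS (zero_add 1))
            comm := ?_ }, hEG, fun h' hh' => hom_ext (hcancel _ _ ?_)⟩
  -- After composing with `g` the claim is `-d E = E d`; both sides equal `d P d` because the
  -- codifferentials square to zero.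
  · rw [shiftObj_one_d]
    apply hcancel
    rw [Ser.comp_assoc, hEG, Ser.comp_assoc _ M''.d, g.comm, ← Ser.comp_assoc _ g.ser, hEG, hEd,
      Ser.neg_comp, hdE, neg_neg]
  · exact Eq.trans hh' hEG.symm

end IsSemiSplit

end TopMod

end

end TopAInf

namespace TopAInf

noncomputable section

open BigradedSpace

variable {K : Type u} [Field K] {A : TopAInfAlg K} {e : A.StrictUnit}

namespace TopMod

/-! ### The semi-split sequence of a cylinder -/

lemma taylor_const_one {M N : TopMod e} (l : M.carrier →ₗ[K] N.carrier) :
    taylor (M := M) (N := N) (Ser.const (strictMap K A.carrier l)) 1 = Ser.const l := by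
  rw [← Ser.strict_const, taylor_strict_one]

lemma taylor_const_ι_mul {M N : TopMod e} (l : M.carrier →ₗ[K] N.carrier) (a : A.carrier)
    (t : TensorAlgebra K A.carrier) :
    taylor (M := M) (N := N) (Ser.const (strictMap K A.carrier l)) (TensorAlgebra.ι K a * t) =
      0 := by
  rw [← Ser.strict_const, taylor_strict_ι_mul]

section Cylinder

variable {M N : TopMod e} (f : M ⟶ N)

/-- The projection `Cyl(f) → M`, as a series of linear maps. -/
def cylRetraction : Ser K (cyl f).carrier M.carrier :=
  Ser.const (LinearMap.fst K M.carrier N.carrier ∘ₗ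
    LinearMap.snd K M.carrier (M.carrier × N.carrier))

lemma strict_cylRetraction : Ser.strict A.carrier (cylRetraction f) =
    (Ser.fst K A.carrier M.carrier N.carrier).comp
      (Ser.snd K A.carrier M.carrier (M.carrier × N.carrier)) := by
  rw [Ser.fst, Ser.snd, Ser.const_comp_const, strictMap_comp, ← Ser.strict_const]
  rfl

/-- The component of the cylinder codifferential in `M` is `d m - m'`, so the defect of the
retraction is the projection to `m'`. That projection is strict, which gives the compatibility in
`isSemiSplit_cyl`, and it is the connecting map to `M[1]`. -/
lemma strict_cylRetraction_comp_d :
    (Ser.strict A.carrier (cylRetraction f)).comp (cyl f).d =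
      M.d.comp (Ser.strict A.carrier (cylRetraction f)) -
        Ser.fst K A.carrier M.carrier (M.carrier × N.carrier) := by
  rw [strict_cylRetraction, cyl_d, Ser.comp_assoc, Ser.snd_twisted, Ser.comp_add,
    Ser.fst_lift_assoc, Ser.fst_twisted_assoc, Ser.neg_comp, Ser.id_comp]
  abel

lemma isSemiSplit_cyl : IsSemiSplit (cylIn f) (cylOut f) (cylRetraction f) where
  strict_left a t := taylor_const_ι_mul _ a t
  strict_right a t := taylor_const_ι_mul _ a t
  injective i j x _ h := by
    erw [taylor_const_one, Ser.eval_const] at h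
    funext n
    exact congrArg (fun p : M.carrier × (M.carrier × N.carrier) => p.2.1) (congrFun h n)
  exact i j y hy := by
    have hy' := mem_seriesGr.1 hy
    erw [taylor_const_one, taylor_const_one, Ser.eval_const]
    constructor
    · intro h
      refine ⟨fun n => (y n).2.1, mem_seriesGr.2 fun n => (hy' n).2.1, ?_⟩
      rw [Ser.eval_const]
      funext n
      have h₁ : (y n).1 = 0 := congrArg Prod.fst (congrFun h n)
      have h₂ : (y n).2.2 = 0 := congrArg Prod.snd (congrFun h n)
      exact Prod.ext h₁.symm (Prod.ext rfl h₂.symm)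
    · rintro ⟨x, -, rfl⟩
      rw [Ser.eval_const]
      rfl
  surjective i j z hz := by
    have hz' := mem_seriesGr.1 hz
    refine ⟨fun n => ((z n).1, (0, (z n).2)), mem_seriesGr.2 fun n =>
      ⟨(hz' n).1, Submodule.zero_mem _, (hz' n).2⟩, ?_⟩
    erw [taylor_const_one, Ser.eval_const]
    rfl
  degree n i j y hy := by
    rw [cylRetraction, Ser.const]
    split_ifs
    · exact hy.2.1
    · exact Submodule.zero_mem _
  retraction := by
    erw [taylor_const_one]
    rw [cylRetraction, Ser.const_comp_const]
    rfl
  compatible a t := by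
    rw [← taylor_strict_comp, strict_cylRetraction_comp_d, taylor_sub, taylor_comp_strict]
    erw [taylor_const_ι_mul]
    rw [sub_zero]

lemma isConnecting_cyl : IsConnecting (cylOut f) (cylRetraction f) (coneOut f) := by
  change _ = M.d.comp (Ser.strict A.carrier (cylRetraction f)) -
    (Ser.strict A.carrier (cylRetraction f)).comp (cyl f).d
  rw [strict_cylRetraction_comp_d, sub_sub_cancel, ser_cylOut]
  exact Ser.fst_lift _ _

end Cylinder

/-! ### The distinguished triangles -/

variable (e) in
-- Every semi-split triangle is a cone triangle by the equivalence `M'' ≃ C(f)`, and every cone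
-- triangle is the semi-split triangle of the cylinder. The axioms can thus be checked on cones of
-- arbitrary, not necessarily strict, morphisms.
lemma mem_semiSplitTriangles_iff (T : Triangle (HoCat e)) : T ∈ semiSplitTriangles e ↔
    ∃ (M N : TopMod e) (f : M ⟶ N),
      Nonempty (T ≅ (hoFunctor e).mapTriangle.obj (coneTriangle f)) := by
  constructor
  · rintro ⟨M, M', M'', f, g, ρ, h, H, hh, ⟨i⟩⟩
    obtain ⟨σ, hσ⟩ := H.exists_isSplit hh
    obtain ⟨j⟩ := hσ.nonempty_iso_coneTriangle
    exact ⟨M, M', f, ⟨i ≪≫ j⟩⟩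
  · rintro ⟨M, N, f, ⟨i⟩⟩
    obtain ⟨j⟩ := nonempty_iso_cylTriangle f
    exact ⟨M, cyl f, cone f, cylIn f, cylOut f, cylRetraction f, coneOut f, isSemiSplit_cyl f,
      isConnecting_cyl f, ⟨i ≪≫ j⟩⟩

lemma coneTriangle_mem {M N : TopMod e} (f : M ⟶ N) :
    (hoFunctor e).mapTriangle.obj (coneTriangle f) ∈ semiSplitTriangles e :=
  (mem_semiSplitTriangles_iff e _).2 ⟨M, N, f, ⟨Iso.refl _⟩⟩

lemma isomorphic_mem (T₁ : Triangle (HoCat e)) (hT₁ : T₁ ∈ semiSplitTriangles e)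
    (T₂ : Triangle (HoCat e)) (i : T₂ ≅ T₁) : T₂ ∈ semiSplitTriangles e := by
  obtain ⟨M, M', M'', f, g, ρ, h, H, hh, ⟨j⟩⟩ := hT₁
  exact ⟨M, M', M'', f, g, ρ, h, H, hh, ⟨i ≪≫ j⟩⟩

lemma isZero_cone_id (M : TopMod e) : IsZero ((hoFunctor e).obj (cone (𝟙 M))) := by
  rw [IsZero.iff_id_eq_zero, ← CategoryTheory.Functor.map_id, ← (hoFunctor e).map_zero]
  refine hoFunctor_map_eq ((isPreHom_cone_inl (𝟙 M)).comp (isPreHom_cone_snd (𝟙 M)) (by omega)) ?_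
  rw [cone_d]
  exact Ser.contractible_cone M.d

lemma contractible_mem (X : HoCat e) : contractibleTriangle X ∈ semiSplitTriangles e := by
  obtain ⟨M⟩ := X
  refine isomorphic_mem _ (coneTriangle_mem (𝟙 M)) _ ?_
  have h := isZero_cone_id M
  refine Triangle.isoMk _ _ (Iso.refl _) (Iso.refl _) h.isoZero.symm ?_ (h.eq_of_tgt _ _)
    ((isZero_zero (HoCat e)).eq_of_src _ _)
  exact (Category.comp_id _).trans (((hoFunctor e).map_id M).symm.trans (Category.id_comp _).symm)

lemma exists_cocone {X Y : HoCat e} (f : X ⟶ Y) :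
    ∃ (Z : HoCat e) (g : Y ⟶ Z) (h : Z ⟶ X⟦(1 : ℤ)⟧), Triangle.mk f g h ∈ semiSplitTriangles e := by
  obtain ⟨X⟩ := X
  obtain ⟨Y⟩ := Y
  obtain ⟨f, rfl⟩ := (hoFunctor e).map_surjective f
  exact ⟨_, _, _, coneTriangle_mem f⟩

/-- The rotated cone triangle is the triangle of the split sequence `N → C(f) → M[1]`. Its
connecting map `-f[1]` need not be strict, which is why splittings more general than semi-split ones
are allowed. -/
lemma rotate_mem (T : Triangle (HoCat e)) (hT : T ∈ semiSplitTriangles e) :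
    T.rotate ∈ semiSplitTriangles e := by
  obtain ⟨M, N, f, ⟨i⟩⟩ := (mem_semiSplitTriangles_iff e T).1 hT
  obtain ⟨j⟩ := (isSplit_cone f).nonempty_iso_coneTriangle
  exact (mem_semiSplitTriangles_iff e _).2 ⟨_, _, _, ⟨(rotate _).mapIso i ≪≫
    ((hoFunctor e).mapTriangleRotateIso).app (coneTriangle f) ≪≫ j⟩⟩

/-- The inverse rotation of a semi-split triangle is the cone triangle of `-h[-1]`. -/
lemma invRotate_mem (T : Triangle (HoCat e)) (hT : T ∈ semiSplitTriangles e) :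
    T.invRotate ∈ semiSplitTriangles e := by
  obtain ⟨M, M', M'', f, g, ρ, h, H, hh, ⟨i⟩⟩ := hT
  obtain ⟨σ, hσ⟩ := H.exists_isSplit hh
  obtain ⟨j⟩ := hσ.nonempty_iso_invRotate
  exact (mem_semiSplitTriangles_iff e _).2 ⟨_, _, _, ⟨(invRotate _).mapIso i ≪≫
    ((hoFunctor e).mapTriangleInvRotateIso).app (Triangle.mk f g h) ≪≫ j⟩⟩

lemma rotate_mem_iff (T : Triangle (HoCat e)) :
    T ∈ semiSplitTriangles e ↔ T.rotate ∈ semiSplitTriangles e :=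
  ⟨rotate_mem T, fun hT => isomorphic_mem _ (invRotate_mem _ hT) _
    ((triangleRotation _).unitIso.app T)⟩

/-- A square in the homotopy category commutes on representatives up to some homotopy, and this
homotopy is the off-diagonal entry of the induced map of cones. -/
lemma exists_coneTriangle_hom {M N M' N' : TopMod e} (f : M ⟶ N) (f' : M' ⟶ N')
    (a : ((hoFunctor e).mapTriangle.obj (coneTriangle f)).obj₁ ⟶
      ((hoFunctor e).mapTriangle.obj (coneTriangle f')).obj₁)
    (b : ((hoFunctor e).mapTriangle.obj (coneTriangle f)).obj₂ ⟶
      ((hoFunctor e).mapTriangle.obj (coneTriangle f')).obj₂)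
    (fac : ((hoFunctor e).mapTriangle.obj (coneTriangle f)).mor₁ ≫ b =
      a ≫ ((hoFunctor e).mapTriangle.obj (coneTriangle f')).mor₁) :
    ∃ φ : (hoFunctor e).mapTriangle.obj (coneTriangle f) ⟶
      (hoFunctor e).mapTriangle.obj (coneTriangle f'), φ.hom₁ = a ∧ φ.hom₂ = b := by
  change (hoFunctor e).obj M ⟶ (hoFunctor e).obj M' at a
  change (hoFunctor e).obj N ⟶ (hoFunctor e).obj N' at b
  obtain ⟨a, rfl⟩ := (hoFunctor e).map_surjective a
  obtain ⟨b, rfl⟩ := (hoFunctor e).map_surjective b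
  have fac' : (hoFunctor e).map (f ≫ b) = (hoFunctor e).map (a ≫ f') := fac
  obtain ⟨H, hH, h⟩ := (CategoryTheory.Quotient.functor_map_eq_iff (homotopic e) _ _).1 fac'
  exact ⟨hoTriangleHom (T₁ := coneTriangle f) (T₂ := coneTriangle f') a b (coneMap f f' a b hH h)
    fac' (congrArg _ (coneIn_coneMap f f' a b hH h))
    (congrArg _ (coneMap_coneOut f f' a b hH h).symm), rfl, rfl⟩

lemma exists_triangle_hom_of_iso {T₁ T₂ T₁' T₂' : Triangle (HoCat e)} (i₁ : T₁ ≅ T₁')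
    (i₂ : T₂ ≅ T₂')
    (h : ∀ (a : T₁'.obj₁ ⟶ T₂'.obj₁) (b : T₁'.obj₂ ⟶ T₂'.obj₂), T₁'.mor₁ ≫ b = a ≫ T₂'.mor₁ →
      ∃ φ : T₁' ⟶ T₂', φ.hom₁ = a ∧ φ.hom₂ = b)
    (a : T₁.obj₁ ⟶ T₂.obj₁) (b : T₁.obj₂ ⟶ T₂.obj₂) (fac : T₁.mor₁ ≫ b = a ≫ T₂.mor₁) :
    ∃ φ : T₁ ⟶ T₂, φ.hom₁ = a ∧ φ.hom₂ = b := by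
  obtain ⟨φ, h₁, h₂⟩ := h (i₁.inv.hom₁ ≫ a ≫ i₂.hom.hom₁) (i₁.inv.hom₂ ≫ b ≫ i₂.hom.hom₂) (by
    rw [i₁.inv.comm₁_assoc, reassoc_of% fac, i₂.hom.comm₁]
    simp only [Category.assoc])
  exact ⟨i₁.hom ≫ φ ≫ i₂.inv, by simp [h₁], by simp [h₂]⟩

lemma exists_triangle_hom (T₁ T₂ : Triangle (HoCat e)) (hT₁ : T₁ ∈ semiSplitTriangles e)
    (hT₂ : T₂ ∈ semiSplitTriangles e) (a : T₁.obj₁ ⟶ T₂.obj₁) (b : T₁.obj₂ ⟶ T₂.obj₂)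
    (fac : T₁.mor₁ ≫ b = a ≫ T₂.mor₁) :
    ∃ c : T₁.obj₃ ⟶ T₂.obj₃, T₁.mor₂ ≫ c = b ≫ T₂.mor₂ ∧ T₁.mor₃ ≫ a⟦(1 : ℤ)⟧' = c ≫ T₂.mor₃ := by
  obtain ⟨M₁, N₁, f₁, ⟨i₁⟩⟩ := (mem_semiSplitTriangles_iff e T₁).1 hT₁
  obtain ⟨M₂, N₂, f₂, ⟨i₂⟩⟩ := (mem_semiSplitTriangles_iff e T₂).1 hT₂
  obtain ⟨φ, rfl, rfl⟩ := exists_triangle_hom_of_iso i₁ i₂ (exists_coneTriangle_hom f₁ f₂) a b fac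
  exact ⟨φ.hom₃, φ.comm₂, φ.comm₃⟩

section Octahedron

variable {X Y Z : TopMod e} (f : X ⟶ Y) (g : Y ⟶ Z)

/-- The morphism from the cone triangle of `f` to that of `f ≫ g`. -/
def coneCompRightHom : (hoFunctor e).mapTriangle.obj (coneTriangle f) ⟶
    (hoFunctor e).mapTriangle.obj (coneTriangle (f ≫ g)) :=
  hoTriangleHom (T₁ := coneTriangle f) (T₂ := coneTriangle (f ≫ g)) (𝟙 X) g (coneCompRight f g)
    (congrArg _ (Category.id_comp (f ≫ g)).symm) (congrArg _ (coneIn_coneMap _ _ _ _ _ _))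
    (congrArg _ (coneMap_coneOut _ _ _ _ _ _).symm)

/-- The morphism from the cone triangle of `f ≫ g` to that of `g`. -/
def coneCompLeftHom : (hoFunctor e).mapTriangle.obj (coneTriangle (f ≫ g)) ⟶
    (hoFunctor e).mapTriangle.obj (coneTriangle g) :=
  hoTriangleHom (T₁ := coneTriangle (f ≫ g)) (T₂ := coneTriangle g) f (𝟙 Z) (coneCompLeft f g)
    (congrArg _ (Category.comp_id (f ≫ g))) (congrArg _ (coneIn_coneMap _ _ _ _ _ _))
    (congrArg _ (coneMap_coneOut _ _ _ _ _ _).symm)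

lemma hoFunctor_map_comp_shift {P Q : TopMod e} (p : P ⟶ Q⟦(1 : ℤ)⟧) {Q' : TopMod e}
    (q : Q ⟶ Q') :
    (hoFunctor e).map (p ≫ q⟦(1 : ℤ)⟧') ≫ ((hoFunctor e).commShiftIso (1 : ℤ)).hom.app Q' =
      ((hoFunctor e).map p ≫ ((hoFunctor e).commShiftIso (1 : ℤ)).hom.app Q) ≫
        ((hoFunctor e).map q)⟦(1 : ℤ)⟧' := by
  rw [Functor.map_comp, Category.assoc, Functor.commShiftIso_hom_naturality, Category.assoc]

lemma coneCompTriangle_mem : Triangle.mk ((hoFunctor e).map (coneCompRight f g))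
    ((hoFunctor e).map (coneCompLeft f g))
    (((hoFunctor e).mapTriangle.obj (coneTriangle g)).mor₃ ≫
      (((hoFunctor e).map (coneIn f))⟦(1 : ℤ)⟧')) ∈ semiSplitTriangles e := by
  have h := (mem_semiSplitTriangles_iff e _).2 ⟨_, _, _, nonempty_iso_coneCompTriangle f g⟩
  -- The two triangles differ in the third arrow only: there the shift is applied before or after
  -- passing to homotopy classes.
  exact (congrArg (fun x => Triangle.mk ((hoFunctor e).map (coneCompRight f g))
    ((hoFunctor e).map (coneCompLeft f g)) x ∈ semiSplitTriangles e)
    (hoFunctor_map_comp_shift (coneOut g) (coneIn f))).mp h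

end Octahedron

end TopMod

open TopMod

variable (e) in
/-- The homotopy category of `A∞`-modules, with the triangles of semi-split sequences. -/
abbrev pretriangulatedHoCat : Pretriangulated (HoCat e) where
  distinguishedTriangles := semiSplitTriangles e
  isomorphic_distinguished := isomorphic_mem
  contractible_distinguished := contractible_mem
  distinguished_cocone_triangle := exists_cocone
  rotate_distinguished_triangle := rotate_mem_iff
  complete_distinguished_triangle_morphism := exists_triangle_hom

attribute [local instance] pretriangulatedHoCat

/-- It suffices to exhibit one octahedron for each composable pair, so representatives and their
cone triangles may be chosen. The equivalence of `C(g)` with the cone of `C(f) → C(f ≫ g)` supplies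
the new triangle. -/
lemma isTriangulated_hoCat : IsTriangulated (HoCat e) := IsTriangulated.mk' (by
  rintro ⟨X₁⟩ ⟨X₂⟩ ⟨X₃⟩ u v
  obtain ⟨u, rfl⟩ := (hoFunctor e).map_surjective u
  obtain ⟨v, rfl⟩ := (hoFunctor e).map_surjective v
  refine ⟨_, _, _, _, _, _, _, _, Iso.refl _, Iso.refl _, Iso.refl _,
    (Category.comp_id _).trans (Category.id_comp _).symm,
    (Category.comp_id _).trans (Category.id_comp _).symm,
    _, _, coneTriangle_mem u, _, _, coneTriangle_mem v, _, _, coneTriangle_mem (u ≫ v), ⟨?_⟩⟩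
  refine Triangulated.Octahedron.mk ((hoFunctor e).map (coneCompRight u v))
    ((hoFunctor e).map (coneCompLeft u v)) (coneCompRightHom u v).comm₂ ?_ ?_
    (coneCompLeftHom u v).comm₃ (coneCompTriangle_mem u v)
  · refine (coneCompRightHom u v).comm₃.symm.trans ?_
    change _ ≫ ((hoFunctor e).map (𝟙 X₁))⟦(1 : ℤ)⟧' = _
    rw [CategoryTheory.Functor.map_id, CategoryTheory.Functor.map_id]
    exact Category.comp_id _
  · refine (coneCompLeftHom u v).comm₂.trans ?_
    change (hoFunctor e).map (𝟙 X₃) ≫ _ = _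
    rw [CategoryTheory.Functor.map_id]
    exact Category.id_comp _)

end

end TopAInf

namespace TopAInf

noncomputable section

open BigradedSpace

variable {K : Type u} [Field K] {A : TopAInfAlg K} {e : A.StrictUnit}

namespace TopMod

/-! ### The underlying complexes -/

/-- `f` sends `m ⊗ 1` to `f⁰ m ⊗ 1`. -/
def PreservesCogenerators {M N : TopMod e} (f : Ser K M.R N.R) : Prop :=
  ∀ n m, f n (m ⊗ₜ 1) = taylor f 1 n m ⊗ₜ 1

lemma coact_tmul_one {M : TopMod e} (m : M.carrier) :
    coact K A.carrier M.carrier (m ⊗ₜ 1) = (m ⊗ₜ 1) ⊗ₜ 1 := by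
  simp [coact, deconc_one]

/-- Elements with trivial coaction come from cogenerators, because projecting the coaction to
cogenerators recovers the element. -/
lemma eq_toCogen_tmul_one {N : TopMod e} {x : N.R}
    (hx : coact K A.carrier N.carrier x = x ⊗ₜ 1) :
    x = toCogen K A.carrier N.carrier x ⊗ₜ 1 := by
  have h := cogen_coact x
  rw [hx, LinearMap.rTensor_tmul] at h
  exact h.symm

lemma IsPreHom.preservesCogenerators {M N : TopMod e} {r : ℤ} {f : Ser K M.R N.R}
    (hf : IsPreHom M N r f) : PreservesCogenerators f := by
  intro n m
  refine eq_toCogen_tmul_one ?_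
  have h := LinearMap.congr_fun (hf.comodule n) (m ⊗ₜ 1)
  rwa [LinearMap.comp_apply, LinearMap.comp_apply, coact_tmul_one, LinearMap.rTensor_tmul] at h

/-- Flatness enters here: the coaction of `d (m ⊗ 1)` has an additional term containing `d_A 1`,
which vanishes. Without it `d⁰` need not square to zero. -/
lemma preservesCogenerators_d (hA : A.IsFlat) (M : TopMod e) : PreservesCogenerators M.d := by
  intro n m
  refine eq_toCogen_tmul_one ?_
  have h := LinearMap.congr_fun (M.d_coderivation n) (m ⊗ₜ 1)
  rwa [LinearMap.comp_apply, LinearMap.comp_apply, coact_tmul_one, LinearMap.add_apply,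
    TensorProduct.map_tmul, TensorProduct.map_tmul, hA n, tmul_zero, add_zero,
    LinearMap.id_apply] at h

/-- If `f` preserves `m ⊗ 1`, higher Taylor components of `g` never meet the composite, so passing
to linear parts is functorial. -/
lemma taylor_comp {M N P : TopMod e} (g : Ser K N.R P.R) {f : Ser K M.R N.R}
    (hf : PreservesCogenerators f) :
    taylor (M := M) (N := P) (g.comp f) 1 = (taylor g 1).comp (taylor f 1) := by
  funext n
  ext m
  simp only [taylor_apply, Ser.comp, LinearMap.sum_apply, LinearMap.comp_apply, map_sum]
  exact Finset.sum_congr rfl fun p _ => congrArg (fun x => toCogen K A.carrier P.carrier (g p.1 x))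
    (hf p.2 m)

lemma taylor_id (M : TopMod e) :
    taylor (M := M) (N := M) (Ser.const LinearMap.id) 1 = Ser.const LinearMap.id := by
  rw [← Ser.strict_id, taylor_strict_one]

/-- The differential `d⁰` of the complex underlying `M`. -/
abbrev diff (M : TopMod e) : Ser K M.carrier M.carrier := taylor M.d 1

lemma diff_eval_hom (hA : A.IsFlat) {M N : TopMod e} (f : M ⟶ N) (x : ℕ → M.carrier) :
    N.diff.eval ((taylor f.ser 1).eval x) = (taylor f.ser 1).eval (M.diff.eval x) := by
  rw [← Ser.eval_comp, ← taylor_comp _ f.isPreHom.preservesCogenerators, f.comm,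
    taylor_comp _ (preservesCogenerators_d hA M), Ser.eval_comp]

/-! ### Acyclic modules -/

/-- The complex underlying `M` is acyclic in every bidegree. -/
def IsAcyclic (M : TopMod e) : Prop :=
  ∀ i j, ∀ x ∈ M.seriesGr i j, M.diff.eval x = 0 → ∃ y ∈ M.seriesGr (i - 1) j, M.diff.eval y = x

/-- Acyclicity passes to retracts up to homotopy. -/
lemma IsAcyclic.of_retract (hA : A.IsFlat) {M N : TopMod e} (f : M ⟶ N) (g : N ⟶ M)
    (hfg : homotopic e (f ≫ g) (𝟙 M)) (hN : N.IsAcyclic) : M.IsAcyclic := by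
  intro i j x hx hdx
  obtain ⟨H, hH, h⟩ := hfg
  obtain ⟨y, hy, hyx⟩ := hN i j _ (taylor_eval_mem f hx) (by rw [diff_eval_hom hA, hdx, map_zero])
  -- On a cocycle `x` the homotopy gives `g f x - x = d H x`. With `f x = d y` this becomes `x = d
  -- (g y - H x)`.
  have h₁ := congrArg (fun s => (taylor s 1).eval x) h
  simp only [taylor_sub, taylor_add, ser_comp, ser_id, taylor_id,
    taylor_comp _ f.isPreHom.preservesCogenerators, taylor_comp _ hH.preservesCogenerators,
    taylor_comp _ (preservesCogenerators_d hA M), Ser.eval_sub, Ser.eval_add, Ser.eval_comp, hdx,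
    map_zero, add_zero, ← hyx, ← diff_eval_hom hA, Ser.eval_const] at h₁
  refine ⟨(taylor g.ser 1).eval y - (taylor H 1).eval x, sub_mem (taylor_eval_mem g hy)
    (eval_mem_seriesGr (fun n _ hm => taylor_one_mem hH.degree rfl n hm) hx), ?_⟩
  rw [map_sub, ← h₁, sub_sub_cancel]
  rfl

lemma IsAcyclic.shift {M : TopMod e} (hM : M.IsAcyclic) (a : ℤ) : (M.shiftObj a).IsAcyclic := by
  have hd : ∀ x : ℕ → M.carrier, (M.shiftObj a).diff.eval x = (-1 : K) ^ a • M.diff.eval x := by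
    intro x
    have : (M.shiftObj a).diff = (-1 : K) ^ a • M.diff := by
      funext n
      ext m
      exact map_smul (toCogen K A.carrier M.carrier) ((-1 : K) ^ a) (M.d n (m ⊗ₜ 1))
    rw [this]
    funext n
    simp [Ser.eval_apply, Finset.smul_sum]
  have hu : (-1 : K) ^ a * (-1 : K) ^ a = 1 := by rw [← mul_zpow]; simp
  intro i j x hx hdx
  rw [hd] at hdx
  have hdx' : M.diff.eval x = 0 := by
    have := congrArg (fun y => (-1 : K) ^ a • y) hdx
    simpa only [smul_smul, hu, one_smul, smul_zero] using this
  obtain ⟨y, hy, hyx⟩ := hM (i + a) j x hx hdx'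
  refine ⟨(-1 : K) ^ a • y, Submodule.smul_mem _ _ ?_, ?_⟩
  · change y ∈ M.seriesGr (i - 1 + a) j
    rwa [show i - 1 + a = i + a - 1 by omega]
  · rw [hd, map_smul, smul_smul, hu, one_smul, hyx]

section Cone

variable {M N : TopMod e} (f : M ⟶ N)

lemma fst_diff_cone (z : ℕ → M.carrier × N.carrier) :
    (fun n => ((cone f).diff.eval z n).1) = -M.diff.eval (fun n => (z n).1) := by
  have h : (Ser.const (LinearMap.fst K M.carrier N.carrier)).comp (cone f).diff =
      (-M.diff).comp (Ser.const (LinearMap.fst K M.carrier N.carrier)) := by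
    rw [← taylor_neg]
    refine (taylor_strict_comp (M := cone f) (N := cone f) (P := M) _ _ 1).symm.trans
      (Eq.trans ?_ (taylor_comp_strict (M := cone f) _ _ 1))
    rw [Ser.strict_const, cone_d]
    exact congrArg (fun s => taylor (M := cone f) (N := M) s 1) (Ser.fst_twisted _ _ _)
  have h₁ := congrArg (fun s => s.eval z) h
  simp only [Ser.eval_comp, Ser.eval_const, Ser.eval_neg] at h₁
  exact h₁

lemma snd_diff_cone (z : ℕ → M.carrier × N.carrier) :
    (fun n => ((cone f).diff.eval z n).2) =
      (taylor f.ser 1).eval (fun n => (z n).1) + N.diff.eval (fun n => (z n).2) := by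
  have h : (Ser.const (LinearMap.snd K M.carrier N.carrier)).comp (cone f).diff =
      (taylor f.ser 1).comp (Ser.const (LinearMap.fst K M.carrier N.carrier)) +
        N.diff.comp (Ser.const (LinearMap.snd K M.carrier N.carrier)) := by
    refine (taylor_strict_comp (M := cone f) (N := cone f) (P := N) _ _ 1).symm.trans
      (Eq.trans ?_ (congrArg₂ (· + ·) (taylor_comp_strict (M := cone f) f.ser _ 1)
        (taylor_comp_strict (M := cone f) N.d _ 1)))
    rw [Ser.strict_const, cone_d, ← taylor_add, Ser.strict_const]
    exact congrArg (fun s => taylor (M := cone f) (N := N) s 1) (Ser.snd_twisted _ _ _)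
  have h₁ := congrArg (fun s => s.eval z) h
  simp only [Ser.eval_comp, Ser.eval_const, Ser.eval_add] at h₁
  exact h₁

lemma diff_cone_eq_iff (z w : ℕ → M.carrier × N.carrier) : (cone f).diff.eval z = w ↔
    -M.diff.eval (fun n => (z n).1) = (fun n => (w n).1) ∧
      (taylor f.ser 1).eval (fun n => (z n).1) + N.diff.eval (fun n => (z n).2) =
        fun n => (w n).2 := by
  rw [← fst_diff_cone, ← snd_diff_cone]
  constructor
  · rintro rfl
    exact ⟨rfl, rfl⟩
  · rintro ⟨h₁, h₂⟩
    funext n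
    exact Prod.ext (congrFun h₁ n) (congrFun h₂ n)

lemma mem_seriesGr_cone {i j : ℤ} {z : ℕ → M.carrier × N.carrier} :
    z ∈ (cone f).seriesGr i j ↔
      (fun n => (z n).1) ∈ M.seriesGr (i + 1) j ∧ (fun n => (z n).2) ∈ N.seriesGr i j := by
  rw [mem_seriesGr, mem_seriesGr, mem_seriesGr]
  exact ⟨fun h => ⟨fun n => (h n).1, fun n => (h n).2⟩, fun h n => ⟨h.1 n, h.2 n⟩⟩

lemma IsQuasiIso.isAcyclic_cone (hA : A.IsFlat) (hf : IsQuasiIso f) : (cone f).IsAcyclic := by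
  intro i j z hz hdz
  obtain ⟨hx, hy⟩ := (mem_seriesGr_cone f).1 hz
  obtain ⟨h₁, h₂⟩ := (diff_cone_eq_iff f z 0).1 hdz
  have h₁' := neg_eq_zero.1 h₁
  have h₂' := eq_neg_of_add_eq_zero_left h₂
  -- A cocycle `(x, y)` of the cone satisfies `d x = 0` and `f x = -d y`, so `-y` bounds `f x` and
  -- injectivity provides `x = d x'`.
  obtain ⟨x', hx', hdx'⟩ := hf.injective (i + 1) j _ hx h₁'
    ⟨-fun n => (z n).2, neg_mem (by rwa [add_sub_cancel_right]), by rw [map_neg, h₂']⟩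
  rw [add_sub_cancel_right] at hx'
  -- Now `y + f x'` is a cocycle, hence equal to `f x'' + d y''` with `d x'' = 0`; the primitive of
  -- `(x, y)` is `(x'' - x', y'')`.
  obtain ⟨x'', hx'', hdx'', y'', hy'', h⟩ := hf.surjective i j
    ((fun n => (z n).2) + (taylor f.ser 1).eval x') (add_mem hy (taylor_eval_mem f hx'))
    (by rw [map_add, diff_eval_hom hA, hdx', h₂', add_neg_cancel])
  refine ⟨fun n => ((x'' - x') n, y'' n), (mem_seriesGr_cone f).2 ⟨?_, hy''⟩,
    (diff_cone_eq_iff f _ _).2 ⟨?_, ?_⟩⟩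
  · rw [sub_add_cancel]
    exact sub_mem hx'' hx'
  · change -M.diff.eval (x'' - x') = _
    rw [map_sub, hdx'', hdx', zero_sub, neg_neg]
  · change (taylor f.ser 1).eval (x'' - x') + N.diff.eval y'' = _
    rw [map_sub, sub_add_eq_add_sub, ← h, add_sub_cancel_right]

lemma IsAcyclic.isQuasiIso (hf : (cone f).IsAcyclic) : IsQuasiIso f where
  injective i j x hx hdx := by
    rintro ⟨y, hy, hyx⟩
    -- If `d y = f x` then `(x, -y)` is a cocycle of the cone. The first component of a primitive,
    -- with opposite sign, bounds `x`.
    obtain ⟨z, hz, hdz⟩ := hf (i - 1) j (fun n => (x n, (-y) n))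
      ((mem_seriesGr_cone f).2 ⟨by rwa [sub_add_cancel], neg_mem hy⟩)
      ((diff_cone_eq_iff f _ _).2 ⟨neg_eq_zero.2 hdx, by
        change (taylor f.ser 1).eval x + N.diff.eval (-y) = 0
        rw [map_neg, hyx, add_neg_cancel]⟩)
    have h := ((mem_seriesGr_cone f).1 hz).1
    rw [sub_add_cancel] at h
    refine ⟨-fun n => (z n).1, neg_mem h, ?_⟩
    rw [map_neg]
    exact ((diff_cone_eq_iff f _ _).1 hdz).1
  surjective i j y hy hdy := by
    -- A cocycle `y` of `N` gives the cocycle `(0, y)` of the cone; a primitive of it consists of a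
    -- cocycle of `M` and a correcting boundary.
    obtain ⟨z, hz, hdz⟩ := hf i j (fun n => (0, y n))
      ((mem_seriesGr_cone f).2 ⟨zero_mem _, hy⟩)
      ((diff_cone_eq_iff f _ _).2 ⟨by
        change -M.diff.eval 0 = 0
        rw [map_zero, neg_zero], by
        change (taylor f.ser 1).eval 0 + N.diff.eval y = 0
        rw [map_zero, hdy, zero_add]⟩)
    obtain ⟨hx, hy'⟩ := (mem_seriesGr_cone f).1 hz
    obtain ⟨h₁, h₂⟩ := (diff_cone_eq_iff f _ _).1 hdz
    rw [sub_add_cancel] at hx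
    exact ⟨_, hx, neg_eq_zero.1 h₁, _, hy', h₂.symm⟩

lemma isQuasiIso_of_isAcyclic (hM : M.IsAcyclic) (hN : N.IsAcyclic) : IsQuasiIso f where
  injective i j x hx hdx _ := hM i j x hx hdx
  surjective i j y hy hdy := by
    obtain ⟨y', hy', h⟩ := hN i j y hy hdy
    exact ⟨0, zero_mem _, map_zero _, y', hy', by rw [map_zero, zero_add, h]⟩

lemma isQuasiIso_id (M : TopMod e) : IsQuasiIso (𝟙 M) where
  injective i j x hx hdx := by
    rintro ⟨y, hy, h⟩
    refine ⟨y, hy, h.trans ?_⟩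
    rw [ser_id, taylor_id, Ser.eval_const]
    rfl
  surjective i j y hy hdy := ⟨y, hy, hdy, 0, zero_mem _, by
    rw [ser_id, taylor_id, Ser.eval_const, map_zero, add_zero]
    rfl⟩

end Cone

end TopMod

/-! ### Quasi-isomorphisms in the homotopy category -/

open TopMod

variable (e) in
/-- The acyclic modules, as a property of objects of the homotopy category. -/
def acyclic : ObjectProperty (HoCat e) := fun X => X.as.IsAcyclic

/-- An isomorphism in the homotopy category exhibits each module as a retract of the other up to
homotopy. -/
lemma isClosedUnderIsomorphisms_acyclic (hA : A.IsFlat) :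
    (acyclic e).IsClosedUnderIsomorphisms where
  of_iso {X Y} i hX := by
    obtain ⟨X⟩ := X
    obtain ⟨Y⟩ := Y
    obtain ⟨f, hf⟩ := (hoFunctor e).map_surjective i.inv
    obtain ⟨g, hg⟩ := (hoFunctor e).map_surjective i.hom
    refine IsAcyclic.of_retract hA f g
      ((CategoryTheory.Quotient.functor_map_eq_iff (homotopic e) _ _).1 ?_) hX
    refine ((hoFunctor e).map_comp f g).trans ?_
    rw [hf, hg]
    exact i.inv_hom_id

lemma isStableUnderShift_acyclic (hA : A.IsFlat) : (acyclic e).IsStableUnderShift ℤ where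
  isStableUnderShiftBy a :=
    { le_shift := by
        rintro ⟨M⟩ hM
        have := isClosedUnderIsomorphisms_acyclic (e := e) hA
        exact (acyclic e).prop_of_iso (((hoFunctor e).commShiftIso a).app M)
          (IsAcyclic.shift hM a) }

attribute [local instance] pretriangulatedHoCat

/-- A map between acyclic modules is a quasi-isomorphism, so its cone is acyclic. Every
distinguished triangle is a cone triangle, and closure at the third vertex implies closure at the
second by shift stability. -/
lemma isTriangulated_acyclic (hA : A.IsFlat) : (acyclic e).IsTriangulated := by
  have h₁ := isClosedUnderIsomorphisms_acyclic (e := e) hA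
  have h₂ := isStableUnderShift_acyclic (e := e) hA
  have h₃ : (acyclic e).IsTriangulatedClosed₃ := .mk' fun T hT hM hN => by
    obtain ⟨M, N, f, ⟨i⟩⟩ := (mem_semiSplitTriangles_iff e T).1 hT
    have hM' : M.IsAcyclic := (acyclic e).prop_of_iso (Triangle.π₁.mapIso i) hM
    have hN' : N.IsAcyclic := (acyclic e).prop_of_iso (Triangle.π₂.mapIso i) hN
    exact (acyclic e).prop_of_iso (Triangle.π₃.mapIso i.symm)
      ((isQuasiIso_of_isAcyclic f hM' hN').isAcyclic_cone f hA)
  exact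
    { exists_zero := ⟨_, isZero_cone_id (zeroMod e), (isQuasiIso_id _).isAcyclic_cone _ hA⟩
      isStableUnderShiftBy := h₂.isStableUnderShiftBy
      ext₂' := (ObjectProperty.IsTriangulatedClosed₂.of_isTriangulatedClosed₃
        (P := acyclic e)).ext₂' }

/-- Both classes consist of the morphisms with acyclic cone. In particular being a quasi-isomorphism
does not depend on the representative of a homotopy class. -/
lemma qis_eq_trW (hA : A.IsFlat) : qis e = (acyclic e).trW := by
  have := isClosedUnderIsomorphisms_acyclic (e := e) hA
  ext X Y φ
  obtain ⟨X⟩ := X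
  obtain ⟨Y⟩ := Y
  have key : ∀ f : X ⟶ Y, (acyclic e).trW ((hoFunctor e).map f) ↔ (cone f).IsAcyclic := fun f =>
    (acyclic e).trW_iff_of_distinguished _ (coneTriangle_mem f)
  constructor
  · rintro ⟨f, rfl, hf⟩
    exact (key f).2 (hf.isAcyclic_cone f hA)
  · intro hφ
    obtain ⟨f, rfl⟩ := (hoFunctor e).map_surjective φ
    exact ⟨f, rfl, ((key f).1 hφ).isQuasiIso f⟩

end

end TopAInf

theorem mainTheorem6 {K : Type u} [Field K] (A : TopAInfAlg K) (hA : A.IsFlat)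
    (e : A.StrictUnit) :
    (∀ (M M' M'' : TopMod e) (f : M ⟶ M') (g : M' ⟶ M'') (ρ : Ser K M'.carrier M.carrier),
      TopMod.IsSemiSplit f g ρ → ∃! h : M'' ⟶ M.shiftObj 1, TopMod.IsConnecting g ρ h) ∧
    ∃ _ : Pretriangulated (HoCat e),
      (distTriang (HoCat e)) = semiSplitTriangles e ∧
      IsTriangulated (HoCat e) ∧
      (∀ (M N : TopMod e) (f : M ⟶ N),
        (hoFunctor e).mapTriangle.obj (TopMod.coneTriangle f) ∈ distTriang (HoCat e)) ∧
      (∀ (M N : TopMod e) (f : M ⟶ N),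
        (hoFunctor e).mapTriangle.obj (TopMod.cylTriangle f) ∈ distTriang (HoCat e)) ∧
      ∃ (_ : (qis e).HasLeftCalculusOfFractions) (_ : (qis e).HasRightCalculusOfFractions)
        (_ : (qis e).IsCompatibleWithTriangulation),
        (distTriang (qis e).Localization) = (qis e).Q.essImageDistTriang ∧
        IsTriangulated (qis e).Localization := by
  refine ⟨fun M M' M'' f g ρ H => H.existsUnique_connecting, pretriangulatedHoCat e, rfl,
    isTriangulated_hoCat, fun M N f => TopMod.coneTriangle_mem f, fun M N f =>
      ⟨_, _, _, _, _, _, _, TopMod.isSemiSplit_cyl f, TopMod.isConnecting_cyl f, ⟨Iso.refl _⟩⟩, ?_⟩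
  let _ := pretriangulatedHoCat e
  have h₁ : IsTriangulated (HoCat e) := isTriangulated_hoCat
  have h₂ : (acyclic e).IsTriangulated := isTriangulated_acyclic hA
  -- For the class of morphisms whose cone lies in a triangulated subcategory, the calculus of
  -- fractions, the compatibility and the triangulated structure on the localization are the general
  -- Verdier quotient results; the distinguished triangles there are by definition the essential
  -- image.
  rw [qis_eq_trW hA]
  exact ⟨inferInstance, inferInstance, inferInstance, rfl, inferInstance⟩
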